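/- **Proposition (Beale–Kato–Majda type criterion).** Let $a, g > 0$ and let $C^\infty(\mathbb{T})$ denote the smooth $2\pi$-periodic functions on $\mathbb{R}$. For $f \in C^\infty(\mathbb{T})$ put $$H_a f(x) := \mathrm{P.V.}\int_{\mathbb{R}} f(x-y)\,K_a(y)\,dy = \lim_{\varepsilon\to 0^+}\int_{|y|>\varepsilon} f(x-y)\,K_a(y)\,dy, \qquad K_a(y) := \frac{1}{\pi y}\,\frac{a^2}{y^2+a^2}.$$ Let $\rho_0 \in C^\infty(\mathbb{T})$, let $0 < T_* < \infty$, and let $\rho \in C^\infty(\mathbb{T}\times[0,T_*))$ (smooth up to and including $t = 0$) be a solution of the one-dimensional IPM model $$\partial_t \rho + u\,\partial_x\rho = 0, \qquad u = g\,H_a\rho, \qquad \rho(\cdot,0) = \rho_0$$ on $\mathbb{T}\times[0,T_*)$. Suppose that $\rho$ cannot be continued smoothly past $T_*$, that is, for no $T' > T_*$ is there a solution $\rho' \in C^\infty(\mathbb{T}\times[0,T'))$ of the model with initial data $\rho_0$ such that $\rho' = \rho$ on $\mathbb{T}\times[0,T_*)$. Then $s \mapsto \|\partial_x\rho(\cdot,s)\|_\infty$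 is integrable on $[0,t]$ for every $0 \le t < T_*$, and $$\lim_{t\to T_*^-}\int_0^t \|\partial_x\rho(\cdot,s)\|_\infty\,ds = \infty.$$ -/

import Mathlib

open Set Filter Topology MeasureTheory
open scoped ContDiff

namespace IPM1D

/-- The kernel `K_a(y) = (1 / (π y)) * a² / (y² + a²)`. -/
noncomputable def kernel (a y : ℝ) : ℝ := 1 / (Real.pi * y) * (a ^ 2 / (y ^ 2 + a ^ 2))

/-- The truncated integral `∫_{|y| > ε} f (x - y) K_a(y) dy`. -/
noncomputable def truncHa (a : ℝ) (f : ℝ → ℝ) (x ε : ℝ) : ℝ :=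
  ∫ y in {y : ℝ | ε < |y|}, f (x - y) * kernel a y

/-- `H_a f (x) = P.V. ∫_ℝ f (x - y) K_a(y) dy`, the limit of the truncated integrals as `ε → 0+`.
The limit exists for every `C¹` function of period `2π`; see `tendsto_truncHa` below. -/
noncomputable def Ha (a : ℝ) (f : ℝ → ℝ) (x : ℝ) : ℝ :=
  limUnder (𝓝[>] (0 : ℝ)) (truncHa a f x)

/-- The sup norm `‖f‖_∞` of a (bounded) function on the real line. -/
noncomputable def supNorm (f : ℝ → ℝ) : ℝ := ⨆ x : ℝ, |f x|

/-- `f ∈ C^∞(𝕋)`: smooth functions on the real line of period `2π`. -/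
def SmoothPeriodic (f : ℝ → ℝ) : Prop :=
  ContDiff ℝ ∞ f ∧ Function.Periodic f (2 * Real.pi)

/-- `ρ x t` is a solution in `C^∞(𝕋 × [0, T))` of
`∂ₜρ + u ∂ₓρ = 0`, `u = g H_a ρ`, `ρ(·, 0) = ρ₀`.
Smoothness is up to and including the initial time; at `t = 0` the time derivative is one-sided. -/
structure IsSmoothSolution (a g : ℝ) (ρ₀ : ℝ → ℝ) (T : ℝ) (ρ : ℝ → ℝ → ℝ) : Prop where
  smooth : ContDiffOn ℝ ∞ (fun p : ℝ × ℝ => ρ p.1 p.2) (univ ×ˢ Ico 0 T)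
  periodic : ∀ t ∈ Ico 0 T, Function.Periodic (fun x => ρ x t) (2 * Real.pi)
  initial : ∀ x, ρ x 0 = ρ₀ x
  equation : ∀ t ∈ Ico 0 T, ∀ x,
    derivWithin (fun s => ρ x s) (Ico 0 T) t
      + (g * Ha a (fun y => ρ y t) x) * deriv (fun y => ρ y t) x = 0

/-- The solution `ρ` on `[0, T)` can be continued smoothly past time `T`: for some `T' > T` there
is a solution in `C^∞(𝕋 × [0, T'))` with the same data which agrees with `ρ` on `[0, T)`. -/
def CanBeContinued (a g : ℝ) (ρ₀ : ℝ → ℝ) (T : ℝ) (ρ : ℝ → ℝ → ℝ) : Prop :=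
  ∃ T' > T, ∃ ρ' : ℝ → ℝ → ℝ, IsSmoothSolution a g ρ₀ T' ρ' ∧
    ∀ t ∈ Ico 0 T, ∀ x, ρ' x t = ρ x t

theorem integrable_lorentz {a : ℝ} (ha : 0 < a) :
    Integrable (fun y : ℝ => a ^ 2 / (y ^ 2 + a ^ 2)) := by
  have h := integrable_inv_one_add_sq.comp_div ha.ne'
  refine h.congr (Eventually.of_forall fun y => ?_)
  have : y ^ 2 + a ^ 2 ≠ 0 := by positivity
  simp only
  field_simp
  ring

theorem measurable_kernel (a : ℝ) : Measurable (kernel a) := by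
  unfold kernel; fun_prop

theorem abs_kernel_mul (a y : ℝ) (hy : y ≠ 0) :
    |kernel a y| * |y| = 1 / Real.pi * (a ^ 2 / (y ^ 2 + a ^ 2)) := by
  have h : kernel a y * y = 1 / Real.pi * (a ^ 2 / (y ^ 2 + a ^ 2)) := by
    unfold kernel
    rw [show 1 / (Real.pi * y) = 1 / Real.pi * y⁻¹ by rw [one_div, mul_inv, one_div]]
    have := inv_mul_cancel₀ hy
    linear_combination (1 / Real.pi * (a ^ 2 / (y ^ 2 + a ^ 2))) * this
  rw [← abs_mul, h, abs_of_nonneg (by have := Real.pi_pos; positivity)]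

theorem measurableSet_trunc (ε : ℝ) : MeasurableSet {y : ℝ | ε < |y|} :=
  measurableSet_lt measurable_const measurable_id.abs

theorem integrableOn_kernel {a ε : ℝ} (ha : 0 < a) (hε : 0 < ε) :
    IntegrableOn (kernel a) {y : ℝ | ε < |y|} := by
  refine Integrable.mono' (((integrable_lorentz ha).const_mul (1 / Real.pi / ε)).integrableOn)
    (measurable_kernel a).aestronglyMeasurable ?_
  refine (ae_restrict_iff' (measurableSet_trunc ε)).2 (Eventually.of_forall fun y hy => ?_)
  have hy' : ε < |y| := hy
  have h := abs_kernel_mul a y (abs_pos.1 (hε.trans hy'))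
  rw [Real.norm_eq_abs, div_mul_eq_mul_div, le_div_iff₀ hε, ← h]
  exact mul_le_mul_of_nonneg_left hy'.le (abs_nonneg _)

theorem integral_kernel_trunc (a ε : ℝ) : ∫ y in {y : ℝ | ε < |y|}, kernel a y = 0 := by
  rw [← integral_indicator (measurableSet_trunc ε)]
  set F := indicator {y : ℝ | ε < |y|} (kernel a) with hF
  have hodd : ∀ y, F (-y) = - F y := by
    intro y
    by_cases h : ε < |y|
    · simp [hF, h, kernel]
    · simp [hF, h]
  have h1 : ∫ y, F (-y) = ∫ y, F y := integral_neg_eq_self F volume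
  simp only [hodd, integral_neg] at h1
  linarith

theorem exists_lipschitz {f : ℝ → ℝ} (hf : ContDiff ℝ 1 f)
    (hp : Function.Periodic f (2 * Real.pi)) : ∃ L : ℝ, ∀ x y, |f x - f y| ≤ L * |x - y| := by
  have hc : Continuous (deriv f) := hf.continuous_deriv le_rfl
  have hp' : Function.Periodic (deriv f) (2 * Real.pi) := by
    intro x
    rw [← deriv_comp_add_const]
    congr 1
    exact funext hp
  obtain ⟨L, hL⟩ := (isCompact_Icc (a := (0 : ℝ)) (b := 2 * Real.pi)).exists_bound_of_continuousOn
    hc.continuousOn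
  refine ⟨L, fun x y => ?_⟩
  refine Convex.norm_image_sub_le_of_norm_deriv_le (s := univ) (C := L)
    (fun z _ => (hf.differentiable one_ne_zero) z) (fun z _ => ?_) convex_univ
    (mem_univ y) (mem_univ x)
  obtain ⟨w, hw, hzw⟩ := hp'.exists_mem_Ico₀ Real.two_pi_pos z
  rw [hzw]
  exact hL w ⟨hw.1, hw.2.le⟩

/-- The truncated integrals of a `C¹` function of period `2π` are absolutely convergent. -/
theorem integrableOn_trunc {a ε : ℝ} (ha : 0 < a) (hε : 0 < ε) {f : ℝ → ℝ} (hf : ContDiff ℝ 1 f)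
    (hp : Function.Periodic f (2 * Real.pi)) (x : ℝ) :
    IntegrableOn (fun y => f (x - y) * kernel a y) {y : ℝ | ε < |y|} := by
  obtain ⟨M, hM⟩ := (isCompact_Icc (a := (0 : ℝ)) (b := 2 * Real.pi)).exists_bound_of_continuousOn
    hf.continuous.continuousOn
  have hfc := hf.continuous
  refine (integrableOn_kernel ha hε).bdd_mul (c := M)
    (by fun_prop : Continuous fun y => f (x - y)).aestronglyMeasurable
    (Eventually.of_forall fun y => ?_)
  obtain ⟨w, hw, hzw⟩ := hp.exists_mem_Ico₀ Real.two_pi_pos (x - y)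
  rw [hzw]
  exact hM w ⟨hw.1, hw.2.le⟩

/-- The principal value defining `H_a f (x)` exists for `C¹` functions of period `2π`. -/
theorem tendsto_truncHa {a : ℝ} (ha : 0 < a) {f : ℝ → ℝ} (hf : ContDiff ℝ 1 f)
    (hp : Function.Periodic f (2 * Real.pi)) (x : ℝ) :
    Tendsto (truncHa a f x) (𝓝[>] (0 : ℝ)) (𝓝 (Ha a f x)) := by
  apply tendsto_nhds_limUnder
  obtain ⟨L, hL⟩ := exists_lipschitz hf hp
  have hfc := hf.continuous
  have hk := measurable_kernel a
  have hmeas : Measurable (fun y => (f (x - y) - f x) * kernel a y) :=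
    ((by fun_prop : Continuous fun y => f (x - y) - f x).measurable).mul hk
  refine ⟨∫ y, (f (x - y) - f x) * kernel a y, ?_⟩
  have key : ∀ ε > 0, ∫ y, indicator {y : ℝ | ε < |y|} (fun y => (f (x - y) - f x) * kernel a y) y
      = truncHa a f x ε := by
    intro ε hε
    rw [integral_indicator (measurableSet_trunc ε)]
    simp only [sub_mul]
    rw [integral_sub (integrableOn_trunc ha hε hf hp x)
      ((integrableOn_kernel ha hε).const_mul (f x)), integral_const_mul,
      integral_kernel_trunc, mul_zero, sub_zero, truncHa]
  refine Tendsto.congr' (eventually_nhdsWithin_of_forall fun ε hε => key ε hε) ?_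
  refine tendsto_integral_filter_of_dominated_convergence
    (fun y => L * (1 / Real.pi * (a ^ 2 / (y ^ 2 + a ^ 2)))) ?_ ?_ ?_ ?_
  · exact Eventually.of_forall fun ε =>
      (hmeas.indicator (measurableSet_trunc ε)).aestronglyMeasurable
  · refine eventually_nhdsWithin_of_forall fun ε hε => Eventually.of_forall fun y => ?_
    have hL0 : 0 ≤ L := by simpa using (abs_nonneg _).trans (hL 1 0)
    by_cases h : ε < |y|
    · have hy : y ≠ 0 := abs_pos.1 (lt_trans hε h)
      rw [indicator_of_mem (show y ∈ {y : ℝ | ε < |y|} from h), Real.norm_eq_abs, abs_mul,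
        ← abs_kernel_mul a y hy]
      have := hL (x - y) x
      rw [show x - y - x = -y by ring, abs_neg] at this
      calc |f (x - y) - f x| * |kernel a y| ≤ L * |y| * |kernel a y| :=
            mul_le_mul_of_nonneg_right this (abs_nonneg _)
        _ = L * (|kernel a y| * |y|) := by ring
    · rw [indicator_of_notMem (show y ∉ {y : ℝ | ε < |y|} from h), norm_zero]
      have := Real.pi_pos
      positivity
  · exact ((integrable_lorentz ha).const_mul _).const_mul _
  · refine Eventually.of_forall fun y => ?_
    refine tendsto_const_nhds.congr'
      (f₁ := fun _ : ℝ => (f (x - y) - f x) * kernel a y) ?_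
    by_cases hy : y = 0
    · refine Eventually.of_forall fun ε => ?_
      simp only [hy, indicator_apply]
      split_ifs <;> simp
    · filter_upwards [nhdsWithin_le_nhds (Iio_mem_nhds (abs_pos.2 hy))] with ε hε
      have hε' : ε < |y| := hε
      simp [indicator_apply, hε']

end IPM1D

/-! Suppose that `∫ ‖∂ₓρ‖_∞` stays bounded up to `T`. The plan is to bound `I(t) = ∫ (∂ₓ²ρ)²` near
`T`, and then to restart the equation so close to `T` that the new solution outlives `T`,
contradicting maximality.

A priori bound. Differentiating the equation twice and testing with `∂ₓ²ρ`, the transport term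
integrates by parts and no third derivative survives. What remains is `g H_a(∂ₓρ)` against
`(∂ₓ²ρ)²`, and `∂ₓρ · g H_a(∂ₓ²ρ)` against `∂ₓ²ρ`. On the Fourier side `H_a` multiplies by a symbol
of modulus at most `2` (`norm_multiplier_le`), so the second term is harmless in `L²`. The first
needs a sup bound of `H_a(∂ₓρ)`. A singular integral is not bounded on `L^∞`, but the loss is only
logarithmic in a stronger norm (`SmoothPeriodic.abs_Ha_le_log`). With `b = ‖∂ₓρ‖_∞` this gives `I' ≤
C (1 + b) (1 + log (1 + I)) I`, which is linear for `1 + log (1 + I)`; integrability of `b`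
therefore bounds `I` (`IsSol.exists_integral_sq_le`).

Local existence with a lifespan depending only on `I` (`exists_local_solution`). The equation
becomes an infinite system for the Fourier coefficients, truncated to finitely many modes.
Symmetrising the trilinear energy sum moves one derivative from the high frequencies to the velocity
(`norm_energy_le`), so every Sobolev norm obeys an estimate independent of the truncation. A cutoff
in the `H²` seminorm makes the truncated field bounded, and is inactive on the chosen time interval.
Uniform bounds allow a limit along an ultrafilter, and rapid decay of the coefficients gives joint
smoothness.

Uniqueness (`IsSol.eq_of_eq_at`) is an `L²` energy estimate for the difference of two solutions. It
identifies the restarted solution with `ρ` before `T`, and the two are glued. -/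

namespace IPM1D

open scoped ComplexConjugate

/-! ### Fourier modes and Fourier coefficients -/

/-- The Fourier mode `e^{ikx}`. -/
noncomputable def mode (k : ℤ) (x : ℝ) : ℂ := Complex.exp (Complex.I * k * x)

theorem norm_mode (k : ℤ) (x : ℝ) : ‖mode k x‖ = 1 := by
  rw [mode, show Complex.I * k * x = ((k * x : ℝ) : ℂ) * Complex.I by push_cast; ring]
  exact Complex.norm_exp_ofReal_mul_I _

theorem mode_zero (x : ℝ) : mode 0 x = 1 := by simp [mode]

theorem mode_at_zero (k : ℤ) : mode k 0 = 1 := by simp [mode]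

theorem mode_add (j k : ℤ) (x : ℝ) : mode (j + k) x = mode j x * mode k x := by
  rw [mode, mode, mode, ← Complex.exp_add]; congr 1; push_cast; ring

theorem mode_add_arg (k : ℤ) (x y : ℝ) : mode k (x + y) = mode k x * mode k y := by
  rw [mode, mode, mode, ← Complex.exp_add]; congr 1; push_cast; ring

theorem mode_sub_arg (k : ℤ) (x y : ℝ) : mode k (x - y) = mode k x * mode k (-y) := by
  rw [sub_eq_add_neg, mode_add_arg]

theorem mode_two_pi (k : ℤ) : mode k (2 * Real.pi) = 1 := by
  rw [mode, Complex.exp_eq_one_iff]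
  exact ⟨k, by push_cast; ring⟩

theorem mode_periodic (k : ℤ) : Function.Periodic (mode k) (2 * Real.pi) := by
  intro x; rw [mode_add_arg, mode_two_pi, mul_one]

theorem conj_mode (k : ℤ) (x : ℝ) : conj (mode k x) = mode (-k) x := by
  rw [mode, mode, ← Complex.exp_conj]; congr 1; simp

theorem hasDerivAt_mode (k : ℤ) (x : ℝ) :
    HasDerivAt (mode k) (Complex.I * k * mode k x) x := by
  have h : HasDerivAt (fun y : ℝ => Complex.I * k * (y : ℂ)) (Complex.I * k) x := by
    simpa using (Complex.ofRealCLM.hasDerivAt (x := x)).const_mul (Complex.I * k)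
  exact h.cexp.congr_deriv (by rw [mode]; ring)

theorem contDiff_mode (k : ℤ) : ContDiff ℝ ∞ (mode k) := by
  unfold mode
  exact ((contDiff_const.mul Complex.ofRealCLM.contDiff)).cexp

theorem continuous_mode (k : ℤ) : Continuous (mode k) := (contDiff_mode k).continuous

theorem integral_mode (k : ℤ) :
    ∫ x in (0 : ℝ)..2 * Real.pi, mode k x = if k = 0 then 2 * (Real.pi : ℂ) else 0 := by
  split_ifs with h
  · subst h; simp [mode_zero]
  · have hc : Complex.I * (k : ℂ) ≠ 0 := mul_ne_zero Complex.I_ne_zero (by exact_mod_cast h)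
    have h1 := integral_exp_mul_complex (a := 0) (b := 2 * Real.pi) hc
    have h2 := mode_two_pi k
    have h3 := mode_at_zero k
    unfold mode at h2 h3 ⊢
    rw [h1, h2, h3, sub_self, zero_div]

/-- The Fourier coefficients of a real function of period `2π`. -/
noncomputable def coef (f : ℝ → ℝ) (k : ℤ) : ℂ :=
  (2 * Real.pi : ℂ)⁻¹ * ∫ x in (0 : ℝ)..2 * Real.pi, mode (-k) x * f x

theorem fourier_eq_mode (k : ℤ) (x : ℝ) :
    fourier k (x : AddCircle (2 * Real.pi)) = mode k x := by
  have : (Real.pi : ℂ) ≠ 0 := by exact_mod_cast Real.pi_ne_zero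
  rw [fourier_coe_apply, mode]; congr 1; push_cast; field_simp

theorem coef_eq_fourierCoeffOn (f : ℝ → ℝ) (k : ℤ) :
    coef f k = fourierCoeffOn Real.two_pi_pos (fun x => (f x : ℂ)) k := by
  rw [fourierCoeffOn_eq_integral]
  have hpi : (Real.pi : ℂ) ≠ 0 := by exact_mod_cast Real.pi_ne_zero
  have h : ∀ x : ℝ, fourier (-k) (x : AddCircle (2 * Real.pi - 0)) = mode (-k) x := fun x => by
    rw [fourier_coe_apply, mode]; congr 1; push_cast; field_simp; ring
  simp only [h, smul_eq_mul, Complex.real_smul, sub_zero]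
  rw [coef]
  push_cast
  rw [one_div]

theorem hasSum_sq_coef {f : ℝ → ℝ} (hf : Continuous f) :
    HasSum (fun k => ‖coef f k‖ ^ 2)
      ((2 * Real.pi)⁻¹ * ∫ x in (0 : ℝ)..2 * Real.pi, f x ^ 2) := by
  have h1 : MemLp (fun x => (f x : ℂ)) 2 (volume.restrict (Ioc 0 (2 * Real.pi))) := by
    obtain ⟨M, hM⟩ := (isCompact_Icc (a := (0 : ℝ)) (b := 2 * Real.pi)).exists_bound_of_continuousOn
      hf.continuousOn
    refine MemLp.of_bound (Complex.continuous_ofReal.comp hf).aestronglyMeasurable M ?_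
    refine (ae_restrict_iff' measurableSet_Ioc).2 (Eventually.of_forall fun x hx => ?_)
    rw [Complex.norm_real]
    exact hM x (Ioc_subset_Icc_self hx)
  have h2 := hasSum_sq_fourierCoeffOn Real.two_pi_pos h1
  simp only [← coef_eq_fourierCoeffOn, Complex.norm_real, sub_zero, smul_eq_mul, Real.norm_eq_abs,
    sq_abs] at h2
  exact h2

theorem hasSum_coef {f : ℝ → ℝ} (hf : Continuous f) (hp : Function.Periodic f (2 * Real.pi))
    (hs : Summable (coef f)) (x : ℝ) : HasSum (fun k => coef f k * mode k x) (f x : ℂ) := by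
  have : Fact (0 < 2 * Real.pi) := ⟨Real.two_pi_pos⟩
  have hp' : Function.Periodic (fun x => (f x : ℂ)) (2 * Real.pi) := fun x => by
    simp only [hp x]
  let F : C(AddCircle (2 * Real.pi), ℂ) := ⟨hp'.lift, by
    refine continuous_coinduced_dom.2 ?_
    exact Complex.continuous_ofReal.comp hf⟩
  have hF : ∀ k, fourierCoeff F k = coef f k := by
    intro k
    rw [fourierCoeff_eq_intervalIntegral F k 0, coef, Complex.real_smul]
    simp only [fourier_eq_mode, smul_eq_mul, zero_add]
    push_cast
    rw [one_div]
    rfl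
  have h := has_pointwise_sum_fourier_series_of_summable (f := F)
    (by rw [show fourierCoeff F = coef f from funext hF]; exact hs) (x : AddCircle (2 * Real.pi))
  simp only [hF, fourier_eq_mode, smul_eq_mul] at h
  exact h

theorem norm_coef_le {f : ℝ → ℝ} {M : ℝ} (hM : ∀ x, |f x| ≤ M) (k : ℤ) : ‖coef f k‖ ≤ M := by
  have h : ‖∫ x in (0 : ℝ)..2 * Real.pi, mode (-k) x * f x‖ ≤ M * |2 * Real.pi - 0| := by
    refine intervalIntegral.norm_integral_le_of_norm_le_const fun x _ => ?_
    rw [norm_mul, norm_mode, one_mul, Complex.norm_real]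
    exact hM x
  have hpi := Real.two_pi_pos
  rw [coef, norm_mul, norm_inv]
  have h2 : ‖(2 * Real.pi : ℂ)‖ = 2 * Real.pi := by
    rw [show (2 * Real.pi : ℂ) = ((2 * Real.pi : ℝ) : ℂ) by push_cast; rfl, Complex.norm_real,
      Real.norm_eq_abs, abs_of_pos hpi]
  rw [h2, inv_mul_le_iff₀ hpi]
  rw [sub_zero, abs_of_pos hpi] at h
  linarith

theorem coef_deriv {f : ℝ → ℝ} (hf : ContDiff ℝ 1 f) (hp : Function.Periodic f (2 * Real.pi))
    (k : ℤ) : coef (deriv f) k = Complex.I * k * coef f k := by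
  have hd : ∀ x, HasDerivAt (fun x => (f x : ℂ)) ((deriv f x : ℝ) : ℂ) x := fun x =>
    ((hf.differentiable one_ne_zero) x).hasDerivAt.ofReal_comp
  have hc : Continuous (deriv f) := hf.continuous_deriv le_rfl
  have h := intervalIntegral.integral_mul_deriv_eq_deriv_mul (a := 0) (b := 2 * Real.pi)
    (u := mode (-k)) (v := fun x => (f x : ℂ)) (u' := fun x => Complex.I * (-k : ℤ) * mode (-k) x)
    (v' := fun x => ((deriv f x : ℝ) : ℂ))
    (fun x _ => hasDerivAt_mode (-k) x) (fun x _ => hd x)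
    ((continuous_const.mul (continuous_mode _)).intervalIntegrable _ _)
    ((Complex.continuous_ofReal.comp hc).intervalIntegrable _ _)
  have h0 : f (2 * Real.pi) = f 0 := by simpa using hp 0
  simp only [mode_two_pi, mode_at_zero, h0, sub_self, zero_sub, mul_assoc,
    intervalIntegral.integral_const_mul] at h
  rw [coef, coef, h]
  push_cast
  ring

theorem coef_conj (f : ℝ → ℝ) (k : ℤ) : conj (coef f k) = coef f (-k) := by
  rw [coef, coef, map_mul, intervalIntegral.integral_of_le Real.two_pi_pos.le,
    intervalIntegral.integral_of_le Real.two_pi_pos.le, ← integral_conj]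
  congr 1
  · rw [map_inv₀, show (2 * Real.pi : ℂ) = ((2 * Real.pi : ℝ) : ℂ) by push_cast; rfl,
      Complex.conj_ofReal]
  · refine integral_congr_ae (Eventually.of_forall fun x => ?_)
    simp [conj_mode]

theorem SmoothPeriodic.deriv {f : ℝ → ℝ} (hf : SmoothPeriodic f) : SmoothPeriodic (deriv f) := by
  refine ⟨?_, fun x => ?_⟩
  · have := hf.1
    rw [contDiff_infty_iff_deriv] at this
    exact this.2
  · rw [← deriv_comp_add_const]
    congr 1
    exact funext hf.2

theorem SmoothPeriodic.contDiff {f : ℝ → ℝ} (hf : SmoothPeriodic f) (n : ℕ∞) :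
    ContDiff ℝ n f := hf.1.of_le (by exact_mod_cast le_top)

theorem SmoothPeriodic.contDiff_one {f : ℝ → ℝ} (hf : SmoothPeriodic f) :
    ContDiff ℝ 1 f := by exact_mod_cast hf.contDiff 1

theorem SmoothPeriodic.continuous {f : ℝ → ℝ} (hf : SmoothPeriodic f) : Continuous f :=
  hf.1.continuous

theorem SmoothPeriodic.hasDerivAt {f : ℝ → ℝ} (hf : SmoothPeriodic f) (x : ℝ) :
    HasDerivAt f (_root_.deriv f x) x :=
  (hf.contDiff_one.differentiable one_ne_zero x).hasDerivAt

theorem exists_abs_le_of_periodic {f : ℝ → ℝ} (hf : Continuous f)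
    (hp : Function.Periodic f (2 * Real.pi)) : ∃ M, ∀ x, |f x| ≤ M := by
  obtain ⟨M, hM⟩ := (isCompact_Icc (a := (0 : ℝ)) (b := 2 * Real.pi)).exists_bound_of_continuousOn
    hf.continuousOn
  refine ⟨M, fun x => ?_⟩
  obtain ⟨w, hw, hxw⟩ := hp.exists_mem_Ico₀ Real.two_pi_pos x
  rw [hxw]
  exact hM w ⟨hw.1, hw.2.le⟩

/-! ### Rapidly decaying coefficients and smooth functions -/

/-- `b k` decays faster than any power of `k`, with constants `B`. -/
def Decay (B : ℕ → ℝ) (b : ℤ → ℂ) : Prop := ∀ (s : ℕ) (k : ℤ), |(k : ℝ)| ^ s * ‖b k‖ ≤ B s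

theorem SmoothPeriodic.exists_decay {f : ℝ → ℝ} (hf : SmoothPeriodic f) :
    ∃ B, Decay B (coef f) := by
  have key : ∀ s : ℕ, ∀ f : ℝ → ℝ, SmoothPeriodic f
      → ∃ B, ∀ k : ℤ, |(k : ℝ)| ^ s * ‖coef f k‖ ≤ B := by
    intro s
    induction s with
    | zero =>
      intro f hf
      obtain ⟨M, hM⟩ := exists_abs_le_of_periodic hf.continuous hf.2
      exact ⟨M, fun k => by simpa using norm_coef_le hM k⟩
    | succ s ih =>
      intro f hf
      -- Passing to the derivative multiplies the coefficient by `ik`, which supplies the extra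
      -- power of `k`.
      obtain ⟨B, hB⟩ := ih _ hf.deriv
      refine ⟨B, fun k => ?_⟩
      have := hB k
      rw [coef_deriv hf.contDiff_one hf.2, norm_mul, norm_mul, Complex.norm_I, one_mul,
        Complex.norm_intCast, ← mul_assoc, ← pow_succ] at this
      exact this
  choose B hB using fun s => key s f hf
  exact ⟨B, hB⟩

/-- A summable weight on the integers. -/
noncomputable def wt (k : ℤ) : ℝ := 1 / (1 + (k : ℝ) ^ 2)

theorem wt_pos (k : ℤ) : 0 < wt k := by unfold wt; positivity

theorem summable_wt : Summable wt := by
  have h := (Real.summable_one_div_int_pow (p := 2)).2 one_lt_two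
  refine Summable.of_norm_bounded_eventually h ?_
  filter_upwards [eventually_cofinite_ne (0 : ℤ)] with k hk
  have hk' : (0 : ℝ) < (k : ℝ) ^ 2 := by positivity
  rw [Real.norm_eq_abs, abs_of_pos (wt_pos k), wt]
  exact one_div_le_one_div_of_le hk' (by linarith)

/-- Adding the bounds of orders `s` and `s + 2` produces the factor `1 + k²`: two orders of decay
are spent to obtain a summable majorant. -/
theorem Decay.le_wt {B : ℕ → ℝ} {b : ℤ → ℂ} (h : Decay B b) (s : ℕ) (k : ℤ) :
    |(k : ℝ)| ^ s * ‖b k‖ ≤ (B s + B (s + 2)) * wt k := by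
  have h1 := h s k
  have h2 := h (s + 2) k
  rw [pow_add, sq_abs] at h2
  rw [wt, mul_one_div, le_div_iff₀ (by positivity)]
  linarith

theorem Decay.norm_le_wt {B : ℕ → ℝ} {b : ℤ → ℂ} (h : Decay B b) (k : ℤ) :
    ‖b k‖ ≤ (B 0 + B 2) * wt k := by
  simpa using h.le_wt 0 k

theorem Decay.nonneg {B : ℕ → ℝ} {b : ℤ → ℂ} (h : Decay B b) (s : ℕ) : 0 ≤ B s :=
  le_trans (by positivity) (h s 0)

theorem Decay.summable {B : ℕ → ℝ} {b : ℤ → ℂ} (h : Decay B b) (s : ℕ) :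
    Summable fun k : ℤ => |(k : ℝ)| ^ s * ‖b k‖ :=
  Summable.of_nonneg_of_le (fun k => by positivity) (h.le_wt s) (summable_wt.mul_left _)

theorem Decay.summable_norm {B : ℕ → ℝ} {b : ℤ → ℂ} (h : Decay B b) :
    Summable fun k : ℤ => ‖b k‖ := by simpa using h.summable 0

theorem Decay.summable_mode {B : ℕ → ℝ} {b : ℤ → ℂ} (h : Decay B b) (x : ℝ) :
    Summable fun k : ℤ => b k * mode k x :=
  Summable.of_norm (by simpa [norm_mode] using h.summable_norm)

/-- Multiplication of the coefficients by a bounded sequence. -/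
theorem Decay.mul_left {B : ℕ → ℝ} {b : ℤ → ℂ} (h : Decay B b) {m : ℤ → ℂ} {C : ℝ}
    (hm : ∀ k, ‖m k‖ ≤ C) : Decay (fun s => C * B s) fun k => m k * b k := by
  intro s k
  rw [norm_mul]
  have h1 := h s k
  have := norm_nonneg (m k)
  calc |(k : ℝ)| ^ s * (‖m k‖ * ‖b k‖) = ‖m k‖ * (|(k : ℝ)| ^ s * ‖b k‖) := by ring
    _ ≤ C * B s := mul_le_mul (hm k) h1 (by positivity) (this.trans (hm k))

/-- The coefficients of the derivative. -/
theorem Decay.deriv {B : ℕ → ℝ} {b : ℤ → ℂ} (h : Decay B b) :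
    Decay (fun s => B (s + 1)) fun k => Complex.I * k * b k := by
  intro s k
  have := h (s + 1) k
  rw [norm_mul, norm_mul, Complex.norm_I, one_mul, Complex.norm_intCast, ← mul_assoc, ← pow_succ]
  exact this

theorem SmoothPeriodic.hasSum_coef {f : ℝ → ℝ} (hf : SmoothPeriodic f) (x : ℝ) :
    HasSum (fun k => coef f k * mode k x) (f x : ℂ) := by
  obtain ⟨B, hB⟩ := hf.exists_decay
  exact IPM1D.hasSum_coef hf.continuous hf.2 hB.summable_norm.of_norm x

/-- Absolute summability permits termwise integration against `mode (-j)`, and orthogonality of the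
modes leaves only the term `k = j`. -/
theorem coef_eq_of_hasSum {f : ℝ → ℝ} {b : ℤ → ℂ} (hb : Summable fun k => ‖b k‖)
    (h : ∀ x, HasSum (fun k => b k * mode k x) (f x : ℂ)) : coef f = b := by
  ext j
  have h1 : HasSum (fun k => ∫ x in (0 : ℝ)..2 * Real.pi, b k * mode (k - j) x)
      (∫ x in (0 : ℝ)..2 * Real.pi, mode (-j) x * f x) := by
    refine intervalIntegral.hasSum_integral_of_dominated_convergence (fun k _ => ‖b k‖)
      (fun k => ((continuous_const.mul (continuous_mode _)).aestronglyMeasurable)) ?_ ?_ ?_ ?_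
    · exact fun k => Eventually.of_forall fun x _ => by rw [norm_mul, norm_mode, mul_one]
    · exact Eventually.of_forall fun x _ => hb
    · exact continuous_const.intervalIntegrable _ _
    · refine Eventually.of_forall fun x _ => ?_
      refine ((h x).mul_left (mode (-j) x)).congr_fun fun k => ?_
      rw [sub_eq_add_neg, mode_add]; ring
  have h2 : HasSum (fun k => ∫ x in (0 : ℝ)..2 * Real.pi, b k * mode (k - j) x)
      (2 * Real.pi * b j) := by
    convert hasSum_ite_eq j (2 * (Real.pi : ℂ) * b j) using 2 with k
    rw [intervalIntegral.integral_const_mul, integral_mode]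
    by_cases hk : k = j
    · subst hk; simp [mul_comm]
    · simp [hk, sub_eq_zero]
  have hpi : (2 * Real.pi : ℂ) ≠ 0 := by exact_mod_cast Real.two_pi_pos.ne'
  rw [coef, h1.unique h2, ← mul_assoc, inv_mul_cancel₀ hpi, one_mul]

theorem Decay.hasDerivAt_tsum {B : ℕ → ℝ} {b : ℤ → ℂ} (h : Decay B b) (x : ℝ) :
    HasDerivAt (fun x => ∑' k, b k * mode k x) (∑' k : ℤ, (Complex.I * k * b k) * mode k x) x := by
  refine _root_.hasDerivAt_tsum (u := fun k => ‖Complex.I * k * b k‖)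
    (g' := fun k y => (Complex.I * k * b k) * mode k y) h.deriv.summable_norm
    (fun k y => ((hasDerivAt_mode k y).const_mul (b k)).congr_deriv (by ring))
    (fun k y => by rw [norm_mul _ (mode k y), norm_mode, mul_one]) (y₀ := 0) (h.summable_mode 0) x

/-- The termwise derivative is again a series with rapidly decaying coefficients, so the induction
runs over all such series at once. -/
theorem Decay.contDiff_tsum {B : ℕ → ℝ} {b : ℤ → ℂ} (h : Decay B b) :
    ContDiff ℝ ∞ (fun x => ∑' k, b k * mode k x) := by
  refine contDiff_infty.2 fun n => ?_
  induction n generalizing B b with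
  | zero =>
    exact contDiff_zero.2 (continuous_iff_continuousAt.2 fun x =>
      (h.hasDerivAt_tsum x).continuousAt)
  | succ n ih =>
    rw [Nat.cast_add, Nat.cast_one, contDiff_succ_iff_deriv]
    refine ⟨fun x => (h.hasDerivAt_tsum x).differentiableAt, by simp, ?_⟩
    rw [show _root_.deriv (fun x => ∑' k, b k * mode k x) = _ from
      funext fun x => (h.hasDerivAt_tsum x).deriv]
    exact ih h.deriv

theorem smoothPeriodic_of_hasSum {B : ℕ → ℝ} {b : ℤ → ℂ} (h : Decay B b) {f : ℝ → ℝ}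
    (hf : ∀ x, HasSum (fun k => b k * mode k x) (f x : ℂ)) : SmoothPeriodic f := by
  have h1 : f = fun x => Complex.reCLM (∑' k, b k * mode k x) := by
    ext x; rw [(hf x).tsum_eq]; simp
  refine ⟨?_, fun x => ?_⟩
  · rw [h1]
    exact Complex.reCLM.contDiff.comp h.contDiff_tsum
  · rw [h1]; simp only [mode_periodic _ x]

theorem hasSum_deriv_of_hasSum {B : ℕ → ℝ} {b : ℤ → ℂ} (h : Decay B b) {f : ℝ → ℝ}
    (hf : ∀ x, HasSum (fun k => b k * mode k x) (f x : ℂ)) (x : ℝ) :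
    HasSum (fun k : ℤ => (Complex.I * k * b k) * mode k x) ((_root_.deriv f x : ℝ) : ℂ) := by
  have h1 := h.hasDerivAt_tsum x
  rw [show (fun x => ∑' k, b k * mode k x) = fun x => (f x : ℂ) from
    funext fun x => (hf x).tsum_eq] at h1
  have h2 := ((smoothPeriodic_of_hasSum h hf).hasDerivAt x).ofReal_comp
  rw [h2.unique h1]
  exact (h.deriv.summable_mode x).hasSum

/-! ### The kernel and its sine transform -/

theorem kernel_pos {a y : ℝ} (ha : 0 < a) (hy : 0 < y) : 0 < kernel a y := by
  have := Real.pi_pos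
  unfold kernel; positivity

theorem mul_kernel (a : ℝ) {y : ℝ} (hy : 0 < y) :
    y * kernel a y = 1 / Real.pi * (a ^ 2 / (y ^ 2 + a ^ 2)) := by
  have := Real.pi_pos.ne'
  unfold kernel; field_simp

theorem mul_kernel_le {a y : ℝ} (ha : 0 < a) (hy : 0 < y) : y * kernel a y ≤ 1 / Real.pi := by
  rw [mul_kernel a hy]
  have := Real.pi_pos
  have h1 : a ^ 2 / (y ^ 2 + a ^ 2) ≤ 1 := by
    rw [div_le_one (by positivity)]; nlinarith
  nlinarith [show 0 < 1 / Real.pi by positivity]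

theorem kernel_le {a y : ℝ} (ha : 0 < a) (hy : 0 < y) : kernel a y ≤ 1 / (Real.pi * y) := by
  have h := mul_kernel_le ha hy
  have := Real.pi_pos
  rw [le_div_iff₀ (by positivity)]
  rw [le_div_iff₀ this] at h
  linarith

theorem hasDerivAt_kernel {a y : ℝ} (ha : 0 < a) (hy : 0 < y) :
    HasDerivAt (kernel a) (-(a ^ 2 * (3 * y ^ 2 + a ^ 2) / (Real.pi * (y * (y ^ 2 + a ^ 2)) ^ 2)))
      y := by
  have hpi := Real.pi_pos
  have h0 : Real.pi * (y * (y ^ 2 + a ^ 2)) ≠ 0 := by positivity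
  have h1 : HasDerivAt (fun y : ℝ => Real.pi * (y * (y ^ 2 + a ^ 2)))
      (Real.pi * (3 * y ^ 2 + a ^ 2)) y := by
    have := ((hasDerivAt_id y).mul (((hasDerivAt_id y).pow 2).add_const (a ^ 2))).const_mul Real.pi
    refine this.congr_deriv ?_
    simp
    ring
  have h2 := (hasDerivAt_const y (a ^ 2)).div h1 h0
  have h3 : kernel a = (fun _ => a ^ 2) / fun y : ℝ => Real.pi * (y * (y ^ 2 + a ^ 2)) := by
    ext z
    simp only [kernel, Pi.div_apply]
    rw [div_mul_div_comm, one_mul, mul_assoc]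
  rw [h3]
  refine h2.congr_deriv ?_
  field_simp
  ring

theorem tendsto_kernel_atTop {a : ℝ} (ha : 0 < a) : Tendsto (kernel a) atTop (𝓝 0) := by
  refine squeeze_zero' ?_ ?_ (g := fun y => 1 / Real.pi * y⁻¹) ?_
  · filter_upwards [eventually_gt_atTop 0] with y hy using (kernel_pos ha hy).le
  · filter_upwards [eventually_gt_atTop 0] with y hy
    refine (kernel_le ha hy).trans_eq ?_
    have := Real.pi_pos.ne'
    field_simp
  · simpa using (tendsto_inv_atTop_zero (𝕜 := ℝ)).const_mul (1 / Real.pi)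

theorem integrableOn_sin_mul_kernel {a κ : ℝ} (ha : 0 < a) (hκ : 0 < κ) :
    IntegrableOn (fun y => Real.sin (κ * y) * kernel a y) (Ioi 0) := by
  refine Integrable.mono' (((integrable_lorentz ha).const_mul (κ * (1 / Real.pi))).integrableOn)
    ((by fun_prop : Continuous fun y : ℝ => Real.sin (κ * y)).measurable.mul
      (measurable_kernel a)).aestronglyMeasurable ?_
  refine (ae_restrict_iff' measurableSet_Ioi).2 (Eventually.of_forall fun y hy => ?_)
  have hy' : 0 < y := hy
  rw [Real.norm_eq_abs, abs_mul, abs_of_pos (kernel_pos ha hy'), mul_assoc, ← mul_kernel a hy',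
    ← mul_assoc]
  refine mul_le_mul_of_nonneg_right ?_ (kernel_pos ha hy').le
  refine (Real.abs_sin_le_abs).trans_eq (abs_of_pos (by positivity))

/-- The half line is cut at the wavelength scale `1/κ`. Below it `|sin (κy)| ≤ κy` and `y K_a(y) ≤
1/π` contribute `1/π`. Above it one integrates by parts: the kernel decreases to `0`, so the
boundary term and the total variation each contribute at most `K_a(1/κ)/κ ≤ 1/π`. The bound does not
depend on `a` or `κ`. -/
theorem abs_integral_sin_mul_kernel_le {a κ : ℝ} (ha : 0 < a) (hκ : 0 < κ) :
    |∫ y in Ioi 0, Real.sin (κ * y) * kernel a y| ≤ 3 / Real.pi := by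
  have hpi := Real.pi_pos
  have hint := integrableOn_sin_mul_kernel ha hκ
  have hκ' : 0 < 1 / κ := by positivity
  have hsplit : Ioi (0 : ℝ) = Ioc 0 (1 / κ) ∪ Ioi (1 / κ) := by
    ext y; simp only [mem_Ioi, mem_union, mem_Ioc]
    constructor
    · intro h; rcases le_or_gt y (1 / κ) with h1 | h1
      · exact Or.inl ⟨h, h1⟩
      · exact Or.inr h1
    · rintro (h | h)
      · exact h.1
      · exact hκ'.trans h
  have hint1 := hint.mono_set (show Ioc 0 (1 / κ) ⊆ Ioi 0 from fun y hy => hy.1)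
  have hint2 := hint.mono_set (show Ioi (1 / κ) ⊆ Ioi 0 from fun y hy => hκ'.trans hy)
  rw [hsplit, setIntegral_union (s := Ioc 0 (1 / κ)) (t := Ioi (1 / κ))
    (Set.disjoint_left.2 fun y h1 h2 => not_lt.2 h1.2 h2)
    measurableSet_Ioi hint1 hint2]
  have hA : |∫ y in Ioc 0 (1 / κ), Real.sin (κ * y) * kernel a y| ≤ 1 / Real.pi := by
    have := norm_setIntegral_le_of_norm_le_const (μ := volume) (s := Ioc 0 (1 / κ))
      (f := fun y => Real.sin (κ * y) * kernel a y) (C := κ / Real.pi) (by simp) ?_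
    · rw [Real.norm_eq_abs] at this
      refine this.trans_eq ?_
      rw [Real.volume_real_Ioc_of_le hκ'.le]
      field_simp
      ring
    · intro y hy
      rw [Real.norm_eq_abs, abs_mul, abs_of_pos (kernel_pos ha hy.1)]
      calc |Real.sin (κ * y)| * kernel a y ≤ (κ * y) * kernel a y :=
            mul_le_mul_of_nonneg_right (Real.abs_sin_le_abs.trans_eq
              (abs_of_pos (mul_pos hκ hy.1))) (kernel_pos ha hy.1).le
        _ = κ * (y * kernel a y) := by ring
        _ ≤ κ * (1 / Real.pi) := mul_le_mul_of_nonneg_left (mul_kernel_le ha hy.1) hκ.le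
        _ = κ / Real.pi := by ring
  set K' : ℝ → ℝ := fun y => -(a ^ 2 * (3 * y ^ 2 + a ^ 2) / (Real.pi * (y * (y ^ 2 + a ^ 2)) ^ 2))
    with hK'
  have hder : ∀ x ∈ Ici (1 / κ), HasDerivAt (kernel a) (K' x) x := fun x hx =>
    hasDerivAt_kernel ha (hκ'.trans_le hx)
  have hneg : ∀ x ∈ Ioi (1 / κ), K' x ≤ 0 := fun x hx => by
    rw [hK']; simp only; rw [neg_nonpos]; positivity
  have hK'int := integrableOn_Ioi_deriv_of_nonpos' hder hneg (tendsto_kernel_atTop ha)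
  have hK'val := integral_Ioi_of_hasDerivAt_of_nonpos' hder hneg (tendsto_kernel_atTop ha)
  have hcosd : ∀ x, HasDerivAt (fun y => -Real.cos (κ * y) / κ) (Real.sin (κ * x)) x := by
    intro x
    have h1 : HasDerivAt (fun y : ℝ => κ * y) κ x := by
      simpa using (hasDerivAt_id x).const_mul κ
    refine ((h1.cos.neg).div_const κ).congr_deriv ?_
    field_simp
  have hcosc : Continuous fun y => -Real.cos (κ * y) / κ := by fun_prop
  have hcosb : ∀ y, |-Real.cos (κ * y) / κ| ≤ 1 / κ := by
    intro y
    rw [abs_div, abs_neg, abs_of_pos hκ]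
    exact div_le_div_of_nonneg_right (Real.abs_cos_le_one _) hκ.le
  have hparts := integral_Ioi_mul_deriv_eq_deriv_mul (a := 1 / κ) (u := kernel a) (u' := K')
    (v := fun y => -Real.cos (κ * y) / κ) (v' := fun y => Real.sin (κ * y))
    (a' := kernel a (1 / κ) * (-Real.cos (κ * (1 / κ)) / κ)) (b' := 0)
    (fun x hx => hder x (Ioi_subset_Ici_self hx)) (fun x _ => hcosd x)
    (by
      refine hint2.congr_fun (fun y _ => ?_) measurableSet_Ioi
      simp [mul_comm])
    (by
      have := hK'int.bdd_mul (c := 1 / κ) hcosc.aestronglyMeasurable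
        (Eventually.of_forall fun y => hcosb y)
      refine this.congr (Eventually.of_forall fun y => ?_)
      simp [mul_comm])
    (((hder _ (mem_Ici.2 le_rfl)).continuousAt.mul hcosc.continuousAt).tendsto.mono_left
      nhdsWithin_le_nhds)
    (by
      refine squeeze_zero_norm' (a := fun y => |kernel a y| * (1 / κ)) ?_ ?_
      · refine Eventually.of_forall fun y => ?_
        rw [Pi.mul_apply, norm_mul, Real.norm_eq_abs, Real.norm_eq_abs]
        exact mul_le_mul_of_nonneg_left (hcosb y) (abs_nonneg _)
      · simpa using (tendsto_kernel_atTop ha).abs.mul_const (1 / κ))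
  have hb1 : kernel a (1 / κ) * (1 / κ) ≤ 1 / Real.pi := by
    rw [mul_comm]; exact mul_kernel_le ha hκ'
  have hB : |∫ y in Ioi (1 / κ), Real.sin (κ * y) * kernel a y| ≤ 2 / Real.pi := by
    have h1 : |∫ x in Ioi (1 / κ), K' x * (-Real.cos (κ * x) / κ)| ≤ 1 / Real.pi := by
      have := norm_integral_le_of_norm_le (μ := volume.restrict (Ioi (1 / κ)))
        (f := fun x => K' x * (-Real.cos (κ * x) / κ)) (g := fun x => -K' x * (1 / κ))
        (hK'int.neg.mul_const _) ((ae_restrict_iff' measurableSet_Ioi).2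
          (Eventually.of_forall fun x hx => by
            rw [Real.norm_eq_abs, abs_mul, abs_of_nonpos (hneg x hx)]
            exact mul_le_mul_of_nonneg_left (hcosb x) (neg_nonneg.2 (hneg x hx))))
      rw [integral_mul_const, integral_neg, hK'val, Real.norm_eq_abs] at this
      refine this.trans (le_trans (le_of_eq ?_) hb1)
      ring
    have h2 : |kernel a (1 / κ) * (-Real.cos (κ * (1 / κ)) / κ)| ≤ 1 / Real.pi := by
      rw [abs_mul, abs_of_pos (kernel_pos ha hκ')]
      exact (mul_le_mul_of_nonneg_left (hcosb _) (kernel_pos ha hκ').le).trans hb1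
    have h3 : ∫ y in Ioi (1 / κ), Real.sin (κ * y) * kernel a y
        = ∫ y in Ioi (1 / κ), kernel a y * Real.sin (κ * y) := by simp only [mul_comm]
    rw [h3, hparts, show (2 : ℝ) / Real.pi = 1 / Real.pi + 1 / Real.pi by ring, zero_sub,
      ← neg_add', abs_neg]
    exact (abs_add_le _ _).trans (add_le_add h2 h1)
  refine (abs_add_le _ _).trans ((add_le_add hA hB).trans_eq ?_)
  ring

/-- The Fourier multiplier of `H_a`. -/
noncomputable def multiplier (a : ℝ) (k : ℤ) : ℂ :=
  ∫ y in Ioi (0 : ℝ), (mode k (-y) - mode k y) * kernel a y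

theorem mode_neg_sub_mode (k : ℤ) (y : ℝ) :
    mode k (-y) - mode k y = -2 * Complex.I * Real.sin (k * y) := by
  have h1 : mode k (-y) = Complex.exp (-((k * y : ℝ) : ℂ) * Complex.I) := by
    rw [mode]; congr 1; push_cast; ring
  have h2 : mode k y = Complex.exp (((k * y : ℝ) : ℂ) * Complex.I) := by
    rw [mode]; congr 1; push_cast; ring
  rw [h1, h2, Complex.exp_mul_I, Complex.exp_mul_I, Complex.cos_neg, Complex.sin_neg,
    Complex.ofReal_sin]
  ring

theorem multiplier_eq (a : ℝ) (k : ℤ) : multiplier a k =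
    -2 * Complex.I * ((∫ y in Ioi (0 : ℝ), Real.sin (k * y) * kernel a y : ℝ) : ℂ) := by
  rw [multiplier, ← integral_complex_ofReal, ← integral_const_mul]
  refine integral_congr_ae (Eventually.of_forall fun y => ?_)
  simp only [mode_neg_sub_mode]
  push_cast; ring

/-- The symbol is `-2i` times the sine transform, which is odd in `k` and at most `3/π < 1` in
modulus. -/
theorem norm_multiplier_le {a : ℝ} (ha : 0 < a) (k : ℤ) : ‖multiplier a k‖ ≤ 2 := by
  have hpi := Real.pi_gt_three
  have key : |∫ y in Ioi (0 : ℝ), Real.sin (k * y) * kernel a y| ≤ 3 / Real.pi := by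
    rcases lt_trichotomy k 0 with hk | hk | hk
    · have hk' : (0 : ℝ) < -k := by
        have : (k : ℝ) < 0 := by exact_mod_cast hk
        linarith
      have := abs_integral_sin_mul_kernel_le ha hk'
      simp only [neg_mul, Real.sin_neg, integral_neg, abs_neg] at this
      exact this
    · subst hk; simp; positivity
    · exact abs_integral_sin_mul_kernel_le ha (by exact_mod_cast hk)
  rw [multiplier_eq, norm_mul, norm_mul, norm_neg, Complex.norm_I, Complex.norm_real,
    Real.norm_eq_abs]
  have h3 : 3 / Real.pi ≤ 1 := by rw [div_le_one (by linarith)]; exact hpi.le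
  norm_num
  linarith

/-! ### The operator `H_a` as an absolutely convergent integral and as a Fourier multiplier -/

/-- The principal value as an absolutely convergent integral. -/
theorem Ha_eq_integral {a : ℝ} (ha : 0 < a) {f : ℝ → ℝ} (hf : ContDiff ℝ 1 f)
    (hp : Function.Periodic f (2 * Real.pi)) (x : ℝ) :
    IntegrableOn (fun y => (f (x - y) - f (x + y)) * kernel a y) (Ioi 0) ∧
    Ha a f x = ∫ y in Ioi 0, (f (x - y) - f (x + y)) * kernel a y := by
  obtain ⟨L, hL⟩ := exists_lipschitz hf hp
  have hfc := hf.continuous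
  have hk := measurable_kernel a
  have hint : IntegrableOn (fun y => (f (x - y) - f (x + y)) * kernel a y) (Ioi 0) := by
    refine Integrable.mono'
        (((integrable_lorentz ha).const_mul (2 * L * (1 / Real.pi))).integrableOn)
      ((by fun_prop : Continuous fun y => f (x - y) - f (x + y)).measurable.mul
        hk).aestronglyMeasurable ?_
    refine (ae_restrict_iff' measurableSet_Ioi).2 (Eventually.of_forall fun y hy => ?_)
    have hy' : 0 < y := hy
    rw [Real.norm_eq_abs, abs_mul, abs_of_pos (kernel_pos ha hy'), mul_assoc (2 * L),
      ← mul_kernel a hy', ← mul_assoc]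
    refine mul_le_mul_of_nonneg_right ?_ (kernel_pos ha hy').le
    refine (hL _ _).trans_eq ?_
    rw [show x - y - (x + y) = -(2 * y) by ring, abs_neg, abs_of_pos (by positivity)]
    ring
  refine ⟨hint, ?_⟩
  -- The kernel is odd, so folding the negative half line onto the positive one replaces `f (x - y)`
  -- by the difference `f (x - y) - f (x + y)`, which cancels the singularity at `0`.
  have key : ∀ ε > 0, ∫ y in Ioi 0, indicator (Ioi ε)
      (fun y => (f (x - y) - f (x + y)) * kernel a y) y
      = truncHa a f x ε := by
    intro ε hε
    have hset : {y : ℝ | ε < |y|} = Iio (-ε) ∪ Ioi ε := by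
      ext y; simp only [mem_ofPred_eq, mem_union, mem_Iio, mem_Ioi, lt_abs]
      constructor
      · rintro (h | h)
        · exact Or.inr h
        · exact Or.inl (by linarith)
      · rintro (h | h)
        · exact Or.inr (by linarith)
        · exact Or.inl h
    have hi := integrableOn_trunc ha hε hf hp x
    rw [hset] at hi
    have hi1 := hi.left_of_union
    have hi2 := hi.right_of_union
    have hi3 : IntegrableOn (fun y => f (x + y) * kernel a y) (Ioi ε) := by
      -- The reflected function `z ↦ f (-z)` at the base point `-x` produces `f (x + y)`.
      have h1 := integrableOn_trunc ha hε (hf.comp contDiff_neg) (x := -x)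
        (fun z => by
          rw [Function.comp, Function.comp, neg_add, ← sub_eq_add_neg]
          exact hp.sub_eq (-z))
      rw [hset] at h1
      refine h1.right_of_union.congr_fun (fun y _ => ?_) measurableSet_Ioi
      simp [sub_eq_add_neg, add_comm]
    rw [setIntegral_indicator measurableSet_Ioi, inter_eq_right.2 (Ioi_subset_Ioi hε.le), truncHa,
      hset, setIntegral_union (s := Iio (-ε)) (t := Ioi ε) (Set.disjoint_left.2 fun y h1 h2 => by
        simp only [mem_Iio, mem_Ioi] at h1 h2; linarith) measurableSet_Ioi hi1 hi2,
      ← integral_Iic_eq_integral_Iio, ← integral_comp_neg_Ioi]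
    simp only [sub_mul]
    rw [integral_sub hi2 hi3]
    have : ∀ y, f (x - -y) * kernel a (-y) = - (f (x + y) * kernel a y) := by
      intro y; simp [kernel]
    simp only [this, integral_neg]
    ring
  refine tendsto_nhds_unique (tendsto_truncHa ha hf hp x)
    (Tendsto.congr' (eventually_nhdsWithin_of_forall fun ε hε => key ε hε) ?_)
  refine tendsto_integral_filter_of_dominated_convergence
    (fun y => ‖(f (x - y) - f (x + y)) * kernel a y‖) ?_ ?_ hint.norm ?_
  · exact Eventually.of_forall fun ε => hint.aestronglyMeasurable.indicator measurableSet_Ioi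
  · exact Eventually.of_forall fun ε => Eventually.of_forall fun y =>
      norm_indicator_le_norm_self _ _
  · refine (ae_restrict_iff' measurableSet_Ioi).2 (Eventually.of_forall fun y hy => ?_)
    refine tendsto_const_nhds.congr' ?_
    filter_upwards [nhdsWithin_le_nhds (Iio_mem_nhds (show (0 : ℝ) < y from hy))] with ε hε
    rw [indicator_of_mem]; exact hε

theorem norm_mode_sub_mode_le (k : ℤ) (x y : ℝ) :
    ‖mode k (x - y) - mode k (x + y)‖ ≤ 2 * |(k : ℝ)| * |y| := by
  have h : mode k (x - y) - mode k (x + y) = mode k x * (mode k (-y) - mode k y) := by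
    rw [mode_sub_arg, mode_add_arg]; ring
  rw [h, norm_mul, norm_mode, one_mul, mode_neg_sub_mode, norm_mul, norm_mul, norm_neg,
    Complex.norm_I, Complex.norm_real, Real.norm_eq_abs]
  have := Real.abs_sin_le_abs (x := k * y)
  rw [abs_mul] at this
  norm_num
  linarith

/-- The folded integral may be taken term by term: the difference of modes is at most `2 |k| y`, so
the `k`-th integrand is dominated by `|k| ‖b k‖` times an integrable Lorentzian, summably in `k`. -/
theorem hasSum_Ha {a : ℝ} (ha : 0 < a) {B : ℕ → ℝ} {b : ℤ → ℂ} (h : Decay B b) {f : ℝ → ℝ}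
    (hf : ∀ x, HasSum (fun k => b k * mode k x) (f x : ℂ)) (x : ℝ) :
    HasSum (fun k => (multiplier a k * b k) * mode k x) (Ha a f x : ℂ) := by
  have hfs := smoothPeriodic_of_hasSum h hf
  have hpi := Real.pi_pos
  obtain ⟨hint, hHa⟩ := Ha_eq_integral ha hfs.contDiff_one hfs.2 x
  set F : ℤ → ℝ → ℂ := fun k y => b k * (mode k (x - y) - mode k (x + y)) * kernel a y with hF
  have hFm : ∀ k, AEStronglyMeasurable (F k) (volume.restrict (Ioi 0)) := by
    intro k
    have h1 : Continuous fun y : ℝ => b k * (mode k (x - y) - mode k (x + y)) := by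
      have := continuous_mode k
      fun_prop
    exact (h1.measurable.mul (Complex.measurable_ofReal.comp
      (measurable_kernel a))).aestronglyMeasurable
  have hlor : Integrable (fun y : ℝ => a ^ 2 / (y ^ 2 + a ^ 2)) (volume.restrict (Ioi 0)) :=
    (integrable_lorentz ha).integrableOn
  have hFb : ∀ k, ∀ y ∈ Ioi (0 : ℝ), ‖F k y‖ ≤
      2 / Real.pi * (|(k : ℝ)| ^ 1 * ‖b k‖) * (a ^ 2 / (y ^ 2 + a ^ 2)) := by
    intro k y hy
    have hy' : 0 < y := hy
    rw [hF]; simp only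
    rw [norm_mul, norm_mul, Complex.norm_real, Real.norm_eq_abs, abs_of_pos (kernel_pos ha hy')]
    calc ‖b k‖ * ‖mode k (x - y) - mode k (x + y)‖ * kernel a y
        ≤ ‖b k‖ * (2 * |(k : ℝ)| * |y|) * kernel a y :=
          mul_le_mul_of_nonneg_right (mul_le_mul_of_nonneg_left (norm_mode_sub_mode_le k x y)
            (norm_nonneg _)) (kernel_pos ha hy').le
      _ = 2 * (|(k : ℝ)| ^ 1 * ‖b k‖) * (y * kernel a y) := by
          rw [abs_of_pos hy']; ring
      _ = _ := by rw [mul_kernel a hy']; ring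
  have hFi : ∀ k, Integrable (F k) (volume.restrict (Ioi 0)) := fun k =>
    Integrable.mono' (hlor.const_mul _) (hFm k)
      ((ae_restrict_iff' measurableSet_Ioi).2 (Eventually.of_forall (hFb k)))
  have hsum := hasSum_integral_of_summable_integral_norm hFi (by
    refine Summable.of_nonneg_of_le (fun k => integral_nonneg fun y => norm_nonneg _) (fun k => ?_)
      (((h.summable 1).mul_left (2 / Real.pi)).mul_right
        (∫ y in Ioi (0 : ℝ), a ^ 2 / (y ^ 2 + a ^ 2)))
    rw [← integral_const_mul]
    exact integral_mono_ae (hFi k).norm (hlor.const_mul _)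
      ((ae_restrict_iff' measurableSet_Ioi).2 (Eventually.of_forall (hFb k))))
  have h1 : ∫ y in Ioi (0 : ℝ), ∑' k, F k y = (Ha a f x : ℂ) := by
    rw [hHa, ← integral_complex_ofReal]
    refine integral_congr_ae (Eventually.of_forall fun y => ?_)
    have := ((hf (x - y)).sub (hf (x + y))).mul_right (kernel a y : ℂ)
    simp only
    rw [hF]; simp only
    rw [← (show HasSum (fun k => b k * (mode k (x - y) - mode k (x + y)) * (kernel a y : ℂ)) _ from
      this.congr_fun fun k => by ring).tsum_eq.symm]
    push_cast; ring
  have h2 : ∀ k, ∫ y in Ioi (0 : ℝ), F k y = (multiplier a k * b k) * mode k x := by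
    intro k
    rw [multiplier, mul_assoc, mul_comm _ (b k * mode k x), ← integral_const_mul]
    refine integral_congr_ae (Eventually.of_forall fun y => ?_)
    rw [hF]; simp only
    rw [mode_sub_arg, mode_add_arg]; ring
  simp only [h1, h2] at hsum
  exact hsum

/-! ### Mapping properties of `H_a` on smooth periodic functions -/

section SmoothPeriodicHa

variable {a : ℝ} {f : ℝ → ℝ}

theorem SmoothPeriodic.hasSum_Ha (ha : 0 < a) (hf : SmoothPeriodic f) (x : ℝ) :
    HasSum (fun k => (multiplier a k * coef f k) * mode k x) (Ha a f x : ℂ) := by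
  obtain ⟨B, hB⟩ := hf.exists_decay
  exact IPM1D.hasSum_Ha ha hB hf.hasSum_coef x

theorem SmoothPeriodic.Ha (ha : 0 < a) (hf : SmoothPeriodic f) : SmoothPeriodic (Ha a f) := by
  obtain ⟨B, hB⟩ := hf.exists_decay
  exact smoothPeriodic_of_hasSum (hB.mul_left (norm_multiplier_le ha)) (hf.hasSum_Ha ha)

theorem SmoothPeriodic.coef_Ha (ha : 0 < a) (hf : SmoothPeriodic f) :
    coef (IPM1D.Ha a f) = fun k => multiplier a k * coef f k := by
  obtain ⟨B, hB⟩ := hf.exists_decay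
  exact coef_eq_of_hasSum (hB.mul_left (norm_multiplier_le ha)).summable_norm (hf.hasSum_Ha ha)

theorem SmoothPeriodic.deriv_Ha (ha : 0 < a) (hf : SmoothPeriodic f) :
    _root_.deriv (IPM1D.Ha a f) = IPM1D.Ha a (_root_.deriv f) := by
  ext x
  obtain ⟨B, hB⟩ := hf.exists_decay
  have h1 := hasSum_deriv_of_hasSum (hB.mul_left (norm_multiplier_le ha)) (hf.hasSum_Ha ha) x
  have h2 := hf.deriv.hasSum_Ha ha x
  simp only [coef_deriv hf.contDiff_one hf.2] at h2
  have := h1.unique (h2.congr_fun fun k => by ring)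
  exact_mod_cast this

/-- Parseval, with the square of the bound `2` for the symbol. -/
theorem SmoothPeriodic.integral_Ha_sq_le (ha : 0 < a) (hf : SmoothPeriodic f) :
    ∫ x in (0 : ℝ)..2 * Real.pi, IPM1D.Ha a f x ^ 2 ≤
      4 * ∫ x in (0 : ℝ)..2 * Real.pi, f x ^ 2 := by
  have h1 := hasSum_sq_coef (hf.Ha ha).continuous
  have h2 := (hasSum_sq_coef hf.continuous).mul_left 4
  rw [hf.coef_Ha ha] at h1
  have h3 := hasSum_le (fun k => ?_) h1 h2
  · have hpi : 0 < (2 * Real.pi)⁻¹ := by have := Real.pi_pos; positivity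
    rw [mul_left_comm] at h3
    exact le_of_mul_le_mul_left h3 hpi
  · rw [norm_mul, mul_pow]
    refine mul_le_mul_of_nonneg_right ?_ (by positivity)
    have := norm_multiplier_le ha k
    have := norm_nonneg (multiplier a k)
    nlinarith

theorem SmoothPeriodic.sub {f₁ f₂ : ℝ → ℝ} (h₁ : SmoothPeriodic f₁) (h₂ : SmoothPeriodic f₂) :
    SmoothPeriodic fun x => f₁ x - f₂ x :=
  ⟨h₁.1.sub h₂.1, fun x => by simp only [h₁.2 x, h₂.2 x]⟩

theorem SmoothPeriodic.Ha_sub (ha : 0 < a) {f₁ f₂ : ℝ → ℝ} (h₁ : SmoothPeriodic f₁)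
    (h₂ : SmoothPeriodic f₂) (x : ℝ) :
    IPM1D.Ha a (fun x => f₁ x - f₂ x) x = IPM1D.Ha a f₁ x - IPM1D.Ha a f₂ x := by
  have h := h₁.sub h₂
  obtain ⟨i₁, e₁⟩ := Ha_eq_integral ha h₁.contDiff_one h₁.2 x
  obtain ⟨i₂, e₂⟩ := Ha_eq_integral ha h₂.contDiff_one h₂.2 x
  obtain ⟨i, e⟩ := Ha_eq_integral ha h.contDiff_one h.2 x
  rw [e, e₁, e₂, ← integral_sub i₁ i₂]
  refine integral_congr_ae (Eventually.of_forall fun y => ?_)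
  simp only
  ring

/-- A logarithmic bound of `H_a f` by the sup norm of `f` and a Hölder seminorm. -/
theorem SmoothPeriodic.abs_Ha_le (ha : 0 < a) (hf : SmoothPeriodic f) {M Q δ : ℝ}
    (hM : ∀ x, |f x| ≤ M) (hQ : ∀ x y, |x - y| ≤ 2 → |f x - f y| ≤ Q * √|x - y|)
      (hδ : 0 < δ) (hδ1 : δ ≤ 1)
    (x : ℝ) : |IPM1D.Ha a f x| ≤
      2 * Q * √δ + M * (-Real.log δ) + M * ∫ y : ℝ, a ^ 2 / (y ^ 2 + a ^ 2) := by
  have hpi := Real.pi_gt_three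
  have hpi0 := Real.pi_pos
  have hM0 : 0 ≤ M := (abs_nonneg _).trans (hM 0)
  have hQ0 : 0 ≤ Q := by simpa using (abs_nonneg _).trans (hQ 1 0 (by norm_num))
  obtain ⟨hint, e⟩ := Ha_eq_integral ha hf.contDiff_one hf.2 x
  set G : ℝ → ℝ := fun y => (f (x - y) - f (x + y)) * kernel a y with hG
  have hs1 : Ioi (0 : ℝ) = Ioc 0 δ ∪ Ioi δ := (Ioc_union_Ioi_eq_Ioi hδ.le).symm
  have hs2 : Ioi δ = Ioc δ 1 ∪ Ioi 1 := (Ioc_union_Ioi_eq_Ioi hδ1).symm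
  have hi1 : IntegrableOn G (Ioc 0 δ) := hint.mono_set fun y hy => hy.1
  have hi2 : IntegrableOn G (Ioi δ) := hint.mono_set (Ioi_subset_Ioi hδ.le)
  have hi3 : IntegrableOn G (Ioc δ 1) := hi2.mono_set fun y hy => hy.1
  have hi4 : IntegrableOn G (Ioi 1) := hi2.mono_set (Ioi_subset_Ioi hδ1)
  have e1 : IPM1D.Ha a f x = (∫ y in (0 : ℝ)..δ, G y) +
      ((∫ y in δ..1, G y) + ∫ y in Ioi 1, G y) := by
    rw [e, intervalIntegral.integral_of_le hδ.le, intervalIntegral.integral_of_le hδ1]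
    rw [hs1, setIntegral_union (s := Ioc 0 δ) (t := Ioi δ)
      (Set.disjoint_left.2 fun y h1 h2 => not_lt.2 h1.2 h2) measurableSet_Ioi hi1 hi2, hs2,
      setIntegral_union (s := Ioc δ 1) (t := Ioi 1)
      (Set.disjoint_left.2 fun y h1 h2 => not_lt.2 h1.2 h2) measurableSet_Ioi hi3 hi4]
  have hGM : ∀ y, 0 < y → |G y| ≤ 2 * M * kernel a y := by
    intro y hy
    rw [hG]; simp only
    rw [abs_mul, abs_of_pos (kernel_pos ha hy)]
    refine mul_le_mul_of_nonneg_right ?_ (kernel_pos ha hy).le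
    have := abs_sub (f (x - y)) (f (x + y))
    linarith [hM (x - y), hM (x + y)]
  -- Near the singularity the Hölder bound applies, since `2y ≤ 2δ ≤ 2`. With `√2 ≤ 3/2` and `π ≥ 3`
  -- the integrand is at most `(Q/2) y^(-1/2)`; its integral is `Q √δ`, within the stated bound.
  have b1 : |∫ y in (0 : ℝ)..δ, G y| ≤ 2 * Q * √δ := by
    have hval : ∫ y in (0 : ℝ)..δ, Q / 2 * (y ^ (-(1 / 2) : ℝ)) * 1 = Q * √δ := by
      simp only [mul_one]
      rw [intervalIntegral.integral_const_mul, integral_rpow (Or.inl (by norm_num)),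
        Real.sqrt_eq_rpow]
      norm_num
      ring
    have hle := intervalIntegral.norm_integral_le_of_norm_le (μ := volume) (f := G)
      (g := fun y => Q / 2 * (y ^ (-(1 / 2) : ℝ)) * 1) hδ.le
      ((ae_of_all _ fun y hy => ?_)) ?_
    · rw [hval, Real.norm_eq_abs] at hle
      nlinarith [Real.sqrt_nonneg δ, mul_nonneg hQ0 (Real.sqrt_nonneg δ)]
    · have hyδ : y ≤ δ := hy.2
      have hy : 0 < y := hy.1
      have hsq : y ^ (-(1 / 2) : ℝ) = (√y)⁻¹ := by
        rw [Real.rpow_neg hy.le, Real.sqrt_eq_rpow]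
      have hsy : 0 < √y := Real.sqrt_pos.2 hy
      rw [Real.norm_eq_abs, hG]; simp only
      rw [abs_mul, abs_of_pos (kernel_pos ha hy), mul_one, hsq]
      have hxy : |x - y - (x + y)| = 2 * y := by
        rw [show x - y - (x + y) = -(2 * y) by ring, abs_neg, abs_of_pos (by positivity)]
      have h1 := hQ (x - y) (x + y) (by rw [hxy]; linarith)
      rw [hxy, Real.sqrt_mul (by norm_num)] at h1
      have h2 : √2 ≤ 3 / 2 := by
        rw [Real.sqrt_le_left (by norm_num)]; norm_num
      have h3 : |f (x - y) - f (x + y)| ≤ Q * (3 / 2 * √y) :=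
        h1.trans (mul_le_mul_of_nonneg_left (mul_le_mul_of_nonneg_right h2 hsy.le) hQ0)
      have h4 : kernel a y ≤ 1 / (3 * y) := (kernel_le ha hy).trans
        (one_div_le_one_div_of_le (by positivity) (by nlinarith))
      calc |f (x - y) - f (x + y)| * kernel a y ≤ (Q * (3 / 2 * √y)) * (1 / (3 * y)) :=
            mul_le_mul h3 h4 (kernel_pos ha hy).le (by positivity)
        _ = Q / 2 * (√y)⁻¹ := by
            have : y = √y * √y := (Real.mul_self_sqrt hy.le).symm
            rw [show 1 / (3 * y) = 1 / (3 * (√y * √y)) by rw [← this]]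
            field_simp
    · simp only [mul_one]
      exact (intervalIntegral.intervalIntegrable_rpow' (by norm_num)).const_mul _
  -- In the middle range only `|f| ≤ M` and `K_a(y) ≤ 1/(2y)` are used; this is the source of the
  -- logarithm.
  have b2 : |∫ y in δ..1, G y| ≤ M * (-Real.log δ) := by
    have h0 : (0 : ℝ) ∉ uIcc δ 1 := by rw [uIcc_of_le hδ1]; exact fun h => not_le.2 hδ h.1
    have hval : ∫ y in δ..1, M * (1 / y) = M * (-Real.log δ) := by
      rw [intervalIntegral.integral_const_mul, integral_one_div h0, one_div, Real.log_inv]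
    have hle := intervalIntegral.norm_integral_le_of_norm_le (μ := volume) (f := G)
      (g := fun y => M * (1 / y)) hδ1 ((ae_of_all _ fun y hy => ?_)) ?_
    · rwa [hval] at hle
    · have hy : 0 < y := hδ.trans hy.1
      refine (hGM y hy).trans ?_
      have h4 : kernel a y ≤ 1 / (2 * y) := (kernel_le ha hy).trans
        (one_div_le_one_div_of_le (by positivity) (by nlinarith))
      calc 2 * M * kernel a y ≤ 2 * M * (1 / (2 * y)) :=
            mul_le_mul_of_nonneg_left h4 (by positivity)
        _ = M * (1 / y) := by field_simp
    · refine (ContinuousOn.intervalIntegrable ?_)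
      refine continuousOn_const.mul (continuousOn_const.div continuousOn_id fun y hy => ?_)
      rintro rfl; exact h0 hy
  -- For `y > 1` the kernel is below `y K_a(y)`, which is a multiple of the integrable Lorentzian.
  have b3 : |∫ y in Ioi 1, G y| ≤ M * ∫ y : ℝ, a ^ 2 / (y ^ 2 + a ^ 2) := by
    have hle := norm_integral_le_of_norm_le (μ := volume.restrict (Ioi 1)) (f := G)
      (g := fun y => M * (a ^ 2 / (y ^ 2 + a ^ 2)))
      ((integrable_lorentz ha).const_mul M).integrableOn
      ((ae_restrict_iff' measurableSet_Ioi).2 (Eventually.of_forall fun y hy => ?_))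
    · rw [integral_const_mul] at hle
      refine hle.trans (mul_le_mul_of_nonneg_left ?_ hM0)
      exact setIntegral_le_integral (integrable_lorentz ha)
        (Eventually.of_forall fun y => by simp only [Pi.zero_apply]; positivity)
    · have hy1 : 1 < y := hy
      have hy : 0 < y := one_pos.trans hy1
      refine (hGM y hy).trans ?_
      have h5 := mul_kernel a hy
      have h6 : kernel a y ≤ y * kernel a y := by nlinarith [kernel_pos ha hy]
      have h7 : 1 / Real.pi ≤ 1 / 2 := one_div_le_one_div_of_le (by norm_num) (by linarith)
      have h8 : 0 ≤ a ^ 2 / (y ^ 2 + a ^ 2) := by positivity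
      rw [h5] at h6
      nlinarith [mul_le_mul_of_nonneg_right h7 h8]
  rw [e1]
  have t1 := abs_add_le (∫ y in (0 : ℝ)..δ, G y) ((∫ y in δ..1, G y) + ∫ y in Ioi 1, G y)
  have t2 := abs_add_le (∫ y in δ..1, G y) (∫ y in Ioi 1, G y)
  linarith

end SmoothPeriodicHa

/-! ### Convolutions and time-dependent Fourier series -/

/-- The convolution of two sequences of Fourier coefficients. -/
noncomputable def conv (b d : ℤ → ℂ) (k : ℤ) : ℂ := ∑' m, b m * d (k - m)

/-- The sum of the summable weight. -/
noncomputable def wtSum : ℝ := ∑' k, wt k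

theorem Decay.norm_conv_term_le {B D : ℕ → ℝ} {b d : ℤ → ℂ} (hb : Decay B b) (hd : Decay D d)
    (k m : ℤ) : ‖b m * d (k - m)‖ ≤ (B 0 + B 2) * wt m * D 0 := by
  rw [norm_mul]
  have h1 := hb.norm_le_wt m
  have h2 : ‖d (k - m)‖ ≤ D 0 := by simpa using hd 0 (k - m)
  exact mul_le_mul h1 h2 (norm_nonneg _) ((norm_nonneg _).trans h1)

theorem Decay.summable_conv {B D : ℕ → ℝ} {b d : ℤ → ℂ} (hb : Decay B b) (hd : Decay D d)
    (k : ℤ) : Summable fun m => b m * d (k - m) :=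
  Summable.of_norm_bounded ((summable_wt.mul_left _).mul_right _) (hb.norm_conv_term_le hd k)

/-- Since `|k|^s ≤ 2^s (|m|^s + |k - m|^s)`, the power is carried by one factor at a time. In both
terms `b` supplies the summable weight, and `d` is only bounded. -/
theorem Decay.conv {B D : ℕ → ℝ} {b d : ℤ → ℂ} (hb : Decay B b) (hd : Decay D d) :
    Decay (fun s => 2 ^ s * (((B s + B (s + 2)) * wtSum) * D 0 + ((B 0 + B 2) * wtSum) * D s))
      (conv b d) := by
  intro s k
  have key : ∀ m, ‖(|(k : ℝ)| ^ s : ℝ) • (b m * d (k - m))‖ ≤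
      2 ^ s * (((B s + B (s + 2)) * wt m) * D 0 + ((B 0 + B 2) * wt m) * D s) := by
    intro m
    have h1 := hb.norm_le_wt m
    have h2 : ‖d (k - m)‖ ≤ D 0 := by simpa using hd 0 (k - m)
    have h3 := hb.le_wt s m
    have h4 := hd s (k - m)
    have h5 : |(k : ℝ)| ^ s ≤ 2 ^ s * (|(m : ℝ)| ^ s + |((k - m : ℤ) : ℝ)| ^ s) := by
      have h6 : |(k : ℝ)| ≤ |(m : ℝ)| + |((k - m : ℤ) : ℝ)| := by
        refine le_trans (le_of_eq ?_) (abs_add_le _ _)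
        push_cast; congr 1; ring
      refine (pow_le_pow_left₀ (abs_nonneg _) h6 s).trans
        ((add_pow_le (abs_nonneg _) (abs_nonneg _) s).trans ?_)
      exact mul_le_mul_of_nonneg_right (pow_le_pow_right₀ one_le_two (Nat.sub_le _ _))
        (by positivity)
    rw [norm_smul, Real.norm_eq_abs, abs_of_nonneg (by positivity), norm_mul]
    calc |(k : ℝ)| ^ s * (‖b m‖ * ‖d (k - m)‖)
        ≤ (2 ^ s * (|(m : ℝ)| ^ s + |((k - m : ℤ) : ℝ)| ^ s)) * (‖b m‖ * ‖d (k - m)‖) :=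
          mul_le_mul_of_nonneg_right h5 (by positivity)
      _ = 2 ^ s * ((|(m : ℝ)| ^ s * ‖b m‖) * ‖d (k - m)‖
            + ‖b m‖ * (|((k - m : ℤ) : ℝ)| ^ s * ‖d (k - m)‖)) := by ring
      _ ≤ _ := by
          refine mul_le_mul_of_nonneg_left (add_le_add ?_ ?_) (by positivity)
          · exact mul_le_mul h3 h2 (norm_nonneg _) ((by positivity : (0:ℝ) ≤ _).trans h3)
          · exact mul_le_mul h1 h4 (by positivity) ((norm_nonneg _).trans h1)
  have hsum : HasSum (fun m => 2 ^ s * (((B s + B (s + 2)) * wt m) * D 0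
      + ((B 0 + B 2) * wt m) * D s)) (2 ^ s * (((B s + B (s + 2)) * wtSum) * D 0
      + ((B 0 + B 2) * wtSum) * D s)) := by
    have hw := summable_wt.hasSum
    exact (((hw.mul_left _).mul_right _).add ((hw.mul_left _).mul_right _)).mul_left _
  have := tsum_of_norm_bounded hsum key
  rw [tsum_const_smul'', norm_smul, Real.norm_eq_abs, abs_of_nonneg (by positivity)] at this
  exact this

/-- The absolutely convergent double series of the product is regrouped along the lines of constant
total frequency `k`. -/
theorem hasSum_conv {B D : ℕ → ℝ} {b d : ℤ → ℂ} (hb : Decay B b) (hd : Decay D d) (x : ℝ) :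
    HasSum (fun k => conv b d k * mode k x) ((∑' k, b k * mode k x) * ∑' k, d k * mode k x) := by
  have n1 : Summable fun k => ‖b k * mode k x‖ := by simpa [norm_mode] using hb.summable_norm
  have n2 : Summable fun k => ‖d k * mode k x‖ := by simpa [norm_mode] using hd.summable_norm
  have h1 := (summable_mul_of_summable_norm n1 n2).hasSum
  rw [← tsum_mul_tsum_of_summable_norm n1 n2] at h1
  let e : ℤ × ℤ ≃ ℤ × ℤ :=
    { toFun := fun p => (p.2, p.1 - p.2)
      invFun := fun p => (p.1 + p.2, p.1)
      left_inv := fun p => by simp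
      right_inv := fun p => by simp }
  have h2 := (e.hasSum_iff.2 h1).prod_fiberwise (g := fun k => conv b d k * mode k x) (fun k => by
    refine ((hb.summable_conv hd k).hasSum.mul_right (mode k x)).congr_fun fun m => ?_
    have : mode k x = mode m x * mode (k - m) x := by rw [← mode_add]; congr 1; ring
    simp only [e, Equiv.coe_fn_mk, Function.comp]
    rw [this]; ring)
  exact h2

/-- Families of coefficients depending on time, which decay rapidly, uniformly in `t ∈ J`,
together with `n` time derivatives. -/
def Good (J : Set ℝ) : ℕ → (ℤ → ℝ → ℂ) → Prop
  | 0, c => (∃ B, ∀ t ∈ J, Decay B fun k => c k t) ∧ ∀ k, ContinuousOn (c k) J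
  | n + 1, c => (∃ B, ∀ t ∈ J, Decay B fun k => c k t) ∧
      ∃ d, Good J n d ∧ ∀ k, ∀ t ∈ J, HasDerivAt (c k) (d k t) t

theorem Good.decay {J : Set ℝ} {n : ℕ} {c : ℤ → ℝ → ℂ} (h : Good J n c) :
    ∃ B, ∀ t ∈ J, Decay B fun k => c k t := by
  cases n <;> exact h.1

theorem Good.continuousOn {J : Set ℝ} {n : ℕ} {c : ℤ → ℝ → ℂ} (h : Good J n c) (k : ℤ) :
    ContinuousOn (c k) J := by
  cases n with
  | zero => exact h.2 k
  | succ n =>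
    obtain ⟨_, d, _, hd⟩ := h
    exact fun t ht => (hd k t ht).continuousAt.continuousWithinAt

theorem Good.zero {J : Set ℝ} {n : ℕ} {c : ℤ → ℝ → ℂ} (h : Good J n c) : Good J 0 c :=
  ⟨h.decay, h.continuousOn⟩

theorem Good.of_succ {J : Set ℝ} {n : ℕ} {c : ℤ → ℝ → ℂ} (h : Good J (n + 1) c) : Good J n c := by
  induction n generalizing c with
  | zero => exact h.zero
  | succ n ih =>
    obtain ⟨hB, d, hd, hcd⟩ := h
    exact ⟨hB, d, ih hd, hcd⟩

theorem Good.deriv {J : Set ℝ} {n : ℕ} {c : ℤ → ℝ → ℂ} (h : Good J n c) :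
    Good J n fun k t => Complex.I * k * c k t := by
  induction n generalizing c with
  | zero =>
    obtain ⟨⟨B, hB⟩, hc⟩ := h
    exact ⟨⟨_, fun t ht => (hB t ht).deriv⟩, fun k => continuousOn_const.mul (hc k)⟩
  | succ n ih =>
    obtain ⟨⟨B, hB⟩, d, hd, hcd⟩ := h
    exact ⟨⟨_, fun t ht => (hB t ht).deriv⟩, _, ih hd, fun k t ht => (hcd k t ht).const_mul _⟩

theorem Good.mul_left {J : Set ℝ} {n : ℕ} {c : ℤ → ℝ → ℂ} (h : Good J n c) {m : ℤ → ℂ} {C : ℝ}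
    (hm : ∀ k, ‖m k‖ ≤ C) : Good J n fun k t => m k * c k t := by
  induction n generalizing c with
  | zero =>
    obtain ⟨⟨B, hB⟩, hc⟩ := h
    exact ⟨⟨_, fun t ht => (hB t ht).mul_left hm⟩, fun k => continuousOn_const.mul (hc k)⟩
  | succ n ih =>
    obtain ⟨⟨B, hB⟩, d, hd, hcd⟩ := h
    exact ⟨⟨_, fun t ht => (hB t ht).mul_left hm⟩, _, ih hd, fun k t ht => (hcd k t ht).const_mul _⟩

theorem Decay.add {B D : ℕ → ℝ} {b d : ℤ → ℂ} (hb : Decay B b) (hd : Decay D d) :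
    Decay (fun s => B s + D s) fun k => b k + d k := by
  intro s k
  refine (mul_le_mul_of_nonneg_left (norm_add_le _ _) (by positivity)).trans ?_
  rw [mul_add]
  exact add_le_add (hb s k) (hd s k)

theorem Good.add {J : Set ℝ} {n : ℕ} {c c' : ℤ → ℝ → ℂ} (h : Good J n c) (h' : Good J n c') :
    Good J n fun k t => c k t + c' k t := by
  induction n generalizing c c' with
  | zero =>
    obtain ⟨⟨B, hB⟩, hc⟩ := h
    obtain ⟨⟨B', hB'⟩, hc'⟩ := h'
    exact ⟨⟨_, fun t ht => (hB t ht).add (hB' t ht)⟩, fun k => (hc k).add (hc' k)⟩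
  | succ n ih =>
    obtain ⟨⟨B, hB⟩, d, hd, hcd⟩ := h
    obtain ⟨⟨B', hB'⟩, d', hd', hcd'⟩ := h'
    exact ⟨⟨_, fun t ht => (hB t ht).add (hB' t ht)⟩, _, ih hd hd',
      fun k t ht => (hcd k t ht).add (hcd' k t ht)⟩

/-- Leibniz rule under the sum. The bounds are uniform on `J`, so termwise differentiation is
legitimate, and each of the two resulting convolutions has one time derivative less to give. -/
theorem Good.conv {J : Set ℝ} (hJ : IsOpen J) (hJ' : IsPreconnected J) {n : ℕ} {c e : ℤ → ℝ → ℂ}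
    (hc : Good J n c) (he : Good J n e) :
    Good J n fun k t => conv (fun m => c m t) (fun m => e m t) k := by
  induction n generalizing c e with
  | zero =>
    obtain ⟨⟨B, hB⟩, hc⟩ := hc
    obtain ⟨⟨D, hD⟩, he⟩ := he
    refine ⟨⟨_, fun t ht => (hB t ht).conv (hD t ht)⟩, fun k => ?_⟩
    exact continuousOn_tsum (fun m => (hc m).mul (he (k - m)))
      ((summable_wt.mul_left (B 0 + B 2)).mul_right (D 0))
      (fun m t ht => (hB t ht).norm_conv_term_le (hD t ht) k m)
  | succ n ih =>
    have hc0 := hc.of_succ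
    have he0 := he.of_succ
    obtain ⟨⟨B, hB⟩, c', hc', hcc'⟩ := hc
    obtain ⟨⟨D, hD⟩, e', he', hee'⟩ := he
    refine ⟨⟨_, fun t ht => (hB t ht).conv (hD t ht)⟩, _, (ih hc' he0).add (ih hc0 he'), ?_⟩
    obtain ⟨B', hB'⟩ := hc'.decay
    obtain ⟨D', hD'⟩ := he'.decay
    intro k t ht
    have h := hasDerivAt_tsum_of_isPreconnected
      (g := fun m t => c m t * e (k - m) t)
      (g' := fun m t => c' m t * e (k - m) t + c m t * e' (k - m) t)
      (u := fun m => (B' 0 + B' 2) * wt m * D 0 + (B 0 + B 2) * wt m * D' 0)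
      (((summable_wt.mul_left _).mul_right _).add ((summable_wt.mul_left _).mul_right _))
      hJ hJ' (fun m y hy => (hcc' m y hy).mul (hee' (k - m) y hy))
      (fun m y hy => (norm_add_le _ _).trans (add_le_add
        ((hB' y hy).norm_conv_term_le (hD y hy) k m)
        ((hB y hy).norm_conv_term_le (hD' y hy) k m))) ht
      ((hB t ht).summable_conv (hD t ht) k) ht
    rw [((hB' t ht).summable_conv (hD t ht) k).tsum_add
      ((hB t ht).summable_conv (hD' t ht) k)] at h
    exact h

theorem hasDerivAt_tsum_time {J : Set ℝ} (hJ : IsOpen J) (hJ' : IsPreconnected J)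
    {c d : ℤ → ℝ → ℂ} {B D : ℕ → ℝ} (hB : ∀ t ∈ J, Decay B fun k => c k t)
    (hD : ∀ t ∈ J, Decay D fun k => d k t) (hcd : ∀ k, ∀ t ∈ J, HasDerivAt (c k) (d k t) t)
    (x : ℝ) {t : ℝ} (ht : t ∈ J) :
    HasDerivAt (fun t => ∑' k, c k t * mode k x) (∑' k, d k t * mode k x) t :=
  hasDerivAt_tsum_of_isPreconnected (g' := fun k t => d k t * mode k x)
    (u := fun k => (D 0 + D 2) * wt k) (summable_wt.mul_left _) hJ hJ'
    (fun k s hs => (hcd k s hs).mul_const _)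
    (fun k s hs => by rw [norm_mul, norm_mode, mul_one]; exact (hD s hs).norm_le_wt k)
    ht ((hB t ht).summable_mode x) ht

/-- Both partial derivatives are series of the same kind: the one in `x` has coefficients `ik c k`,
the one in `t` the differentiated coefficients. Each is one order less regular in time at worst,
which drives the induction. -/
theorem Good.contDiffOn {J : Set ℝ} (hJ : IsOpen J) (hJ' : IsPreconnected J) {n : ℕ}
    {c : ℤ → ℝ → ℂ} (h : Good J n c) :
    ContDiffOn ℝ n (fun p : ℝ × ℝ => ∑' k, c k p.2 * mode k p.1) (univ ×ˢ J) := by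
  induction n generalizing c with
  | zero =>
    obtain ⟨⟨B, hB⟩, hc⟩ := h
    refine contDiffOn_zero.2 (continuousOn_tsum (u := fun k => (B 0 + B 2) * wt k) (fun k => ?_)
      (summable_wt.mul_left _) fun k p hp => ?_)
    · exact ((hc k).comp continuousOn_snd fun p hp => hp.2).mul
        ((continuous_mode k).comp continuous_fst).continuousOn
    · rw [norm_mul, norm_mode, mul_one]
      exact (hB p.2 hp.2).norm_le_wt k
  | succ n ih =>
    have h0 := h.of_succ
    obtain ⟨⟨B, hB⟩, d, hd, hcd⟩ := h
    obtain ⟨D, hD⟩ := hd.decay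
    have hopen : IsOpen ((univ : Set ℝ) ×ˢ J) := isOpen_univ.prod hJ
    -- `Φ z` and `Ψ z` are the linear maps `p ↦ p.1 • z` and `p ↦ p.2 • z`. Being continuous and
    -- linear in `z`, they commute with the sums over `k`.
    let Φ := ContinuousLinearMap.smulRightL ℝ (ℝ × ℝ) ℂ (ContinuousLinearMap.fst ℝ ℝ ℝ)
    let Ψ := ContinuousLinearMap.smulRightL ℝ (ℝ × ℝ) ℂ (ContinuousLinearMap.snd ℝ ℝ ℝ)
    have hfd : ∀ p ∈ (univ : Set ℝ) ×ˢ J, HasFDerivAt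
        (fun p : ℝ × ℝ => ∑' k, c k p.2 * mode k p.1)
        (Φ (∑' k : ℤ, (Complex.I * k * c k p.2) * mode k p.1) +
          Ψ (∑' k, d k p.2 * mode k p.1)) p := by
      intro p hp
      have hs1 := (hB p.2 hp.2).deriv.summable_mode p.1
      have hs2 := (hD p.2 hp.2).summable_mode p.1
      have h := hasFDerivAt_tsum_of_isPreconnected (𝕜 := ℝ)
        (f := fun k (p : ℝ × ℝ) => c k p.2 * mode k p.1)
        (f' := fun k p => Φ ((Complex.I * k * c k p.2) * mode k p.1) + Ψ (d k p.2 * mode k p.1))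
        (u := fun k => ‖Φ‖ * ((B 1 + B (1 + 2)) * wt k) + ‖Ψ‖ * ((D 0 + D 2) * wt k))
        (((summable_wt.mul_left _).mul_left _).add ((summable_wt.mul_left _).mul_left _))
        hopen (isPreconnected_univ.prod hJ') ?_ ?_ hp ((hB p.2 hp.2).summable_mode p.1) hp
      · rw [(Φ.summable hs1).tsum_add (Ψ.summable hs2), ← Φ.map_tsum hs1, ← Ψ.map_tsum hs2] at h
        exact h
      · intro k q hq
        have h1 : HasFDerivAt (fun q : ℝ × ℝ => c k q.2) _ q :=
          (hcd k q.2 hq.2).hasFDerivAt.comp q hasFDerivAt_snd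
        have h2 : HasFDerivAt (fun q : ℝ × ℝ => mode k q.1) _ q :=
          (hasDerivAt_mode k q.1).hasFDerivAt.comp q hasFDerivAt_fst
        refine (h1.mul h2).congr_fderiv ?_
        ext <;> simp [Φ, Ψ] <;> ring
      · intro k q hq
        refine (norm_add_le _ _).trans (add_le_add ?_ ?_)
        · refine (Φ.le_opNorm _).trans (mul_le_mul_of_nonneg_left ?_ (norm_nonneg _))
          have := (hB q.2 hq.2).le_wt 1 k
          rw [norm_mul, norm_mode, mul_one, norm_mul, norm_mul, Complex.norm_I, one_mul,
            Complex.norm_intCast]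
          simpa using this
        · refine (Ψ.le_opNorm _).trans (mul_le_mul_of_nonneg_left ?_ (norm_nonneg _))
          rw [norm_mul, norm_mode, mul_one]
          exact (hD q.2 hq.2).norm_le_wt k
    rw [Nat.cast_add, Nat.cast_one, contDiffOn_succ_iff_fderiv_of_isOpen hopen]
    refine ⟨fun p hp => (hfd p hp).differentiableAt.differentiableWithinAt, by simp, ?_⟩
    refine ContDiffOn.congr ?_ fun p hp => (hfd p hp).fderiv
    exact (Φ.contDiff.comp_contDiffOn (ih h0.deriv)).add (Ψ.contDiff.comp_contDiffOn (ih hd))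

/-! ### The nonlinearity and its energy estimate -/

/-- The Fourier coefficients of `(H_a f) f'`, where `c` are those of `f`. -/
noncomputable def nl (a : ℝ) (c : ℤ → ℂ) (k : ℤ) : ℂ :=
  conv (fun m => multiplier a m * c m) (fun n => Complex.I * n * c n) k

theorem multiplier_zero (a : ℝ) : multiplier a 0 = 0 := by simp [multiplier_eq]

theorem conj_multiplier_neg (a : ℝ) (k : ℤ) : conj (multiplier a (-k)) = multiplier a k := by
  rw [multiplier_eq, multiplier_eq]
  simp only [Int.cast_neg, neg_mul, Real.sin_neg, integral_neg, map_mul, map_neg,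
      Complex.conj_ofReal,
    Complex.conj_I, Complex.ofReal_neg, map_ofNat]
  ring

theorem conj_conv_neg (b d : ℤ → ℂ) (k : ℤ) :
    conj (conv b d (-k)) = conv (fun m => conj (b (-m))) (fun m => conj (d (-m))) k := by
  rw [conv, conv, Complex.conj_tsum, ← (Equiv.neg ℤ).tsum_eq]
  refine tsum_congr fun m => ?_
  rw [map_mul, Equiv.neg_apply]
  congr 3; ring

/-- The nonlinearity commutes with the reflection `c ↦ conj (c (-·))`, whose fixed points are the
coefficients of real functions. This lets the truncated flow preserve reality. -/
theorem conj_nl_neg (a : ℝ) (c : ℤ → ℂ) (k : ℤ) :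
    conj (nl a c (-k)) = nl a (fun m => conj (c (-m))) k := by
  rw [nl, conj_conv_neg, nl]
  congr 1
  · ext m; rw [map_mul, conj_multiplier_neg]
  · ext m
    simp

/-- The cancellation behind the energy estimate, with `x` and `y` the frequencies of the two copies
of the solution and `-(x + y)` that of the velocity. For `s ≥ 1` the left side is `xy (x^(2s-1) -
(-y)^(2s-1))`, which contains a factor `x + y`. Hence the `2s + 1` derivatives can be distributed so
that one of the three factors carries one and the other two carry `s` each. -/
theorem abs_symm_weight_le (s : ℕ) (x y : ℝ) :
    |x ^ (2 * s) * y + y ^ (2 * s) * x| ≤ ((2 * s + 1 : ℕ) * 2 ^ s : ℝ) *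
      (|x + y| * |y| ^ s * |x| ^ s + |x + y| ^ s * |y| * |x| ^ s +
        |x + y| ^ s * |y| ^ s * |x|) := by
  rcases s with _ | r
  · simp only [mul_zero, pow_zero, one_mul, mul_one, zero_add, Nat.cast_one]
    rw [add_comm y x]
    linarith [abs_nonneg x, abs_nonneg y]
  · have main : ∀ x y : ℝ, |y| ≤ |x| → |x ^ (2 * (r + 1)) * y + y ^ (2 * (r + 1)) * x| ≤
        ((2 * (r + 1) + 1 : ℕ) * 2 ^ (r + 1) : ℝ) *
          (|x + y| * |y| ^ (r + 1) * |x| ^ (r + 1) + |x + y| ^ (r + 1) * |y| * |x| ^ (r + 1)) := by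
      intro x y hxy
      have h1 : x ^ (2 * (r + 1)) * y + y ^ (2 * (r + 1)) * x
          = x * y * (x ^ (2 * r + 1) - (-y) ^ (2 * r + 1)) := by
        rw [Odd.neg_pow ⟨r, rfl⟩]; ring
      have h2 := abs_pow_sub_pow_le x (-y) (2 * r + 1)
      rw [sub_neg_eq_add, abs_neg, max_eq_left hxy, Nat.add_sub_cancel] at h2
      -- Of the `2r` powers of the larger frequency `x`, half stay on `x` and half are passed on to
      -- `x + y` or `y`.
      have h3 : |x| ^ r ≤ 2 ^ r * (|x + y| ^ r + |y| ^ r) := by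
        have h4 : |x| ≤ |x + y| + |y| := by
          refine le_trans (le_of_eq ?_) (abs_sub (x + y) y)
          congr 1; ring
        refine (pow_le_pow_left₀ (abs_nonneg _) h4 r).trans
          ((add_pow_le (abs_nonneg _) (abs_nonneg _) r).trans ?_)
        exact mul_le_mul_of_nonneg_right (pow_le_pow_right₀ one_le_two (Nat.sub_le _ _))
          (by positivity)
      have h5 : ((2 * r + 1 : ℕ) : ℝ) * 2 ^ r ≤ (2 * (r + 1) + 1 : ℕ) * 2 ^ (r + 1) := by
        refine mul_le_mul ?_ (pow_le_pow_right₀ one_le_two (Nat.le_succ r)) (by positivity)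
          (by positivity)
        exact_mod_cast (by omega)
      rw [h1, abs_mul, abs_mul]
      calc |x| * |y| * |x ^ (2 * r + 1) - (-y) ^ (2 * r + 1)|
          ≤ |x| * |y| * (|x + y| * (2 * r + 1 : ℕ) * |x| ^ (2 * r)) :=
            mul_le_mul_of_nonneg_left h2 (by positivity)
        _ = (|x| ^ (r + 1) * |y| * |x + y| * (2 * r + 1 : ℕ)) * |x| ^ r := by ring
        _ ≤ (|x| ^ (r + 1) * |y| * |x + y| * (2 * r + 1 : ℕ)) * (2 ^ r * (|x + y| ^ r + |y| ^ r)) :=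
            mul_le_mul_of_nonneg_left h3 (by positivity)
        _ = (((2 * r + 1 : ℕ) : ℝ) * 2 ^ r) * (|x + y| * |y| ^ (r + 1) * |x| ^ (r + 1)
              + |x + y| ^ (r + 1) * |y| * |x| ^ (r + 1)) := by ring
        _ ≤ _ := mul_le_mul_of_nonneg_right h5 (by positivity)
    rcases le_total |y| |x| with h | h
    · refine (main x y h).trans (mul_le_mul_of_nonneg_left ?_ (by positivity))
      have : 0 ≤ |x + y| ^ (r + 1) * |y| ^ (r + 1) * |x| := by positivity
      linarith
    · have h1 := main y x h
      rw [add_comm y x] at h1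
      rw [add_comm (x ^ _ * y)]
      refine h1.trans (mul_le_mul_of_nonneg_left ?_ (by positivity))
      have : 0 ≤ |x + y| ^ (r + 1) * |y| * |x| ^ (r + 1) := by positivity
      nlinarith

section Trilinear

variable {S : Finset ℤ}

/-- As `q` lives on `S`, the right side is its full sum; the left side is part of a reflected
translate of that sum. -/
theorem sum_shift_le {q : ℤ → ℝ} (hq : ∀ k, 0 ≤ q k) (hS : ∀ k ∉ S, q k = 0) (m : ℤ) :
    ∑ l ∈ S, q (-m - l) ≤ ∑ k ∈ S, q k := by
  have hs : Summable q := summable_of_ne_finset_zero (s := S) fun k hk => hS k hk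
  have h1 := ((Equiv.subLeft (-m)).summable_iff.2 hs).sum_le_tsum S (fun l _ => hq _)
  rw [(Equiv.subLeft (-m)).tsum_eq, tsum_eq_sum fun k hk => hS k hk] at h1
  exact h1

/-- An `ℓ¹ · ℓ² · ℓ²` bound over triples of frequencies with sum zero: the product of the two `v` is
split by `pq ≤ (p² + q²)/2`. The next two lemmas place the `ℓ¹` factor `w` in the other two slots.
-/
theorem sum_trilinear_left {w v : ℤ → ℝ} (hw : ∀ k, 0 ≤ w k)
    (hvS : ∀ k ∉ S, v k = 0) :
    ∑ m ∈ S, ∑ l ∈ S, w m * v (-m - l) * v l ≤ (∑ k ∈ S, w k) * ∑ k ∈ S, v k ^ 2 := by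
  rw [Finset.sum_mul]
  refine Finset.sum_le_sum fun m _ => ?_
  have h1 := sum_shift_le (S := S) (q := fun k => v k ^ 2) (fun k => sq_nonneg _)
    (fun k hk => by simp [hvS k hk]) m
  calc ∑ l ∈ S, w m * v (-m - l) * v l
      ≤ ∑ l ∈ S, w m * ((1 / 2) * v (-m - l) ^ 2 + (1 / 2) * v l ^ 2) := by
        refine Finset.sum_le_sum fun l _ => ?_
        rw [mul_assoc]
        refine mul_le_mul_of_nonneg_left ?_ (hw m)
        nlinarith [sq_nonneg (v (-m - l) - v l)]
    _ = w m * ((1 / 2) * ∑ l ∈ S, v (-m - l) ^ 2 + (1 / 2) * ∑ l ∈ S, v l ^ 2) := by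
        rw [← Finset.mul_sum, Finset.sum_add_distrib, Finset.mul_sum, Finset.mul_sum]
    _ ≤ _ := mul_le_mul_of_nonneg_left (by linarith) (hw m)

theorem sum_trilinear_right {w v : ℤ → ℝ} (hw : ∀ k, 0 ≤ w k)
    (hvS : ∀ k ∉ S, v k = 0) :
    ∑ m ∈ S, ∑ l ∈ S, v m * v (-m - l) * w l ≤ (∑ k ∈ S, w k) * ∑ k ∈ S, v k ^ 2 := by
  rw [Finset.sum_comm]
  refine le_trans (le_of_eq ?_) (sum_trilinear_left hw hvS)
  refine Finset.sum_congr rfl fun m _ => Finset.sum_congr rfl fun l _ => ?_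
  rw [show -l - m = -m - l by ring]; ring

theorem sum_trilinear_mid {w v : ℤ → ℝ} (hw : ∀ k, 0 ≤ w k)
    (hwS : ∀ k ∉ S, w k = 0) :
    ∑ m ∈ S, ∑ l ∈ S, v m * w (-m - l) * v l ≤ (∑ k ∈ S, w k) * ∑ k ∈ S, v k ^ 2 := by
  calc ∑ m ∈ S, ∑ l ∈ S, v m * w (-m - l) * v l
      ≤ ∑ m ∈ S, ∑ l ∈ S, ((1 / 2) * (w (-m - l) * v m ^ 2) +
        (1 / 2) * (w (-m - l) * v l ^ 2)) := by
        refine Finset.sum_le_sum fun m _ => Finset.sum_le_sum fun l _ => ?_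
        nlinarith [mul_nonneg (hw (-m - l)) (sq_nonneg (v m - v l))]
    _ = (1 / 2) * (∑ m ∈ S, (∑ l ∈ S, w (-m - l)) * v m ^ 2)
        + (1 / 2) * (∑ l ∈ S, (∑ m ∈ S, w (-l - m)) * v l ^ 2) := by
        simp only [Finset.sum_add_distrib, ← Finset.mul_sum, Finset.sum_mul]
        congr 2
        rw [Finset.sum_comm]
        refine Finset.sum_congr rfl fun m _ => Finset.sum_congr rfl fun l _ => ?_
        rw [show -l - m = -m - l by ring]
    _ ≤ (1 / 2) * ((∑ k ∈ S, w k) * ∑ k ∈ S, v k ^ 2)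
        + (1 / 2) * ((∑ k ∈ S, w k) * ∑ k ∈ S, v k ^ 2) := by
        have : ∑ m ∈ S, (∑ l ∈ S, w (-m - l)) * v m ^ 2 ≤ (∑ k ∈ S, w k) * ∑ k ∈ S, v k ^ 2 := by
          rw [Finset.mul_sum]
          exact Finset.sum_le_sum fun m _ =>
            mul_le_mul_of_nonneg_right (sum_shift_le hw hwS m) (sq_nonneg _)
        linarith
    _ = _ := by ring

end Trilinear

/-- The energy estimate: the highest order terms of the nonlinearity cancel. -/
theorem norm_energy_le {a : ℝ} (ha : 0 < a) {S : Finset ℤ} {c : ℤ → ℂ} (hc : ∀ k ∉ S, c k = 0)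
    (hconj : ∀ k, conj (c (-k)) = c k) (s : ℕ) :
    ‖∑ k ∈ S, (k : ℂ) ^ (2 * s) * conj (c k) * nl a c k‖ ≤
      (3 * ((2 * s + 1 : ℕ) * 2 ^ s) : ℝ) * (∑ k ∈ S, |(k : ℝ)| * ‖c k‖) *
        ∑ k ∈ S, (|(k : ℝ)| ^ s * ‖c k‖) ^ 2 := by
  have hcn : ∀ k, conj (c k) = c (-k) := fun k => by rw [← hconj (-k), neg_neg]
  set T : ℤ → ℤ → ℂ := fun m l => (l : ℂ) ^ (2 * s) * c l * (multiplier a m * c m) *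
    (Complex.I * ((-m - l : ℤ) : ℂ) * c (-m - l)) with hT
  have hTS : ∀ m, ∀ l ∉ S, T m l = 0 := fun m l hl => by simp [hT, hc l hl]
  -- Reality turns `conj (c k)` into `c (-k)`; with `l = -k` the three frequencies `m`, `l`, `-m -
  -- l` sum to zero.
  have e1 : ∑ k ∈ S, (k : ℂ) ^ (2 * s) * conj (c k) * nl a c k = ∑ m ∈ S, ∑' l, T m l := by
    have h1 : ∀ k, nl a c k = ∑ m ∈ S, (multiplier a m * c m) *
        (Complex.I * ((k - m : ℤ) : ℂ) * c (k - m)) := fun k =>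
      tsum_eq_sum fun m hm => by simp [hc m hm]
    simp only [h1, Finset.mul_sum]
    rw [Finset.sum_comm]
    refine Finset.sum_congr rfl fun m _ => ?_
    rw [← (Equiv.neg ℤ).tsum_eq, tsum_eq_sum (s := S) fun k hk => ?_]
    · refine Finset.sum_congr rfl fun k _ => ?_
      simp only [hT, Equiv.neg_apply, hcn]
      rw [show -m - -k = k - m by ring, Int.cast_neg, Even.neg_pow ⟨s, by ring⟩]
      ring
    · simp only [hT, Equiv.neg_apply]
      rw [← hcn, hc k hk]; simp
  obtain ⟨U, hU⟩ : ∃ U : ℤ → ℤ → ℂ, ∀ m l, U m l =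
      (Complex.I * multiplier a m * c m * c (-m - l) * c l) *
      (((l : ℝ) ^ (2 * s) * ((-m - l : ℤ) : ℝ) + ((-m - l : ℤ) : ℝ) ^ (2 * s) * l : ℝ) : ℂ) :=
    ⟨_, fun _ _ => rfl⟩
  -- Averaging over the exchange `l ↔ -m - l` symmetrises the weight into the form of
  -- `abs_symm_weight_le`. The resulting factor `1/2` later absorbs the bound `2` of the multiplier.
  have e2 : ∀ m, ∑' l, T m l = (1 / 2) * ∑ l ∈ S, U m l := by
    intro m
    have hs1 : Summable (T m) := summable_of_ne_finset_zero (s := S) (hTS m)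
    have hs2 : Summable fun l => T m (-m - l) :=
      hs1.comp_injective (i := fun l => -m - l) (sub_right_injective (b := -m))
    have h3 : ∑' l, T m (-m - l) = ∑' l, T m l := (Equiv.subLeft (-m)).tsum_eq (T m)
    have h4 : ∑' l, T m l = (1 / 2) * ∑' l, (T m l + T m (-m - l)) := by
      rw [hs1.tsum_add hs2, h3]; ring
    rw [h4, tsum_eq_sum (s := S) fun l hl => ?_]
    · congr 1
      refine Finset.sum_congr rfl fun l _ => ?_
      simp only [hT, hU]
      rw [show -m - (-m - l) = l by ring]
      push_cast; ring
    · rw [hTS m l hl]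
      simp only [hT]
      rw [show -m - (-m - l) = l by ring, hc l hl]; simp
  set w : ℤ → ℝ := fun k => |(k : ℝ)| * ‖c k‖ with hw
  set v : ℤ → ℝ := fun k => |(k : ℝ)| ^ s * ‖c k‖ with hv
  obtain ⟨C, hC⟩ : ∃ C : ℝ, C = (2 * s + 1 : ℕ) * 2 ^ s := ⟨_, rfl⟩
  have hC0 : 0 ≤ C := by rw [hC]; positivity
  have hCle := abs_symm_weight_le s
  rw [← hC] at hCle ⊢
  have e3 : ∀ m, ‖∑' l, T m l‖ ≤ C * ∑ l ∈ S, (w m * v (-m - l) * v l + v m * w (-m - l) * v l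
      + v m * v (-m - l) * w l) := by
    intro m
    rw [e2 m, norm_mul, Finset.mul_sum]
    have h12 : ‖(1 / 2 : ℂ)‖ = 1 / 2 := by norm_num
    rw [h12]
    have hn : 1 / 2 * ‖∑ l ∈ S, U m l‖ ≤ 1 / 2 * ∑ l ∈ S, ‖U m l‖ :=
      mul_le_mul_of_nonneg_left (norm_sum_le S (U m)) (by norm_num)
    refine hn.trans ?_
    rw [Finset.mul_sum]
    refine Finset.sum_le_sum fun l _ => ?_
    rw [hU, norm_mul, norm_mul, norm_mul, norm_mul, norm_mul, Complex.norm_I, one_mul,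
      Complex.norm_real, Real.norm_eq_abs]
    have h5 := hCle (l : ℝ) ((-m - l : ℤ) : ℝ)
    have h6 : |(l : ℝ) + ((-m - l : ℤ) : ℝ)| = |(m : ℝ)| := by
      push_cast
      rw [show (l : ℝ) + (-m - l) = -m by ring, abs_neg]
    rw [h6] at h5
    have hX := abs_nonneg ((l : ℝ) ^ (2 * s) * ((-m - l : ℤ) : ℝ) +
        ((-m - l : ℤ) : ℝ) ^ (2 * s) * l)
    have h7 : ‖multiplier a m‖ * ‖c m‖ * ‖c (-m - l)‖ * ‖c l‖ ≤
        2 * ‖c m‖ * ‖c (-m - l)‖ * ‖c l‖ := by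
      have := norm_multiplier_le ha m
      gcongr
    refine (mul_le_mul_of_nonneg_left (mul_le_mul h7 h5 hX (by positivity))
      (by norm_num : (0 : ℝ) ≤ 1 / 2)).trans (le_of_eq ?_)
    simp only [hw, hv]
    ring
  rw [e1]
  calc ‖∑ m ∈ S, ∑' l, T m l‖ ≤ ∑ m ∈ S, ‖∑' l, T m l‖ := norm_sum_le _ _
    _ ≤ ∑ m ∈ S, C * ∑ l ∈ S, (w m * v (-m - l) * v l + v m * w (-m - l) * v l
      + v m * v (-m - l) * w l) := Finset.sum_le_sum fun m _ => e3 m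
    _ = C * (∑ m ∈ S, ∑ l ∈ S, w m * v (-m - l) * v l + ∑ m ∈ S, ∑ l ∈ S, v m * w (-m - l) * v l
      + ∑ m ∈ S, ∑ l ∈ S, v m * v (-m - l) * w l) := by
        simp only [← Finset.mul_sum, Finset.sum_add_distrib]
    _ ≤ C * (3 * ((∑ k ∈ S, w k) * ∑ k ∈ S, v k ^ 2)) := by
        refine mul_le_mul_of_nonneg_left ?_ (by positivity)
        have hw0 : ∀ k, 0 ≤ w k := fun k => by simp only [hw]; positivity
        have hwS : ∀ k ∉ S, w k = 0 := fun k hk => by simp [hw, hc k hk]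
        have hvS : ∀ k ∉ S, v k = 0 := fun k hk => by simp [hv, hc k hk]
        have t1 := sum_trilinear_left hw0 hvS
        have t2 := sum_trilinear_mid (v := v) hw0 hwS
        have t3 := sum_trilinear_right hw0 hvS
        linarith
    _ = _ := by ring

/-! ### Ordinary differential equations and the Galerkin system -/

/-- A bounded `C¹` vector field on a finite dimensional space has a unique integral curve through
each point, on any bounded time interval. -/
theorem exists_unique_integralCurve {E : Type*} [NormedAddCommGroup E] [NormedSpace ℝ E]
    [FiniteDimensional ℝ E] {V : E → E} (hV : ContDiff ℝ 1 V) {L : ℝ} (hL : ∀ x, ‖V x‖ ≤ L)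
    (x₀ : E) {τ : ℝ} (hτ : 0 < τ) :
    ∃ α : ℝ → E, α 0 = x₀ ∧ (∀ t ∈ Ioo (-τ) τ, HasDerivAt α (V (α t)) t) ∧
      ∀ β : ℝ → E, β 0 = x₀ → (∀ t ∈ Ioo (-τ) τ, HasDerivAt β (V (β t)) t) →
        EqOn β α (Ioo (-τ) τ) := by
  have : ProperSpace E := FiniteDimensional.proper ℝ E
  have : CompleteSpace E := FiniteDimensional.complete ℝ E
  have hL0 : 0 ≤ L := (norm_nonneg _).trans (hL x₀)
  -- At speed at most `L` no curve leaves this ball before time `τ`, so a Lipschitz constant on the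
  -- compact ball suffices.
  set r : ℝ := L * τ with hr
  have hr0 : 0 ≤ r := by positivity
  obtain ⟨C, hC⟩ := (isCompact_closedBall x₀ r).exists_bound_of_continuousOn
    (hV.continuous_fderiv one_ne_zero).continuousOn
  have hlip : LipschitzOnWith C.toNNReal V (Metric.closedBall x₀ r) := by
    refine (convex_closedBall x₀ r).lipschitzOnWith_of_nnnorm_fderiv_le (𝕜 := ℝ)
      (fun x _ => (hV.differentiable one_ne_zero) x) fun x hx => ?_
    rw [← NNReal.coe_le_coe, coe_nnnorm]
    exact (hC x hx).trans (Real.le_coe_toNNReal C)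
  have h0 : (0 : ℝ) ∈ Icc (-τ) τ := ⟨by linarith, hτ.le⟩
  have hpl : IsPicardLindelof (fun _ : ℝ => V) (⟨0, h0⟩ : Icc (-τ) τ) x₀ ⟨r, hr0⟩ 0 ⟨L, hL0⟩
      C.toNNReal :=
    { lipschitzOnWith := fun t _ => hlip
      continuousOn := fun x _ => continuousOn_const
      norm_le := fun t _ x _ => hL x
      mul_max_le := by
        change L * max (τ - 0) (0 - -τ) ≤ L * τ - 0
        simp }
  obtain ⟨α, hα0, hα⟩ := hpl.exists_eq_forall_mem_Icc_hasDerivWithinAt₀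
  have hα' : ∀ t ∈ Ioo (-τ) τ, HasDerivAt α (V (α t)) t := fun t ht =>
    (hα t (Ioo_subset_Icc_self ht)).hasDerivAt (Icc_mem_nhds ht.1 ht.2)
  have h0' : (0 : ℝ) ∈ Ioo (-τ) τ := ⟨by linarith, hτ⟩
  have hball : ∀ β : ℝ → E, β 0 = x₀ → (∀ t ∈ Ioo (-τ) τ, HasDerivAt β (V (β t)) t) →
      ∀ t ∈ Ioo (-τ) τ, β t ∈ Metric.closedBall x₀ r := by
    intro β hβ0 hβ t ht
    have := Convex.norm_image_sub_le_of_norm_hasDerivWithin_le (f := β)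
      (f' := fun t => V (β t)) (fun x hx => (hβ x hx).hasDerivWithinAt) (fun x _ => hL _)
      (convex_Ioo _ _) h0' ht
    rw [mem_closedBall_iff_norm, ← hβ0]
    refine this.trans (mul_le_mul_of_nonneg_left ?_ hL0)
    rw [sub_zero]
    exact (abs_lt.2 ht).le
  refine ⟨α, hα0, hα', fun β hβ0 hβ => ?_⟩
  exact ODE_solution_unique_of_mem_Ioo (v := fun _ => V) (s := fun _ => Metric.closedBall x₀ r)
    (fun t _ => hlip) h0' (fun t ht => ⟨hβ t ht, hball β hβ0 hβ t ht⟩)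
    (fun t ht => ⟨hα' t ht, hball α hα0 hα' t ht⟩) (hβ0.trans hα0.symm)

/-- Two-sided Grönwall inequality. -/
theorem le_mul_exp_of_abs_deriv_le {f f' : ℝ → ℝ} {τ κ : ℝ}
    (hf : ∀ t ∈ Ioo (-τ) τ, HasDerivAt f (f' t) t) (hf' : ∀ t ∈ Ioo (-τ) τ, |f' t| ≤ κ * f t)
    {t : ℝ} (ht : t ∈ Ioo (-τ) τ) : f t ≤ f 0 * Real.exp (κ * |t|) := by
  have hτ : 0 < τ := by have := ht.1.trans ht.2; linarith
  have h0 : (0 : ℝ) ∈ Ioo (-τ) τ := ⟨by linarith, hτ⟩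
  have hd : ∀ σ : ℝ, ∀ t ∈ Ioo (-τ) τ, HasDerivAt (fun t => f t * Real.exp (σ * t))
      ((f' t + σ * f t) * Real.exp (σ * t)) t := by
    intro σ t ht
    have h1 : HasDerivAt (fun t : ℝ => Real.exp (σ * t)) (Real.exp (σ * t) * σ) t := by
      simpa using ((hasDerivAt_id t).const_mul σ).exp
    exact ((hf t ht).mul h1).congr_deriv (by ring)
  rcases le_total 0 t with h | h
  · have hanti : AntitoneOn (fun t => f t * Real.exp (-κ * t)) (Ioo (-τ) τ) := by
      refine antitoneOn_of_deriv_nonpos (convex_Ioo _ _)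
        (fun t ht => (hd _ t ht).continuousAt.continuousWithinAt) (fun t ht => ?_) fun t ht => ?_
      · rw [interior_Ioo] at ht
        exact (hd _ t ht).differentiableAt.differentiableWithinAt
      · rw [interior_Ioo] at ht
        rw [(hd _ t ht).deriv]
        have := (abs_le.1 (hf' t ht)).2
        exact mul_nonpos_of_nonpos_of_nonneg (by linarith) (Real.exp_pos _).le
    have := hanti h0 ht h
    simp only [mul_zero, Real.exp_zero, mul_one, neg_mul, Real.exp_neg] at this
    rw [abs_of_nonneg h]
    rwa [mul_inv_le_iff₀ (Real.exp_pos _)] at this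
  · have hmono : MonotoneOn (fun t => f t * Real.exp (κ * t)) (Ioo (-τ) τ) := by
      refine monotoneOn_of_deriv_nonneg (convex_Ioo _ _)
        (fun t ht => (hd _ t ht).continuousAt.continuousWithinAt) (fun t ht => ?_) fun t ht => ?_
      · rw [interior_Ioo] at ht
        exact (hd _ t ht).differentiableAt.differentiableWithinAt
      · rw [interior_Ioo] at ht
        rw [(hd _ t ht).deriv]
        have := (abs_le.1 (hf' t ht)).1
        exact mul_nonneg (by linarith) (Real.exp_pos _).le
    have := hmono ht h0 h
    simp only [mul_zero, Real.exp_zero, mul_one] at this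
    rw [abs_of_nonpos h, mul_neg, Real.exp_neg, ← div_eq_mul_inv, le_div_iff₀ (Real.exp_pos _)]
    exact this

/-- The squared homogeneous Sobolev norm of the modes in `S`. -/
noncomputable def sobolev (S : Finset ℤ) (s : ℕ) (c : ℤ → ℂ) : ℝ :=
  ∑ k ∈ S, (|(k : ℝ)| ^ s * ‖c k‖) ^ 2

theorem sobolev_nonneg (S : Finset ℤ) (s : ℕ) (c : ℤ → ℂ) : 0 ≤ sobolev S s c :=
  Finset.sum_nonneg fun _ _ => sq_nonneg _

theorem sq_le_sobolev {S : Finset ℤ} {c : ℤ → ℂ} (hc : ∀ k ∉ S, c k = 0) (s : ℕ) (k : ℤ) :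
    (|(k : ℝ)| ^ s * ‖c k‖) ^ 2 ≤ sobolev S s c := by
  by_cases hk : k ∈ S
  · exact Finset.single_le_sum (f := fun k : ℤ => (|(k : ℝ)| ^ s * ‖c k‖) ^ 2)
      (fun _ _ => sq_nonneg _) hk
  · rw [hc k hk]; simpa using sobolev_nonneg S s c

theorem le_one_add_sobolev {S : Finset ℤ} {c : ℤ → ℂ} (hc : ∀ k ∉ S, c k = 0) (s : ℕ) (k : ℤ) :
    |(k : ℝ)| ^ s * ‖c k‖ ≤ 1 + sobolev S s c := by
  have := sq_le_sobolev hc s k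
  nlinarith [sq_nonneg (|(k : ℝ)| ^ s * ‖c k‖ - 1)]

theorem abs_intCast_le_sq (k : ℤ) : |(k : ℝ)| ≤ |(k : ℝ)| ^ 2 := by
  rcases eq_or_ne k 0 with rfl | hk
  · simp
  · have : (1 : ℝ) ≤ |(k : ℝ)| := by exact_mod_cast Int.one_le_abs hk
    nlinarith

/-- A smooth cutoff, equal to `1` on `(-∞, R]` and to `0` on `[2R, ∞)`. -/
noncomputable def cutoff (R y : ℝ) : ℝ := Real.smoothTransition (2 - y / R)

theorem cutoff_nonneg (R y : ℝ) : 0 ≤ cutoff R y := Real.smoothTransition.nonneg _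

theorem cutoff_le_one (R y : ℝ) : cutoff R y ≤ 1 := Real.smoothTransition.le_one _

theorem cutoff_eq_one {R y : ℝ} (hR : 0 < R) (h : y ≤ R) : cutoff R y = 1 := by
  apply Real.smoothTransition.one_of_one_le
  have : y / R ≤ 1 := by rwa [div_le_one hR]
  linarith

theorem cutoff_eq_zero {R y : ℝ} (hR : 0 < R) (h : 2 * R ≤ y) : cutoff R y = 0 := by
  apply Real.smoothTransition.zero_of_nonpos
  have : 2 ≤ y / R := by rwa [le_div_iff₀ hR]
  linarith

/-- The cutoff vanishes unless the squared `H²` seminorm is below `2R`. There `|k| ‖c k‖ ≤ wt k +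
(k² ‖c k‖)²/2`, and summation gives a bound independent of `S`. -/
theorem cutoff_mul_sum_le {R : ℝ} (hR : 0 < R) (S : Finset ℤ) (c : ℤ → ℂ) :
    cutoff R (sobolev S 2 c) * ∑ k ∈ S, |(k : ℝ)| * ‖c k‖ ≤ wtSum + R := by
  have hw0 : 0 ≤ wtSum := tsum_nonneg fun k => (wt_pos k).le
  rcases le_total (2 * R) (sobolev S 2 c) with h | h
  · rw [cutoff_eq_zero hR h, zero_mul]; linarith
  · have h1 : ∑ k ∈ S, |(k : ℝ)| * ‖c k‖ ≤ ∑ k ∈ S,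
      (wt k + (1 / 2) * (|(k : ℝ)| ^ 2 * ‖c k‖) ^ 2) := by
      refine Finset.sum_le_sum fun k _ => ?_
      have hwt : wt k * (1 + |(k : ℝ)| ^ 2) = 1 := by
        rw [wt, sq_abs, one_div_mul_cancel (by positivity)]
      have hk := abs_intCast_le_sq k
      have hx := abs_nonneg (k : ℝ)
      have hz := norm_nonneg (c k)
      generalize |(k : ℝ)| = x at *
      generalize ‖c k‖ = z at *
      have hwp := wt_pos k
      generalize wt k = w at *
      rcases eq_or_ne x 0 with rfl | hx0
      · simp; positivity
      · have hxp : 0 < x := lt_of_le_of_ne hx (Ne.symm hx0)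
        have hx1 : 1 ≤ x := by nlinarith
        have h2w : 1 ≤ 2 * w * x ^ 2 := by nlinarith
        have : 2 * (x * z) * x ^ 2 ≤ (2 * w + (x ^ 2 * z) ^ 2) * x ^ 2 := by
          nlinarith [sq_nonneg (x * (x ^ 2 * z) - 1)]
        have := le_of_mul_le_mul_right this (by positivity)
        linarith
    rw [Finset.sum_add_distrib, ← Finset.mul_sum] at h1
    have h2 : ∑ k ∈ S, wt k ≤ wtSum := summable_wt.sum_le_tsum S fun k _ => (wt_pos k).le
    have h3 : ∑ k ∈ S, |(k : ℝ)| * ‖c k‖ ≤ wtSum + R := by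
      unfold sobolev at h; linarith
    have h4 : 0 ≤ ∑ k ∈ S, |(k : ℝ)| * ‖c k‖ := Finset.sum_nonneg fun k _ => by positivity
    nlinarith [cutoff_le_one R (sobolev S 2 c), cutoff_nonneg R (sobolev S 2 c)]

/-- Extension by zero of a family of coefficients. -/
noncomputable def extendCoef (S : Finset ℤ) (c : S → ℂ) (k : ℤ) : ℂ :=
  if h : k ∈ S then c ⟨k, h⟩ else 0

theorem extendCoef_of_notMem {S : Finset ℤ} (c : S → ℂ) {k : ℤ} (h : k ∉ S) :
    extendCoef S c k = 0 := dif_neg h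

theorem extendCoef_coe {S : Finset ℤ} (c : S → ℂ) (k : S) : extendCoef S c k = c k :=
  dif_pos k.2

theorem contDiff_extendCoef (S : Finset ℤ) (k : ℤ) :
    ContDiff ℝ 1 fun c : S → ℂ => extendCoef S c k := by
  unfold extendCoef
  split_ifs with h
  · exact contDiff_apply ℝ ℂ (⟨k, h⟩ : S)
  · exact contDiff_const

theorem nl_eq_sum {a : ℝ} {S : Finset ℤ} {c : ℤ → ℂ} (hc : ∀ k ∉ S, c k = 0) (k : ℤ) :
    nl a c k = ∑ m ∈ S, (multiplier a m * c m) * (Complex.I * ((k - m : ℤ) : ℂ) * c (k - m)) :=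
  tsum_eq_sum fun m hm => by simp [hc m hm]

/-- The symbol vanishes at `0`, so the mean, which homogeneous seminorms do not see, does not enter
the velocity. -/
theorem norm_multiplier_mul_le {a : ℝ} (ha : 0 < a) (m : ℤ) (z : ℂ) :
    ‖multiplier a m * z‖ ≤ 2 * (|(m : ℝ)| ^ 2 * ‖z‖) := by
  rcases eq_or_ne m 0 with rfl | hm
  · simp [multiplier_zero]
  · have h1 : (1 : ℝ) ≤ |(m : ℝ)| := by exact_mod_cast Int.one_le_abs hm
    rw [norm_mul]
    have := norm_multiplier_le ha m
    have hz := norm_nonneg z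
    calc ‖multiplier a m‖ * ‖z‖ ≤ 2 * ‖z‖ := by gcongr
      _ ≤ 2 * (|(m : ℝ)| ^ 2 * ‖z‖) := by
        have : (1 : ℝ) ≤ |(m : ℝ)| ^ 2 := one_le_pow₀ h1
        nlinarith

/-- The Galerkin approximation, with a cutoff which makes the vector field bounded. -/
theorem exists_galerkin {a g R τ : ℝ} (ha : 0 < a) (hg : 0 < g) (hR : 0 < R) (hτ : 0 < τ)
    {S : Finset ℤ} (hS : ∀ k ∈ S, -k ∈ S) {b : ℤ → ℂ} (hb : ∀ k, conj (b (-k)) = b k) :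
    ∃ c : ℝ → ℤ → ℂ, (∀ t, ∀ k ∉ S, c t k = 0) ∧ (∀ k ∈ S, c 0 k = b k) ∧
      (∀ t ∈ Ioo (-τ) τ, ∀ k, conj (c t (-k)) = c t k) ∧
      ∀ t ∈ Ioo (-τ) τ, ∀ k ∈ S, HasDerivAt (fun t => c t k)
        (-((cutoff R (sobolev S 2 (c t)) * g : ℝ) : ℂ) * nl a (c t) k) t := by
  set X := extendCoef S with hX
  have hX0 : ∀ c, ∀ k ∉ S, X c k = 0 := fun c k hk => extendCoef_of_notMem c hk
  set V : (S → ℂ) → S → ℂ := fun c k =>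
    -((cutoff R (sobolev S 2 (X c)) * g : ℝ) : ℂ) * nl a (X c) k with hV
  have hVd : ContDiff ℝ 1 V := by
    refine contDiff_pi.2 fun k => ?_
    have h1 : ContDiff ℝ 1 fun c => sobolev S 2 (X c) := by
      unfold sobolev
      refine ContDiff.sum fun j _ => ?_
      simp only [mul_pow]
      exact contDiff_const.mul ((contDiff_extendCoef S j).norm_sq ℝ)
    have h2 : ContDiff ℝ 1 fun c => cutoff R (sobolev S 2 (X c)) :=
      Real.smoothTransition.contDiff.comp (contDiff_const.sub (h1.div_const R))
    have h3 : ContDiff ℝ 1 fun c => nl a (X c) k := by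
      simp only [fun c => nl_eq_sum (a := a) (hX0 c) (k : ℤ)]
      refine ContDiff.sum fun m _ => ?_
      exact (contDiff_const.mul (contDiff_extendCoef S m)).mul
        (contDiff_const.mul (contDiff_extendCoef S _))
    exact (Complex.ofRealCLM.contDiff.comp (h2.mul contDiff_const)).neg.mul h3
  have hVb : ∀ c, ‖V c‖ ≤ g * (S.card * (2 * (1 + 2 * R) ^ 2)) := by
    intro c
    refine (pi_norm_le_iff_of_nonneg (by positivity)).2 fun k => ?_
    simp only [hV]
    rcases le_total (2 * R) (sobolev S 2 (X c)) with h | h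
    · rw [cutoff_eq_zero hR h]; simp; positivity
    · rw [norm_mul, norm_neg, Complex.norm_real, Real.norm_eq_abs,
        abs_of_nonneg (mul_nonneg (cutoff_nonneg _ _) hg.le)]
      have h1 : ∀ j : ℤ, |(j : ℝ)| ^ 2 * ‖X c j‖ ≤ 1 + 2 * R := fun j =>
        (le_one_add_sobolev (hX0 c) 2 j).trans (by linarith)
      have h2 : ‖nl a (X c) k‖ ≤ S.card * (2 * (1 + 2 * R) ^ 2) := by
        rw [nl_eq_sum (hX0 c), ← nsmul_eq_mul]
        refine norm_sum_le_of_le _ (fun m _ => ?_) |>.trans (Finset.sum_le_card_nsmul S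
          (fun _ => 2 * (1 + 2 * R) ^ 2) _ fun _ _ => le_rfl)
        have h4 := norm_multiplier_mul_le ha m (X c m)
        rw [norm_mul (multiplier a m * X c m), norm_mul (Complex.I * _) (X c _), norm_mul Complex.I,
          Complex.norm_I, one_mul,
          Complex.norm_intCast]
        have h5 : |((↑k - m : ℤ) : ℝ)| * ‖X c (↑k - m)‖ ≤ 1 + 2 * R :=
          (mul_le_mul_of_nonneg_right (abs_intCast_le_sq _) (norm_nonneg _)).trans (h1 _)
        have h6 := h1 m
        have h7 : ‖multiplier a m * X c m‖ ≤ 2 * (1 + 2 * R) := by linarith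
        calc _ ≤ (2 * (1 + 2 * R)) * (1 + 2 * R) :=
              mul_le_mul h7 h5 (by positivity) (by positivity)
          _ = _ := by ring
      have h3 : cutoff R (sobolev S 2 (X c)) * g ≤ g := by
        nlinarith [cutoff_le_one R (sobolev S 2 (X c))]
      exact mul_le_mul h3 h2 (norm_nonneg _) hg.le
  obtain ⟨α, hα0, hα, huniq⟩ := exists_unique_integralCurve hVd hVb (fun k : S => b k) hτ
  -- The reflection maps integral curves to integral curves and fixes the initial point, so by
  -- uniqueness it fixes the curve.
  have hrefl : ∀ t ∈ Ioo (-τ) τ, ∀ k, conj (X (α t) (-k)) = X (α t) k := by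
    set ν : S → S := fun k => ⟨-k, hS k k.2⟩ with hν
    set ρ : (S → ℂ) → S → ℂ := fun c k => conj (c (ν k)) with hρ
    have hXρ : ∀ c k, X (ρ c) k = conj (X c (-k)) := by
      intro c k
      by_cases hk : k ∈ S
      · have h1 : extendCoef S (ρ c) k = conj (c (ν ⟨k, hk⟩)) := extendCoef_coe (ρ c) ⟨k, hk⟩
        have h2 : extendCoef S c (-k) = c (ν ⟨k, hk⟩) := extendCoef_coe c (ν ⟨k, hk⟩)
        rw [hX, h1, h2]
      · have hk' : -k ∉ S := fun h => hk (by simpa using hS _ h)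
        rw [hX0 _ _ hk, hX0 _ _ hk', map_zero]
    have hsob : ∀ c, sobolev S 2 (X (ρ c)) = sobolev S 2 (X c) := by
      intro c
      unfold sobolev
      refine Finset.sum_bij (fun k _ => -k) (fun k hk => hS k hk) (fun _ _ _ _ h => neg_inj.1 h)
        (fun k hk => ⟨-k, hS k hk, neg_neg k⟩) fun k _ => ?_
      rw [hXρ, Complex.norm_conj, Int.cast_neg, abs_neg]
    have hVρ : ∀ c, V (ρ c) = ρ (V c) := by
      intro c
      ext k
      simp only [hV, hsob]
      rw [show X (ρ c) = fun m => conj (X c (-m)) from funext (hXρ c), ← conj_nl_neg]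
      simp only [hρ, hν]
      rw [map_mul, map_neg, Complex.conj_ofReal]
    have hβ := huniq (fun t => ρ (α t)) (by
        ext k
        simp only [hρ, hν, hα0]
        exact hb k) (fun t ht => by
        rw [hVρ]
        refine hasDerivAt_pi.2 fun k => ?_
        exact (hasDerivAt_pi.1 (hα t ht) (ν k)).star)
    intro t ht k
    rw [← hXρ]
    exact congrFun (congrArg X (hβ ht)) k
  refine ⟨fun t => X (α t), fun t => hX0 _, fun k hk => ?_, hrefl, fun t ht k hk => ?_⟩
  · simp only [hα0]
    exact extendCoef_coe (fun k : S => b k) ⟨k, hk⟩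
  · have h1 := hasDerivAt_pi.1 (hα t ht) ⟨k, hk⟩
    refine h1.congr_of_eventuallyEq (Eventually.of_forall fun t => ?_)
    exact extendCoef_coe (α t) ⟨k, hk⟩

/-- The growth rate of the Sobolev norms of the truncated system. -/
noncomputable def rate (g R : ℝ) (s : ℕ) : ℝ :=
  2 * g * (3 * ((2 * s + 1 : ℕ) * 2 ^ s)) * (wtSum + R)

/-- Grönwall. The energy estimate bounds the derivative by the norm itself times `∑ |k| ‖c k‖`, and
the cutoff bounds that sum. The rate depends neither on the truncation `S` nor on the data. -/
theorem sobolev_le_of_galerkin {a g R τ : ℝ} (ha : 0 < a) (hg : 0 < g) (hR : 0 < R)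
    {S : Finset ℤ} {c : ℝ → ℤ → ℂ} (hc : ∀ t, ∀ k ∉ S, c t k = 0)
    (hconj : ∀ t ∈ Ioo (-τ) τ, ∀ k, conj (c t (-k)) = c t k)
    (hder : ∀ t ∈ Ioo (-τ) τ, ∀ k ∈ S, HasDerivAt (fun t => c t k)
        (-((cutoff R (sobolev S 2 (c t)) * g : ℝ) : ℂ) * nl a (c t) k) t) (s : ℕ)
    {t : ℝ} (ht : t ∈ Ioo (-τ) τ) :
    sobolev S s (c t) ≤ sobolev S s (c 0) * Real.exp (rate g R s * |t|) := by
  set G : ℝ → ℂ := fun t => ∑ k ∈ S, (k : ℂ) ^ (2 * s) * conj (c t k) * nl a (c t) k with hG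
  refine le_mul_exp_of_abs_deriv_le (f := fun t => sobolev S s (c t)) (τ := τ)
    (f' := fun t => -2 * (cutoff R (sobolev S 2 (c t)) * g) * (G t).re) (fun t ht => ?_)
    (fun t ht => ?_) ht
  · have h1 : ∀ k ∈ S, HasDerivAt (fun t => (|(k : ℝ)| ^ s * ‖c t k‖) ^ 2)
        (-2 * (cutoff R (sobolev S 2 (c t)) * g) *
          ((k : ℂ) ^ (2 * s) * conj (c t k) * nl a (c t) k).re) t := by
      intro k hk
      have h2 := ((hder t ht k hk).norm_sq).const_mul ((|(k : ℝ)| ^ s) ^ 2)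
      simp only [mul_pow]
      refine h2.congr_deriv ?_
      have h3 : (|(k : ℝ)| ^ s) ^ 2 = (k : ℝ) ^ (2 * s) := by
        rw [← pow_mul, mul_comm s 2, Even.pow_abs ⟨s, by ring⟩]
      have h5 : ((k : ℂ) ^ (2 * s) * conj (c t k) * nl a (c t) k).re =
          (k : ℝ) ^ (2 * s) * (conj (c t k) * nl a (c t) k).re := by
        rw [mul_assoc, ← Complex.re_ofReal_mul]; push_cast; rfl
      have h6 : inner ℝ (c t k) (-((cutoff R (sobolev S 2 (c t)) * g : ℝ) : ℂ) * nl a (c t) k) =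
          -(cutoff R (sobolev S 2 (c t)) * g) * (conj (c t k) * nl a (c t) k).re := by
        rw [Complex.inner, mul_assoc, ← Complex.ofReal_neg, Complex.re_ofReal_mul,
            mul_comm (nl _ _ _)]
      rw [h3, h5, h6]
      ring
    have h4 := HasDerivAt.fun_sum h1
    rw [← Finset.mul_sum, ← Complex.re_sum] at h4
    exact h4
  · have h1 := norm_energy_le ha (hc t) (hconj t ht) s
    have h2 := cutoff_mul_sum_le hR S (c t)
    have h3 := (Complex.abs_re_le_norm (G t)).trans h1
    have hχ := cutoff_nonneg R (sobolev S 2 (c t))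
    have hY := sobolev_nonneg S s (c t)
    rw [abs_mul, abs_mul, abs_of_nonneg (mul_nonneg hχ hg.le), abs_neg, abs_two]
    calc 2 * (cutoff R (sobolev S 2 (c t)) * g) * |(G t).re|
        ≤ 2 * (cutoff R (sobolev S 2 (c t)) * g) * ((3 * ((2 * s + 1 : ℕ) * 2 ^ s) : ℝ) *
          (∑ k ∈ S, |(k : ℝ)| * ‖c t k‖) * sobolev S s (c t)) :=
          mul_le_mul_of_nonneg_left h3 (by positivity)
      _ = 2 * g * (3 * ((2 * s + 1 : ℕ) * 2 ^ s)) *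
          (cutoff R (sobolev S 2 (c t)) * ∑ k ∈ S, |(k : ℝ)| * ‖c t k‖) * sobolev S s (c t) := by
          ring
      _ ≤ 2 * g * (3 * ((2 * s + 1 : ℕ) * 2 ^ s)) * (wtSum + R) * sobolev S s (c t) := by
          gcongr
      _ = _ := by rw [rate]

/-- The `H²` quantity at most doubles on an interval with `rate · τ ≤ log 2`, hence stays below `R`.
There the cutoff equals `1` and the truncated equation holds without it. -/
theorem exists_galerkin_bounded {a g R τ : ℝ} (ha : 0 < a) (hg : 0 < g) (hR : 0 < R) (hτ : 0 < τ)
    (hτR : rate g R 2 * τ ≤ Real.log 2)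
    {S : Finset ℤ} (hS : ∀ k ∈ S, -k ∈ S) {b : ℤ → ℂ} (hb : ∀ k, conj (b (-k)) = b k)
    (hbR : 2 * sobolev S 2 b ≤ R) :
    ∃ c : ℝ → ℤ → ℂ, (∀ t, ∀ k ∉ S, c t k = 0) ∧ (∀ k ∈ S, c 0 k = b k) ∧
      (∀ t ∈ Ioo (-τ) τ, ∀ k, conj (c t (-k)) = c t k) ∧
      (∀ t ∈ Ioo (-τ) τ, ∀ k ∈ S, HasDerivAt (fun t => c t k) (-(g : ℂ) * nl a (c t) k) t) ∧
      ∀ t ∈ Ioo (-τ) τ, ∀ s, sobolev S s (c t) ≤ sobolev S s b * Real.exp (rate g R s * τ) := by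
  obtain ⟨c, h1, h2, h3, h4⟩ := exists_galerkin ha hg hR hτ hS hb
  have hw0 : 0 ≤ wtSum := tsum_nonneg fun k => (wt_pos k).le
  have h5 : ∀ t ∈ Ioo (-τ) τ, ∀ s, sobolev S s (c t) ≤
      sobolev S s b * Real.exp (rate g R s * τ) := by
    intro t ht s
    have h6 := sobolev_le_of_galerkin ha hg hR h1 h3 h4 s ht
    have h7 : sobolev S s (c 0) = sobolev S s b :=
      Finset.sum_congr rfl fun k hk => by rw [h2 k hk]
    rw [h7] at h6
    refine h6.trans (mul_le_mul_of_nonneg_left (Real.exp_le_exp.2 ?_) (sobolev_nonneg _ _ _))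
    refine mul_le_mul_of_nonneg_left (abs_lt.2 ht).le ?_
    unfold rate; positivity
  refine ⟨c, h1, h2, h3, fun t ht k hk => ?_, h5⟩
  have h6 : sobolev S 2 (c t) ≤ R := by
    refine (h5 t ht 2).trans (le_trans ?_ hbR)
    rw [mul_comm]
    refine mul_le_mul_of_nonneg_right ?_ (sobolev_nonneg _ _ _)
    rw [← Real.exp_log (two_pos : (0 : ℝ) < 2)]
    exact Real.exp_le_exp.2 hτR
  have h7 := h4 t ht k hk
  rw [cutoff_eq_one hR h6, one_mul] at h7
  exact h7

/-! ### Passage to the limit and local existence -/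

theorem wtSum_nonneg : 0 ≤ wtSum := tsum_nonneg fun k => (wt_pos k).le

theorem Decay.nl {a : ℝ} (ha : 0 < a) {B : ℕ → ℝ} {c : ℤ → ℂ} (hc : Decay B c) :
    Decay (fun s => 2 ^ s * (((2 * B s + 2 * B (s + 2)) * wtSum) * B (0 + 1)
      + ((2 * B 0 + 2 * B 2) * wtSum) * B (s + 1))) (nl a c) :=
  (hc.mul_left (norm_multiplier_le ha)).conv hc.deriv

/-- On rapidly decaying sequences each component of the nonlinearity is Lipschitz in the sup norm.
The constant may grow with `k`, because the derivative can fall on the difference, where `|k - m| ≤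
|k| + |m|`. -/
theorem norm_nl_sub_le {a : ℝ} (ha : 0 < a) {D : ℕ → ℝ} {c d : ℤ → ℂ} (hc : Decay D c)
    (hd : Decay D d) {ε : ℝ} (hε : ∀ k, ‖c k - d k‖ ≤ ε) (k : ℤ) :
    ‖nl a c k - nl a d k‖ ≤ (2 * ((D 1 + D (1 + 2)) * wtSum) +
      2 * ((|(k : ℝ)| * (D 0 + D 2) + (D 1 + D (1 + 2))) * wtSum)) * ε := by
  have hs1 := (hc.mul_left (norm_multiplier_le ha)).summable_conv hc.deriv k
  have hs2 := (hd.mul_left (norm_multiplier_le ha)).summable_conv hd.deriv k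
  rw [IPM1D.nl, IPM1D.nl, IPM1D.conv, IPM1D.conv, ← hs1.tsum_sub hs2]
  have hw := summable_wt.hasSum
  have hw' : HasSum (fun m => wt (k - m)) wtSum := (Equiv.subLeft k).hasSum_iff.2 hw
  have hsum : HasSum (fun m => (2 * ((D 1 + D (1 + 2)) * wt (k - m)) +
      2 * ((|(k : ℝ)| * (D 0 + D 2) + (D 1 + D (1 + 2))) * wt m)) * ε) _ :=
    (((hw'.mul_left _).mul_left 2).add ((hw.mul_left _).mul_left 2)).mul_right ε
  refine tsum_of_norm_bounded hsum fun m => ?_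
  have e : multiplier a m * c m * (Complex.I * ((k - m : ℤ) : ℂ) * c (k - m)) -
      multiplier a m * d m * (Complex.I * ((k - m : ℤ) : ℂ) * d (k - m)) =
      multiplier a m * ((c m - d m) * (Complex.I * ((k - m : ℤ) : ℂ) * c (k - m))
        + d m * (Complex.I * ((k - m : ℤ) : ℂ)) * (c (k - m) - d (k - m))) := by ring
  rw [e, norm_mul]
  have hn : ‖Complex.I * ((k - m : ℤ) : ℂ)‖ = |((k - m : ℤ) : ℝ)| := by
    rw [norm_mul, Complex.norm_I, one_mul, Complex.norm_intCast]
  have h1 : |((k - m : ℤ) : ℝ)| * ‖c (k - m)‖ ≤ (D 1 + D (1 + 2)) * wt (k - m) := by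
    simpa using hc.le_wt 1 (k - m)
  have h2 : ‖d m‖ * |((k - m : ℤ) : ℝ)| ≤ (|(k : ℝ)| * (D 0 + D 2) + (D 1 + D (1 + 2))) * wt m := by
    have h3 := hd.norm_le_wt m
    have h4 : |(m : ℝ)| * ‖d m‖ ≤ (D 1 + D (1 + 2)) * wt m := by simpa using hd.le_wt 1 m
    have h5 : |((k - m : ℤ) : ℝ)| ≤ |(k : ℝ)| + |(m : ℝ)| := by
      push_cast; exact abs_sub _ _
    have h6 := mul_le_mul_of_nonneg_left h5 (norm_nonneg (d m))
    have h7 := mul_le_mul_of_nonneg_left h3 (abs_nonneg (k : ℝ))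
    nlinarith
  have hε0 : 0 ≤ ε := (norm_nonneg _).trans (hε 0)
  have h8 : ‖(c m - d m) * (Complex.I * ((k - m : ℤ) : ℂ) * c (k - m))
        + d m * (Complex.I * ((k - m : ℤ) : ℂ)) * (c (k - m) - d (k - m))‖ ≤
      ε * ((D 1 + D (1 + 2)) * wt (k - m)) +
        ((|(k : ℝ)| * (D 0 + D 2) + (D 1 + D (1 + 2))) * wt m) * ε := by
    refine (norm_add_le _ _).trans (add_le_add ?_ ?_)
    · rw [norm_mul, norm_mul _ (c (k - m)), hn]
      exact mul_le_mul (hε m) h1 (by positivity) hε0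
    · rw [norm_mul, norm_mul (d m), hn]
      exact mul_le_mul h2 (hε _) (norm_nonneg _) ((by positivity : (0:ℝ) ≤ _).trans h2)
  calc _ ≤ 2 * (ε * ((D 1 + D (1 + 2)) * wt (k - m)) +
        ((|(k : ℝ)| * (D 0 + D 2) + (D 1 + D (1 + 2))) * wt m) * ε) :=
        mul_le_mul (norm_multiplier_le ha m) h8 (norm_nonneg _) (by norm_num)
    _ = _ := by ring

theorem sobolev_le_of_decay {B : ℕ → ℝ} {b : ℤ → ℂ} (hb : Decay B b) (S : Finset ℤ) (s : ℕ) :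
    sobolev S s b ≤ B s * ((B s + B (s + 2)) * wtSum) := by
  have h1 : ∑ k ∈ S, wt k ≤ wtSum := summable_wt.sum_le_tsum S fun k _ => (wt_pos k).le
  calc sobolev S s b ≤ ∑ k ∈ S, B s * ((B s + B (s + 2)) * wt k) := by
        refine Finset.sum_le_sum fun k _ => ?_
        rw [sq]
        exact mul_le_mul (hb s k) (hb.le_wt s k) (by positivity) (hb.nonneg s)
    _ = B s * ((B s + B (s + 2)) * ∑ k ∈ S, wt k) := by
        rw [← Finset.mul_sum, ← Finset.mul_sum]
    _ ≤ _ := by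
        have := hb.nonneg s
        have := hb.nonneg (s + 2)
        gcongr

/-- The solution of the equation for the Fourier coefficients. -/
theorem exists_coef_solution {a g R τ : ℝ} (ha : 0 < a) (hg : 0 < g) (hR : 0 < R) (hτ : 0 < τ)
    (hτR : rate g R 2 * τ ≤ Real.log 2) {B : ℕ → ℝ} {b : ℤ → ℂ} (hB : Decay B b)
    (hb : ∀ k, conj (b (-k)) = b k) (hbR : ∀ S, 2 * sobolev S 2 b ≤ R) :
    ∃ (c : ℝ → ℤ → ℂ) (D : ℕ → ℝ), (∀ t ∈ Ioo (-τ) τ, Decay D (c t)) ∧ (∀ k, c 0 k = b k) ∧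
      (∀ t ∈ Ioo (-τ) τ, ∀ k, conj (c t (-k)) = c t k) ∧
      ∀ t ∈ Ioo (-τ) τ, ∀ k, HasDerivAt (fun t => c t k) (-(g : ℂ) * nl a (c t) k) t := by
  set S : ℕ → Finset ℤ := fun N => Finset.Icc (-(N : ℤ)) N with hSdef
  have hS : ∀ N, ∀ k ∈ S N, -k ∈ S N := fun N k hk => by
    simp only [hSdef, Finset.mem_Icc] at hk ⊢; omega
  choose C hC0 hCb hCc hCd hCs using fun N =>
    exists_galerkin_bounded ha hg hR hτ hτR (hS N) hb (hbR (S N))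
  set J := Ioo (-τ) τ with hJ
  set D : ℕ → ℝ := fun s => 1 + B s * ((B s + B (s + 2)) * wtSum) * Real.exp (rate g R s * τ)
    with hD
  have hCD : ∀ N, ∀ t ∈ J, Decay D (C N t) := by
    intro N t ht s k
    refine (le_one_add_sobolev (hC0 N t) s k).trans ?_
    refine add_le_add le_rfl ((hCs N t ht s).trans ?_)
    exact mul_le_mul_of_nonneg_right (sobolev_le_of_decay hB _ s) (Real.exp_pos _).le
  obtain ⟨P, hP⟩ : ∃ P : ℝ, ∀ N, ∀ t ∈ J, ∀ k, ‖-(g : ℂ) * nl a (C N t) k‖ ≤ P := by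
    obtain ⟨D', hD'⟩ : ∃ D', ∀ N, ∀ t ∈ J, Decay D' (nl a (C N t)) :=
      ⟨_, fun N t ht => (hCD N t ht).nl ha⟩
    refine ⟨g * D' 0, fun N t ht k => ?_⟩
    rw [norm_mul, norm_neg, Complex.norm_real, Real.norm_eq_abs, abs_of_pos hg]
    have := hD' N t ht 0 k
    rw [pow_zero, one_mul] at this
    exact mul_le_mul_of_nonneg_left this hg.le
  have hlip : ∀ N, ∀ t ∈ J, ∀ s ∈ J, ∀ k, ‖C N t k - C N s k‖ ≤ P * |t - s| := by
    intro N t ht s hs k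
    by_cases hk : k ∈ S N
    · exact Convex.norm_image_sub_le_of_norm_hasDerivWithin_le (f := fun t => C N t k)
        (f' := fun t => -(g : ℂ) * nl a (C N t) k)
        (fun x hx => (hCd N x hx k hk).hasDerivWithinAt) (fun x hx => hP N x hx k)
        (convex_Ioo _ _) hs ht
    · rw [hC0 N t k hk, hC0 N s k hk, sub_zero, norm_zero]
      exact mul_nonneg ((norm_nonneg _).trans (hP N t ht k)) (abs_nonneg _)
  obtain ⟨Λ, hΛ⟩ : ∃ Λ : ℤ → ℝ, ∀ N, ∀ t ∈ J, ∀ s ∈ J, ∀ k,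
      ‖-(g : ℂ) * nl a (C N t) k - -(g : ℂ) * nl a (C N s) k‖ ≤ Λ k * |t - s| := by
    refine ⟨fun k => g * ((2 * ((D 1 + D (1 + 2)) * wtSum) +
      2 * ((|(k : ℝ)| * (D 0 + D 2) + (D 1 + D (1 + 2))) * wtSum)) * P), fun N t ht s hs k => ?_⟩
    rw [← mul_sub, norm_mul, norm_neg, Complex.norm_real, Real.norm_eq_abs, abs_of_pos hg]
    have := norm_nl_sub_le ha (hCD N t ht) (hCD N s hs) (hlip N t ht s hs) k
    rw [mul_assoc g, mul_assoc _ P]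
    exact mul_le_mul_of_nonneg_left this hg.le
  -- A quadratic Taylor remainder with a constant independent of `N`. It survives pointwise limits
  -- and yields differentiability of the limit, with no uniform convergence of derivatives.
  have htaylor : ∀ N, ∀ k ∈ S N, ∀ t ∈ J, ∀ s ∈ J,
      ‖C N t k - C N s k - ((t - s : ℝ) : ℂ) * (-(g : ℂ) * nl a (C N s) k)‖ ≤
        Λ k * |t - s| * |t - s| := by
    intro N k hk t ht s hs
    have hsub : uIcc s t ⊆ J := (convex_Ioo (-τ) τ).ordConnected.uIcc_subset hs ht
    set w := -(g : ℂ) * nl a (C N s) k with hw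
    have := Convex.norm_image_sub_le_of_norm_hasDerivWithin_le (s := uIcc s t)
      (f := fun r => C N r k - ((r - s : ℝ) : ℂ) * w)
      (f' := fun r => -(g : ℂ) * nl a (C N r) k - w) (C := Λ k * |t - s|) (x := s) (y := t)
      (fun x hx => ?_) (fun x hx => ?_) (convex_uIcc s t) left_mem_uIcc right_mem_uIcc
    · simp only [sub_self, Complex.ofReal_zero, zero_mul, sub_zero] at this
      rw [Real.norm_eq_abs] at this
      rwa [sub_right_comm]
    · refine ((hCd N x (hsub hx) k hk).sub ?_).hasDerivWithinAt
      have h1 : HasDerivAt (fun r : ℝ => ((r - s : ℝ) : ℂ)) ((1 : ℝ) : ℂ) x :=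
        ((hasDerivAt_id x).sub_const s).ofReal_comp
      simpa using h1.mul_const w
    · refine (hΛ N x (hsub hx) s hs k).trans ?_
      have hΛ0 : 0 ≤ Λ k * |t - s| := (norm_nonneg _).trans (hΛ N t ht s hs k)
      have h2 : |x - s| ≤ |t - s| := by
        have := abs_sub_left_of_mem_uIcc hx
        exact this
      rcases eq_or_ne t s with rfl | hne
      · simp only [sub_self, abs_zero] at h2 ⊢
        have : |x - t| = 0 := le_antisymm h2 (abs_nonneg _)
        rw [this]
      · have hΛ1 : 0 ≤ Λ k := by
          have : 0 < |t - s| := abs_pos.2 (sub_ne_zero.2 hne)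
          exact nonneg_of_mul_nonneg_left hΛ0 this
        exact mul_le_mul_of_nonneg_left h2 hΛ1
  -- Along an ultrafilter every bounded sequence converges, so all times and frequencies are handled
  -- at once without extracting subsequences.
  let U : Ultrafilter ℕ := Ultrafilter.of atTop
  have hU : (U : Filter ℕ) ≤ atTop := Ultrafilter.of_le atTop
  have hlim : ∀ t k, ∃ z, t ∈ J → Tendsto (fun N => C N t k) U (𝓝 z) := by
    intro t k
    by_cases ht : t ∈ J
    · have hmem : ∀ N, C N t k ∈ Metric.closedBall (0 : ℂ) (D 0) := fun N => by
        rw [mem_closedBall_zero_iff]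
        simpa using hCD N t ht 0 k
      obtain ⟨z, _, hz⟩ := (isCompact_closedBall (0 : ℂ) (D 0)).ultrafilter_le_nhds
        (U.map fun N => C N t k) (by
          rw [le_principal_iff]
          exact Filter.mem_map.2 (Eventually.of_forall hmem))
      exact ⟨z, fun _ => hz⟩
    · exact ⟨0, fun h => absurd h ht⟩
  choose c hc using hlim
  have hmemS : ∀ k : ℤ, ∀ᶠ N in (U : Filter ℕ), k ∈ S N := by
    intro k
    refine hU ?_
    filter_upwards [eventually_ge_atTop k.natAbs] with N hN
    simp only [hSdef, Finset.mem_Icc]; omega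
  have h0J : (0 : ℝ) ∈ J := ⟨by linarith, hτ⟩
  have hcD : ∀ t ∈ J, Decay D (c t) := by
    intro t ht s k
    refine le_of_tendsto ((hc t k ht).norm.const_mul _) ?_
    exact Eventually.of_forall fun N => hCD N t ht s k
  have hnl : ∀ t ∈ J, ∀ k, Tendsto (fun N => -(g : ℂ) * nl a (C N t) k) U
      (𝓝 (-(g : ℂ) * nl a (c t) k)) := by
    intro t ht k
    refine Tendsto.const_mul _ ?_
    refine tendsto_tsum_of_dominated_convergence
      (bound := fun m => (2 * D 0 + 2 * D 2) * wt m * D (0 + 1))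
      ((summable_wt.mul_left _).mul_right _) (fun m => ?_) (Eventually.of_forall fun N m => ?_)
    · exact ((hc t m ht).const_mul _).mul ((hc t (k - m) ht).const_mul _)
    · exact ((hCD N t ht).mul_left (norm_multiplier_le ha)).norm_conv_term_le (hCD N t ht).deriv k m
  refine ⟨c, D, hcD, fun k => ?_, fun t ht k => ?_, fun s hs k => ?_⟩
  · refine tendsto_nhds_unique (hc 0 k h0J) (tendsto_const_nhds.congr' ?_)
    filter_upwards [hmemS k] with N hN
    exact (hCb N k hN).symm
  · refine tendsto_nhds_unique ?_ (hc t k ht)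
    have := (Complex.continuous_conj.tendsto _).comp (hc t (-k) ht)
    exact this.congr fun N => hCc N t ht k
  · rw [hasDerivAt_iff_isLittleO]
    have hO : (fun t => c t k - c s k - (t - s) • (-(g : ℂ) * nl a (c s) k)) =O[𝓝 s]
        fun t => (t - s) ^ 2 := by
      refine Asymptotics.IsBigO.of_bound (Λ k) ?_
      filter_upwards [isOpen_Ioo.mem_nhds hs] with t ht
      refine le_of_tendsto (((hc t k ht).sub (hc s k hs)).sub
          ((hnl s hs k).const_smul (t - s))).norm
        ?_
      filter_upwards [hmemS k] with N hN
      have := htaylor N k hN t ht s hs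
      rw [Complex.real_smul, Real.norm_eq_abs, abs_pow, sq, ← mul_assoc (Λ k)]
      exact this
    refine hO.trans_isLittleO ?_
    simpa using Asymptotics.isLittleO_pow_sub_sub s (m := 2) (by norm_num)

theorem hasSum_re_of_conj {B : ℕ → ℝ} {c : ℤ → ℂ} (hc : Decay B c)
    (hconj : ∀ k, conj (c (-k)) = c k) (x : ℝ) :
    HasSum (fun k => c k * mode k x) ((∑' k, c k * mode k x).re : ℂ) := by
  have h := (hc.summable_mode x).hasSum
  have h1 : conj (∑' k, c k * mode k x) = ∑' k, c k * mode k x := by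
    rw [Complex.conj_tsum, ← (Equiv.neg ℤ).tsum_eq]
    refine tsum_congr fun k => ?_
    rw [Equiv.neg_apply, map_mul, hconj, conj_mode, neg_neg]
  rw [Complex.conj_eq_iff_re.1 h1]
  exact h

theorem sobolev_coef_le {f : ℝ → ℝ} (hf : SmoothPeriodic f) (S : Finset ℤ) :
    sobolev S 2 (coef f) ≤
      (2 * Real.pi)⁻¹ * ∫ x in (0 : ℝ)..2 * Real.pi, deriv (deriv f) x ^ 2 := by
  have h := hasSum_sq_coef hf.deriv.deriv.continuous
  refine le_trans (le_of_eq ?_) (sum_le_hasSum S (fun k _ => sq_nonneg _) h)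
  refine Finset.sum_congr rfl fun k _ => ?_
  rw [coef_deriv hf.deriv.contDiff_one hf.deriv.2, coef_deriv hf.contDiff_one hf.2, norm_mul,
    norm_mul, norm_mul, norm_mul, Complex.norm_I, one_mul, Complex.norm_intCast, ← mul_assoc, ← sq]

/-- Local existence of smooth solutions, on a time interval which depends only on a bound of the
second derivative of the data in `L²`. -/
theorem exists_local_solution {a g R : ℝ} (ha : 0 < a) (hg : 0 < g) (hR : 0 < R) :
    ∃ τ > 0, ∀ f, SmoothPeriodic f →
      ∫ x in (0 : ℝ)..2 * Real.pi, deriv (deriv f) x ^ 2 ≤ R →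
      ∃ ρ : ℝ → ℝ → ℝ, ContDiffOn ℝ ∞ (fun p : ℝ × ℝ => ρ p.1 p.2) (univ ×ˢ Ioo (-τ) τ) ∧
        (∀ t ∈ Ioo (-τ) τ, SmoothPeriodic fun x => ρ x t) ∧ (∀ x, ρ x 0 = f x) ∧
        ∀ t ∈ Ioo (-τ) τ, ∀ x, HasDerivAt (fun s => ρ x s)
          (-((g * Ha a (fun y => ρ y t) x) * deriv (fun y => ρ y t) x)) t := by
  have hpi := Real.pi_pos
  -- The factor `(2π)⁻¹` comes from Parseval; the factor `2` leaves room for the doubling of the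
  -- norm.
  set R' := 2 * ((2 * Real.pi)⁻¹ * R) with hR'
  have hR'0 : 0 < R' := by positivity
  have hrate : 0 < rate g R' 2 := by
    have := wtSum_nonneg
    unfold rate; positivity
  have hτ : 0 < Real.log 2 / rate g R' 2 := div_pos (Real.log_pos one_lt_two) hrate
  refine ⟨Real.log 2 / rate g R' 2, hτ, fun f hf hfR => ?_⟩
  generalize hτdef : Real.log 2 / rate g R' 2 = τ at *
  obtain ⟨B, hB⟩ := hf.exists_decay
  obtain ⟨c, D, hD, hc0, hconj, hder⟩ := exists_coef_solution ha hg hR'0 hτ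
    (by rw [← hτdef, mul_div_cancel₀ _ hrate.ne']) hB
    (fun k => by rw [coef_conj, neg_neg]) (fun S => by
      have h1 := sobolev_coef_le hf S
      have h2 : (2 * Real.pi)⁻¹ * ∫ x in (0 : ℝ)..2 * Real.pi, deriv (deriv f) x ^ 2 ≤
        (2 * Real.pi)⁻¹ * R := mul_le_mul_of_nonneg_left hfR (by positivity)
      linarith)
  set J := Ioo (-τ) τ with hJ
  have hJo : IsOpen J := isOpen_Ioo
  have hJp : IsPreconnected J := isPreconnected_Ioo
  -- Bootstrap in time: the time derivative is `-g` times the nonlinearity, a convolution of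
  -- sequences that are already good to order `n`.
  have hgood : ∀ n, Good J n fun k t => c t k := by
    intro n
    induction n with
    | zero =>
      exact ⟨⟨D, hD⟩, fun k t ht => (hder t ht k).continuousAt.continuousWithinAt⟩
    | succ n ih =>
      have h1 := ((ih.mul_left (norm_multiplier_le ha)).conv hJo hJp ih.deriv).mul_left
        (m := fun _ => -(g : ℂ)) (fun _ => le_rfl)
      exact ⟨⟨D, hD⟩, _, h1, fun k t ht => hder t ht k⟩
  have hreal : ∀ t ∈ J, ∀ x, HasSum (fun k => c t k * mode k x)
      (((∑' k, c t k * mode k x).re : ℝ) : ℂ) :=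
    fun t ht x => hasSum_re_of_conj (hD t ht) (hconj t ht) x
  refine ⟨fun x t => (∑' k, c t k * mode k x).re, ?_, fun t ht => ?_, fun x => ?_, fun t ht x => ?_⟩
  · exact Complex.reCLM.contDiff.comp_contDiffOn
      (contDiffOn_infty.2 fun n => (hgood n).contDiffOn hJo hJp)
  · exact smoothPeriodic_of_hasSum (hD t ht) (hreal t ht)
  · simp only [hc0]
    rw [(hf.hasSum_coef x).tsum_eq, Complex.ofReal_re]
  · have hnlD := ((hD t ht).mul_left (norm_multiplier_le ha)).conv (hD t ht).deriv
    obtain ⟨D', hD'⟩ : ∃ D', ∀ t ∈ J, Decay D' fun k => -(g : ℂ) * nl a (c t) k :=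
      ⟨_, fun t ht => ((hD t ht).nl ha).mul_left (m := fun _ => -(g : ℂ)) fun _ => le_rfl⟩
    have h1 := hasDerivAt_tsum_time hJo hJp (c := fun k t => c t k)
      (d := fun k t => -(g : ℂ) * nl a (c t) k) hD hD' (fun k t ht => hder t ht k) x ht
    have h2 := hasSum_conv ((hD t ht).mul_left (norm_multiplier_le ha)) (hD t ht).deriv x
    have h3 := hasSum_Ha ha (hD t ht) (hreal t ht) x
    have h4 := hasSum_deriv_of_hasSum (hD t ht) (hreal t ht) x
    rw [h3.tsum_eq, h4.tsum_eq] at h2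
    have h5 := (h2.mul_left (-(g : ℂ))).tsum_eq
    simp only [← mul_assoc] at h5
    have h6 : ∑' k, -(g : ℂ) * nl a (c t) k * mode k x = _ := h5
    rw [h6] at h1
    have h7 := Complex.reCLM.hasFDerivAt.comp_hasDerivAt t h1
    refine h7.congr_deriv ?_
    simp only [Complex.reCLM_apply]
    rw [← Complex.ofReal_neg, ← Complex.ofReal_mul, ← Complex.ofReal_mul, Complex.ofReal_re]
    ring

/-! ### Partial derivatives and energies of transport equations -/

/-- The partial derivative in the first variable. -/
noncomputable def dx (F : ℝ → ℝ → ℝ) (x t : ℝ) : ℝ := deriv (fun y => F y t) x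

/-- The partial derivative in the second variable. -/
noncomputable def dt (F : ℝ → ℝ → ℝ) (x t : ℝ) : ℝ := deriv (fun s => F x s) t

/-- Joint smoothness on `ℝ × J`. -/
def Smooth2 (J : Set ℝ) (F : ℝ → ℝ → ℝ) : Prop :=
  ContDiffOn ℝ ∞ (fun p : ℝ × ℝ => F p.1 p.2) (univ ×ˢ J)

section Calculus

variable {J : Set ℝ} {F : ℝ → ℝ → ℝ}

theorem Smooth2.contDiffAt (hJ : IsOpen J) (hF : Smooth2 J F) {x t : ℝ} (ht : t ∈ J) :
    ContDiffAt ℝ ∞ (fun p : ℝ × ℝ => F p.1 p.2) (x, t) :=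
  ContDiffOn.contDiffAt hF ((isOpen_univ.prod hJ).mem_nhds ⟨mem_univ _, ht⟩)

theorem Smooth2.hasFDerivAt (hJ : IsOpen J) (hF : Smooth2 J F) {x t : ℝ} (ht : t ∈ J) :
    HasFDerivAt (fun p : ℝ × ℝ => F p.1 p.2)
      (fderiv ℝ (fun p : ℝ × ℝ => F p.1 p.2) (x, t)) (x, t) :=
  ((hF.contDiffAt hJ ht).differentiableAt (by simp)).hasFDerivAt

theorem hasDerivAt_partial_fst {G : ℝ × ℝ → ℝ} {L : ℝ × ℝ →L[ℝ] ℝ} {x t : ℝ}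
    (h : HasFDerivAt G L (x, t)) : HasDerivAt (fun y => G (y, t)) (L (1, 0)) x :=
  HasFDerivAt.comp_hasDerivAt (f := fun y : ℝ => (y, t)) x h
    ((hasDerivAt_id x).prodMk (hasDerivAt_const x t))

theorem hasDerivAt_partial_snd {G : ℝ × ℝ → ℝ} {L : ℝ × ℝ →L[ℝ] ℝ} {x t : ℝ}
    (h : HasFDerivAt G L (x, t)) : HasDerivAt (fun s => G (x, s)) (L (0, 1)) t :=
  HasFDerivAt.comp_hasDerivAt (f := fun s : ℝ => (x, s)) t h
    ((hasDerivAt_const t x).prodMk (hasDerivAt_id t))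

theorem Smooth2.dx_eq (hJ : IsOpen J) (hF : Smooth2 J F) {x t : ℝ} (ht : t ∈ J) :
    dx F x t = fderiv ℝ (fun p : ℝ × ℝ => F p.1 p.2) (x, t) (1, 0) :=
  (hasDerivAt_partial_fst (hF.hasFDerivAt hJ ht)).deriv

theorem Smooth2.dt_eq (hJ : IsOpen J) (hF : Smooth2 J F) {x t : ℝ} (ht : t ∈ J) :
    dt F x t = fderiv ℝ (fun p : ℝ × ℝ => F p.1 p.2) (x, t) (0, 1) :=
  (hasDerivAt_partial_snd (hF.hasFDerivAt hJ ht)).deriv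

theorem Smooth2.hasDerivAt_dt (hJ : IsOpen J) (hF : Smooth2 J F) {x t : ℝ} (ht : t ∈ J) :
    HasDerivAt (fun s => F x s) (dt F x t) t := by
  rw [hF.dt_eq hJ ht]; exact hasDerivAt_partial_snd (hF.hasFDerivAt hJ ht)

theorem Smooth2.contDiffOn_fderiv_apply (hJ : IsOpen J) (hF : Smooth2 J F) (v : ℝ × ℝ) :
    ContDiffOn ℝ ∞ (fun p => fderiv ℝ (fun p : ℝ × ℝ => F p.1 p.2) p v) (univ ×ˢ J) :=
  (ContDiffOn.fderiv_of_isOpen hF (isOpen_univ.prod hJ) (by simp)).clm_apply contDiffOn_const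

theorem Smooth2.dx (hJ : IsOpen J) (hF : Smooth2 J F) : Smooth2 J (dx F) :=
  (hF.contDiffOn_fderiv_apply hJ (1, 0)).congr fun _ hp => hF.dx_eq hJ hp.2

theorem Smooth2.dt (hJ : IsOpen J) (hF : Smooth2 J F) : Smooth2 J (dt F) :=
  (hF.contDiffOn_fderiv_apply hJ (0, 1)).congr fun _ hp => hF.dt_eq hJ hp.2

theorem Smooth2.dt_dx (hJ : IsOpen J) (hF : Smooth2 J F) {x t : ℝ} (ht : t ∈ J) :
    IPM1D.dt (IPM1D.dx F) x t = IPM1D.dx (IPM1D.dt F) x t := by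
  set f : ℝ × ℝ → ℝ := fun p => F p.1 p.2
  have h2 : HasFDerivAt (fderiv ℝ f) (fderiv ℝ (fderiv ℝ f) (x, t)) (x, t) :=
    (((hF.contDiffAt hJ ht).fderiv_right (m := 1)
      (WithTop.coe_le_coe.2 (le_top : (1 + 1 : ℕ∞) ≤ ⊤))).differentiableAt
      one_ne_zero).hasFDerivAt
  have hap : ∀ v : ℝ × ℝ, HasFDerivAt (fun p => fderiv ℝ f p v)
      ((fderiv ℝ (fderiv ℝ f) (x, t)).flip v) (x, t) := fun v => by
    have := h2.clm_apply (hasFDerivAt_const v (x, t))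
    exact this.congr_fderiv (by ext <;> simp)
  have e1 : IPM1D.dt (IPM1D.dx F) x t = fderiv ℝ (fderiv ℝ f) (x, t) (0, 1) (1, 0) := by
    have h := hasDerivAt_partial_snd (hap (1, 0))
    refine (h.congr_of_eventuallyEq ?_).deriv
    filter_upwards [hJ.mem_nhds ht] with s hs using hF.dx_eq hJ hs
  have e2 : IPM1D.dx (IPM1D.dt F) x t = fderiv ℝ (fderiv ℝ f) (x, t) (1, 0) (0, 1) := by
    have h := hasDerivAt_partial_fst (hap (0, 1))
    refine (h.congr_of_eventuallyEq (Eventually.of_forall fun y => ?_)).deriv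
    exact hF.dt_eq hJ ht
  have hs : IsSymmSndFDerivAt ℝ f (x, t) :=
    (hF.contDiffAt hJ ht).isSymmSndFDerivAt (by
      rw [minSmoothness_of_isRCLikeNormedField]
      exact ENat.LEInfty.out)
  rw [e1, e2, hs.eq]

theorem Smooth2.exists_abs_le (hF : Smooth2 J F)
    (hp : ∀ t ∈ J, Function.Periodic (fun x => F x t) (2 * Real.pi)) {K : Set ℝ}
    (hK : IsCompact K) (hKJ : K ⊆ J) : ∃ M, 0 ≤ M ∧ ∀ t ∈ K, ∀ x, |F x t| ≤ M := by
  obtain ⟨M, hM⟩ := ((isCompact_Icc (a := (0 : ℝ)) (b := 2 * Real.pi)).prod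
    hK).exists_bound_of_continuousOn
    (hF.continuousOn.mono (prod_mono (subset_univ _) hKJ))
  refine ⟨max M 0, le_max_right _ _, fun t ht x => ?_⟩
  obtain ⟨w, hw, hzw⟩ := (hp t (hKJ ht)).exists_mem_Ico₀ Real.two_pi_pos x
  have := hM (w, t) ⟨⟨hw.1, hw.2.le⟩, ht⟩
  rw [show F x t = F w t from hzw]
  exact this.trans (le_max_left _ _)

theorem Smooth2.hasDerivAt_energy (hJ : IsOpen J) (hF : Smooth2 J F)
    {t : ℝ} (ht : t ∈ J) :
    HasDerivAt (fun t => ∫ x in (0 : ℝ)..2 * Real.pi, F x t ^ 2)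
      (∫ x in (0 : ℝ)..2 * Real.pi, 2 * F x t * IPM1D.dt F x t) t := by
  obtain ⟨K, hK, htK, hKJ⟩ := exists_compact_subset hJ ht
  have hc : ∀ {G : ℝ → ℝ → ℝ}, Smooth2 J G → ∀ s ∈ J, Continuous fun x => G x s :=
    fun hG s hs => by
      rw [← continuousOn_univ]
      exact ContinuousOn.comp (f := fun x : ℝ => (x, s)) (ContDiffOn.continuousOn hG)
        (by fun_prop) fun x _ => ⟨mem_univ _, hs⟩
  have hd := hF.dt hJ
  have hcont : ContinuousOn (fun p : ℝ × ℝ => 2 * F p.1 p.2 * IPM1D.dt F p.1 p.2) (univ ×ˢ J) :=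
    (continuousOn_const.mul hF.continuousOn).mul hd.continuousOn
  obtain ⟨M, hM⟩ := ((isCompact_Icc (a := (0 : ℝ)) (b := 2 * Real.pi)).prod
    hK).exists_bound_of_continuousOn (hcont.mono (prod_mono (subset_univ _) hKJ))
  refine (intervalIntegral.hasDerivAt_integral_of_dominated_loc_of_deriv_le (s := interior K)
    (F := fun t x => F x t ^ 2)
    (F' := fun t x => 2 * F x t * IPM1D.dt F x t) (bound := fun _ => M)
    (isOpen_interior.mem_nhds htK) ?_ ?_ ?_ ?_ ?_ ?_).2
  · filter_upwards [hJ.mem_nhds ht] with s hs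
    exact ((hc hF s hs).pow 2).aestronglyMeasurable
  · exact ((hc hF t ht).pow 2).intervalIntegrable _ _
  · exact ((continuous_const.mul (hc hF t ht)).mul (hc hd t ht)).aestronglyMeasurable
  · refine Eventually.of_forall fun x hx s hs => ?_
    rw [uIoc_of_le Real.two_pi_pos.le] at hx
    exact hM (x, s) ⟨⟨hx.1.le, hx.2⟩, interior_subset hs⟩
  · exact intervalIntegrable_const
  · refine Eventually.of_forall fun x hx s hs => ?_
    exact ((hF.hasDerivAt_dt hJ (hKJ (interior_subset hs))).pow 2).congr_deriv (by simp)

end Calculus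

theorem integral_deriv_of_smoothPeriodic {f : ℝ → ℝ} (hf : SmoothPeriodic f) :
    ∫ x in (0 : ℝ)..2 * Real.pi, deriv f x = 0 := by
  rw [intervalIntegral.integral_deriv_eq_sub' f rfl
    (fun x _ => (hf.hasDerivAt x).differentiableAt) hf.deriv.continuous.continuousOn]
  have := hf.2 0
  simp only [zero_add] at this
  rw [this, sub_self]

theorem SmoothPeriodic.mul {f h : ℝ → ℝ} (hf : SmoothPeriodic f) (hh : SmoothPeriodic h) :
    SmoothPeriodic fun x => f x * h x :=
  ⟨hf.1.mul hh.1, fun x => by simp only [hf.2 x, hh.2 x]⟩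

/-- The energy identity for the transport operator. -/
theorem integral_transport {u f G : ℝ → ℝ} (hu : SmoothPeriodic u) (hf : SmoothPeriodic f)
    (hG : Continuous G) :
    ∫ x in (0 : ℝ)..2 * Real.pi, 2 * f x * -(u x * deriv f x + G x) =
      ∫ x in (0 : ℝ)..2 * Real.pi, (deriv u x * f x ^ 2 - 2 * f x * G x) := by
  have hP : SmoothPeriodic fun x => u x * (f x * f x) := hu.mul (hf.mul hf)
  have hd : ∀ x, deriv (fun x => u x * (f x * f x)) x =
      deriv u x * f x ^ 2 + 2 * f x * (u x * deriv f x) := fun x => by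
    refine (((hu.hasDerivAt x).fun_mul ((hf.hasDerivAt x).fun_mul (hf.hasDerivAt x))).congr_deriv
      ?_).deriv
    ring
  have h0 := integral_deriv_of_smoothPeriodic hP
  have c1 := hu.continuous
  have c2 := hu.deriv.continuous
  have c3 := hf.continuous
  have c4 := hf.deriv.continuous
  rw [← sub_eq_zero, ← intervalIntegral.integral_sub]
  · rw [← neg_eq_zero, ← intervalIntegral.integral_neg]
    refine Eq.trans ?_ h0
    refine intervalIntegral.integral_congr fun x _ => ?_
    simp only [hd]
    ring
  · exact Continuous.intervalIntegrable (by fun_prop) _ _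
  · exact Continuous.intervalIntegrable (by fun_prop) _ _

/-! ### Uniqueness of smooth solutions -/

/-- Smooth solutions on an open time interval, with no initial condition. -/
structure IsSol (a g : ℝ) (J : Set ℝ) (ρ : ℝ → ℝ → ℝ) : Prop where
  smooth : Smooth2 J ρ
  slice : ∀ t ∈ J, SmoothPeriodic fun x => ρ x t
  equation : ∀ t ∈ J, ∀ x, HasDerivAt (fun s => ρ x s)
    (-((g * Ha a (fun y => ρ y t) x) * deriv (fun y => ρ y t) x)) t

theorem SmoothPeriodic.eq_zero_of_integral_sq {f : ℝ → ℝ} (hf : SmoothPeriodic f)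
    (h : ∫ x in (0 : ℝ)..2 * Real.pi, f x ^ 2 = 0) (x : ℝ) : f x = 0 := by
  have h1 := hasSum_sq_coef hf.continuous
  rw [h, mul_zero, hasSum_zero_iff_of_nonneg fun k => sq_nonneg _] at h1
  have h2 : ∀ k, coef f k = 0 := fun k => by simpa using congrFun h1 k
  have h3 := hf.hasSum_coef x
  simp only [h2, zero_mul] at h3
  exact_mod_cast h3.unique hasSum_zero

theorem SmoothPeriodic.abs_Ha_le_of_deriv_le {a : ℝ} (ha : 0 < a) {f : ℝ → ℝ}
    (hf : SmoothPeriodic f) {M N : ℝ} (hM : ∀ x, |f x| ≤ M) (hN : ∀ x, |_root_.deriv f x| ≤ N)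
      (x : ℝ) :
    |IPM1D.Ha a f x| ≤ 4 * N + M * ∫ y : ℝ, a ^ 2 / (y ^ 2 + a ^ 2) := by
  have hN0 : 0 ≤ N := (abs_nonneg _).trans (hN 0)
  -- With `δ = 1` the logarithm vanishes. The Hölder constant `2N` works because `√|x - y| ≤ 2` on
  -- the range considered.
  have h := hf.abs_Ha_le ha (Q := 2 * N) hM (fun x y hxy => ?_) one_pos le_rfl x
  · simpa [← mul_assoc, show (2 : ℝ) * 2 = 4 by norm_num] using h
  · have h1 : |f x - f y| ≤ N * |x - y| :=
      Convex.norm_image_sub_le_of_norm_deriv_le (s := univ)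
        (fun z _ => (hf.hasDerivAt z).differentiableAt) (fun z _ => hN z) convex_univ
        (mem_univ y) (mem_univ x)
    have h2 : √|x - y| ≤ 2 := Real.sqrt_le_iff.2 ⟨by norm_num, by linarith⟩
    have h3 := Real.mul_self_sqrt (abs_nonneg (x - y))
    nlinarith [mul_nonneg hN0 (mul_nonneg (Real.sqrt_nonneg |x - y|) (sub_nonneg.2 h2))]

/-- The `L²` bound of `H_a` absorbs the nonlocal term into the energy; this is the origin of `1 +
4g²`. -/
theorem SmoothPeriodic.abs_integral_le_energy {a : ℝ} (ha : 0 < a) {f h : ℝ → ℝ}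
    (hf : SmoothPeriodic f) {g A b : ℝ} (hb : 0 ≤ b)
    (hh : ∀ x, |h x| ≤ A * f x ^ 2 + b * (f x ^ 2 + (g * IPM1D.Ha a f x) ^ 2)) :
    |∫ x in (0 : ℝ)..2 * Real.pi, h x| ≤
      (A + b * (1 + 4 * g ^ 2)) * ∫ x in (0 : ℝ)..2 * Real.pi, f x ^ 2 := by
  have c1 := hf.continuous
  have c2 := (hf.Ha ha).continuous
  have i1 : IntervalIntegrable (fun x => f x ^ 2) volume 0 (2 * Real.pi) :=
    Continuous.intervalIntegrable (by fun_prop) _ _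
  have i2 : IntervalIntegrable (fun x => IPM1D.Ha a f x ^ 2) volume 0 (2 * Real.pi) :=
    Continuous.intervalIntegrable (by fun_prop) _ _
  have h1 : |∫ x in (0 : ℝ)..2 * Real.pi, h x| ≤
      ∫ x in (0 : ℝ)..2 * Real.pi, ((A + b) * f x ^ 2 + b * g ^ 2 * IPM1D.Ha a f x ^ 2) := by
    rw [← Real.norm_eq_abs]
    refine intervalIntegral.norm_integral_le_of_norm_le Real.two_pi_pos.le
      (Eventually.of_forall fun x _ => ?_) ((i1.const_mul _).add (i2.const_mul _))
    have := hh x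
    rw [Real.norm_eq_abs]
    linarith
  rw [intervalIntegral.integral_add (i1.const_mul _) (i2.const_mul _),
    intervalIntegral.integral_const_mul, intervalIntegral.integral_const_mul] at h1
  have h2 := mul_le_mul_of_nonneg_left (hf.integral_Ha_sq_le ha) (mul_nonneg hb (sq_nonneg g))
  linarith

theorem SmoothPeriodic.const_mul {f : ℝ → ℝ} (hf : SmoothPeriodic f) (c : ℝ) :
    SmoothPeriodic fun x => c * f x :=
  ⟨contDiff_const.mul hf.1, fun x => by simp only [hf.2 x]⟩

theorem abs_energy_density_le {d w v p A M : ℝ} (hd : |d| ≤ A) (hp : |p| ≤ M) :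
    |d * w ^ 2 - 2 * w * (v * p)| ≤ A * w ^ 2 + M * (w ^ 2 + v ^ 2) := by
  have h1 : |d * w ^ 2| ≤ A * w ^ 2 := by
    rw [abs_mul, abs_of_nonneg (sq_nonneg w)]
    exact mul_le_mul_of_nonneg_right hd (sq_nonneg w)
  have h2 : |2 * w * (v * p)| ≤ M * (w ^ 2 + v ^ 2) := by
    rw [show 2 * w * (v * p) = p * (2 * w * v) by ring, abs_mul]
    exact mul_le_mul hp (abs_le.2 ⟨by nlinarith [sq_nonneg (w + v)], by
      nlinarith [sq_nonneg (w - v)]⟩) (abs_nonneg _) ((abs_nonneg p).trans hp)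
  exact (abs_sub _ _).trans (add_le_add h1 h2)

/-- The time derivative of the energy of a solution of a forced transport equation. -/
theorem Smooth2.hasDerivAt_transport_energy {J : Set ℝ} {F : ℝ → ℝ → ℝ} (hJ : IsOpen J)
    (hF : Smooth2 J F) {t : ℝ} (ht : t ∈ J) (hs : SmoothPeriodic fun x => F x t) {u G : ℝ → ℝ}
    (hu : SmoothPeriodic u) (hG : Continuous G)
    (he : ∀ x, IPM1D.dt F x t = -(u x * IPM1D.dx F x t + G x)) :
    HasDerivAt (fun t => ∫ x in (0 : ℝ)..2 * Real.pi, F x t ^ 2)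
      (∫ x in (0 : ℝ)..2 * Real.pi, (deriv u x * F x t ^ 2 - 2 * F x t * G x)) t := by
  refine (hF.hasDerivAt_energy hJ ht).congr_deriv ?_
  rw [← integral_transport hu hs hG]
  exact intervalIntegral.integral_congr fun x _ => by simp only [he x]; rfl

/-- The difference `w` is transported by the velocity `u₁` of `ρ₁` and forced by `g H_a w · ∂ₓρ₂`.
On a compact time interval `∂ₓu₁` and `∂ₓρ₂` are bounded, so the energy of `w` satisfies a linear
differential inequality with zero initial value. -/
theorem IsSol.eq_of_eq_at {a g : ℝ} (ha : 0 < a) {J : Set ℝ} (hJ : IsOpen J)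
    {ρ₁ ρ₂ : ℝ → ℝ → ℝ} (h₁ : IsSol a g J ρ₁) (h₂ : IsSol a g J ρ₂) {t₀ t₁ : ℝ}
    (hsub : Icc t₀ t₁ ⊆ J) (h0 : ∀ x, ρ₁ x t₀ = ρ₂ x t₀) :
    ∀ t ∈ Icc t₀ t₁, ∀ x, ρ₁ x t = ρ₂ x t := by
  set w : ℝ → ℝ → ℝ := fun x t => ρ₁ x t - ρ₂ x t with hw
  have hwS : Smooth2 J w := ContDiffOn.sub h₁.smooth h₂.smooth
  have hws : ∀ t ∈ J, SmoothPeriodic fun x => w x t := fun t ht =>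
    (h₁.slice t ht).sub (h₂.slice t ht)
  obtain ⟨M₁, hM₁0, hM₁⟩ := (h₁.smooth.dx hJ).exists_abs_le
    (fun t ht => (h₁.slice t ht).deriv.2) isCompact_Icc hsub
  obtain ⟨N₁, hN₁0, hN₁⟩ := ((h₁.smooth.dx hJ).dx hJ).exists_abs_le
    (fun t ht => (h₁.slice t ht).deriv.deriv.2) isCompact_Icc hsub
  obtain ⟨M₂, hM₂0, hM₂⟩ := (h₂.smooth.dx hJ).exists_abs_le
    (fun t ht => (h₂.slice t ht).deriv.2) isCompact_Icc hsub
  set A : ℝ := |g| * (4 * N₁ + M₁ * ∫ y : ℝ, a ^ 2 / (y ^ 2 + a ^ 2))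
  set D : ℝ → ℝ := fun t => ∫ x in (0 : ℝ)..2 * Real.pi,
    (deriv (fun x => g * Ha a (fun y => ρ₁ y t) x) x * w x t ^ 2 -
      2 * w x t * ((g * Ha a (fun y => w y t) x) * deriv (fun y => ρ₂ y t) x))
  have hder : ∀ t ∈ J, HasDerivAt (fun t => ∫ x in (0 : ℝ)..2 * Real.pi, w x t ^ 2) (D t) t := by
    intro t ht
    have s1 := h₁.slice t ht
    have s2 := h₂.slice t ht
    refine hwS.hasDerivAt_transport_energy hJ ht (hws t ht) ((s1.Ha ha).const_mul g)
      ((((hws t ht).Ha ha).const_mul g).continuous.mul s2.deriv.continuous) fun x => ?_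
    have e1 : dt w x t = _ := ((h₁.equation t ht x).sub (h₂.equation t ht x)).deriv
    have e2 : dx w x t = deriv (fun y => ρ₁ y t) x - deriv (fun y => ρ₂ y t) x :=
      ((s1.hasDerivAt x).sub (s2.hasDerivAt x)).deriv
    have e3 : Ha a (fun y => w y t) x = _ := s1.Ha_sub ha s2 x
    rw [e1, e2, e3]
    ring
  have hbd : ∀ t ∈ Icc t₀ t₁, |D t| ≤
      (A + M₂ * (1 + 4 * g ^ 2)) * ∫ x in (0 : ℝ)..2 * Real.pi, w x t ^ 2 := by
    intro t ht
    have s1 := h₁.slice t (hsub ht)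
    refine (hws t (hsub ht)).abs_integral_le_energy ha hM₂0 fun x => ?_
    have b1 : |deriv (fun x => g * Ha a (fun y => ρ₁ y t) x) x| ≤ A := by
      rw [(((s1.Ha ha).hasDerivAt x).const_mul g).deriv, s1.deriv_Ha ha, abs_mul]
      exact mul_le_mul_of_nonneg_left
        (s1.deriv.abs_Ha_le_of_deriv_le ha (hM₁ t ht) (hN₁ t ht) x) (abs_nonneg g)
    have b2 : |deriv (fun y => ρ₂ y t) x| ≤ M₂ := hM₂ t ht x
    exact abs_energy_density_le b1 b2
  intro t ht x
  have hz := eq_zero_of_abs_deriv_le_mul_abs_self_of_eq_zero_right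
    (f := fun t => ∫ x in (0 : ℝ)..2 * Real.pi, w x t ^ 2) (f' := D)
    (K := A + M₂ * (1 + 4 * g ^ 2)) (a := t₀) (b := t₁)
    (fun t ht => (hder t (hsub ht)).continuousAt.continuousWithinAt)
    (fun t ht => (hder t (hsub (Ico_subset_Icc_self ht))).hasDerivWithinAt)
    (by simp [hw, h0]) (fun t ht => ?_) t ht
  · exact sub_eq_zero.1 ((hws t (hsub ht)).eq_zero_of_integral_sq hz x)
  · refine (hbd t (Ico_subset_Icc_self ht)).trans_eq ?_
    rw [Real.norm_eq_abs, abs_of_nonneg]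
    exact intervalIntegral.integral_nonneg Real.two_pi_pos.le fun x _ => sq_nonneg _

/-! ### The a priori bound of the second derivative -/

/-- The `C^{1/2}` bound of a periodic function by the `L²` norm of its derivative. -/
theorem SmoothPeriodic.abs_sub_le_sqrt {f : ℝ → ℝ} (hf : SmoothPeriodic f) {E : ℝ} (hE : 0 < E)
    (hfE : ∫ x in (0 : ℝ)..2 * Real.pi, _root_.deriv f x ^ 2 ≤ E) {x y : ℝ} (hxy : |x - y| ≤ 2) :
    |f x - f y| ≤ √E * √|x - y| := by
  wlog h : y ≤ x generalizing x y
  · rw [abs_sub_comm (f x), abs_sub_comm x]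
    exact this (by rwa [abs_sub_comm]) (le_of_not_ge h)
  rcases h.eq_or_lt with rfl | hlt
  · simp
  have hpos : 0 < x - y := sub_pos.2 hlt
  rw [abs_of_pos hpos] at hxy ⊢
  have hc := hf.deriv.continuous
  -- The optimal parameter in `|f'| ≤ (l/2) f'² + 1/(2l)`: it balances the two integrals and
  -- replaces the Cauchy–Schwarz inequality.
  set l : ℝ := √(x - y) / √E with hl
  have hsE : 0 < √E := Real.sqrt_pos.2 hE
  have hsx : 0 < √(x - y) := Real.sqrt_pos.2 hpos
  have hl0 : 0 < l := div_pos hsx hsE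
  have hFTC : ∫ z in y..x, _root_.deriv f z = f x - f y :=
    intervalIntegral.integral_deriv_eq_sub (fun z _ => (hf.hasDerivAt z).differentiableAt)
      (hc.intervalIntegrable _ _)
  have i1 : ∀ p q : ℝ, IntervalIntegrable (fun z => _root_.deriv f z ^ 2) volume p q := fun p q =>
    Continuous.intervalIntegrable (by fun_prop) _ _
  have h1 : |f x - f y| ≤ ∫ z in y..x, (l / 2 * _root_.deriv f z ^ 2 + 1 / (2 * l)) := by
    rw [← hFTC, ← Real.norm_eq_abs]
    refine intervalIntegral.norm_integral_le_of_norm_le h (Eventually.of_forall fun z _ => ?_)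
      (((i1 _ _).const_mul _).add intervalIntegrable_const)
    have h2 : l / 2 * _root_.deriv f z ^ 2 + 1 / (2 * l) - |_root_.deriv f z| =
        (l * |_root_.deriv f z| - 1) ^ 2 / (2 * l) := by
      rw [← sq_abs (_root_.deriv f z)]
      field_simp
      ring
    have h3 : 0 ≤ (l * |_root_.deriv f z| - 1) ^ 2 / (2 * l) := by positivity
    rw [Real.norm_eq_abs]
    linarith
  rw [intervalIntegral.integral_add ((i1 _ _).const_mul _) intervalIntegrable_const,
    intervalIntegral.integral_const_mul, intervalIntegral.integral_const, smul_eq_mul] at h1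
  have h2 : ∫ z in y..x, _root_.deriv f z ^ 2 ≤ E := by
    have hp : Function.Periodic (fun z => _root_.deriv f z ^ 2) (2 * Real.pi) := fun z => by
      simp only [hf.deriv.2 z]
    have h3 := hp.intervalIntegral_add_eq y 0
    rw [zero_add] at h3
    rw [← h3] at hfE
    refine le_trans ?_ hfE
    -- The interval has length at most `2`, hence lies within one period starting at `y`.
    refine intervalIntegral.integral_mono_interval le_rfl h (by linarith [Real.pi_gt_three])
      (Eventually.of_forall fun z => sq_nonneg _) (i1 _ _)
  have h3 := mul_le_mul_of_nonneg_left h2 (half_pos hl0).le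
  have e1 : l / 2 * E = √E * √(x - y) / 2 := by
    have := Real.mul_self_sqrt hE.le
    rw [hl]
    field_simp
    nlinarith
  have e2 : (x - y) * (1 / (2 * l)) = √E * √(x - y) / 2 := by
    have := Real.mul_self_sqrt hpos.le
    rw [hl]
    field_simp
    nlinarith
  linarith

theorem SmoothPeriodic.abs_le_supNorm {f : ℝ → ℝ} (hf : SmoothPeriodic f) (x : ℝ) :
    |f x| ≤ supNorm f := by
  obtain ⟨M, hM⟩ := exists_abs_le_of_periodic hf.continuous hf.2
  exact le_ciSup (f := fun x => |f x|) ⟨M, by rintro _ ⟨y, rfl⟩; exact hM y⟩ x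

/-- The logarithmic bound of `H_a f` by the sup norm of `f` and the `L²` norm of `f'`. -/
theorem SmoothPeriodic.abs_Ha_le_log {a : ℝ} (ha : 0 < a) {f : ℝ → ℝ} (hf : SmoothPeriodic f)
    {M E : ℝ} (hM : ∀ x, |f x| ≤ M) (hE : 1 ≤ E)
    (hfE : ∫ x in (0 : ℝ)..2 * Real.pi, _root_.deriv f x ^ 2 ≤ E) (x : ℝ) :
    |IPM1D.Ha a f x| ≤ 2 + M * Real.log E + M * ∫ y : ℝ, a ^ 2 / (y ^ 2 + a ^ 2) := by
  have hE0 : 0 < E := by linarith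
  -- The choice `δ = 1/E` makes the near part constant and turns `-log δ` into `log E`.
  have h := hf.abs_Ha_le ha hM (fun x y hxy => hf.abs_sub_le_sqrt hE0 hfE hxy) (inv_pos.2 hE0)
    (inv_le_one_of_one_le₀ hE) x
  have h1 : √E * √E⁻¹ = 1 := by
    rw [Real.sqrt_inv, mul_inv_cancel₀ (Real.sqrt_pos.2 hE0).ne']
  rw [mul_assoc, h1, Real.log_inv, neg_neg, mul_one] at h
  exact h

/-- The second derivative of a solution solves a forced transport equation. -/
theorem IsSol.dt_dx_dx {a g : ℝ} (ha : 0 < a) {J : Set ℝ} (hJ : IsOpen J) {ρ : ℝ → ℝ → ℝ}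
    (h : IsSol a g J ρ) {t : ℝ} (ht : t ∈ J) (x : ℝ) :
    dt (dx (dx ρ)) x t = -((g * Ha a (fun y => ρ y t) x) * dx (dx (dx ρ)) x t +
      (2 * (g * Ha a (fun y => dx ρ y t) x) * dx (dx ρ) x t +
        (g * Ha a (fun y => dx (dx ρ) y t) x) * dx ρ x t)) := by
  have s0 := h.slice t ht
  have s1 : SmoothPeriodic fun y => dx ρ y t := s0.deriv
  have s2 : SmoothPeriodic fun y => dx (dx ρ) y t := s1.deriv
  have u0 : ∀ x, HasDerivAt (Ha a fun y => ρ y t) (Ha a (fun y => dx ρ y t) x) x := fun x => by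
    have := (s0.Ha ha).hasDerivAt x
    rwa [s0.deriv_Ha ha] at this
  have u1 : ∀ x, HasDerivAt (Ha a fun y => dx ρ y t) (Ha a (fun y => dx (dx ρ) y t) x) x :=
    fun x => by
      have := (s1.Ha ha).hasDerivAt x
      rwa [s1.deriv_Ha ha] at this
  have r1 : ∀ x, HasDerivAt (fun y => dx ρ y t) (dx (dx ρ) x t) x := fun x => s1.hasDerivAt x
  have r2 : ∀ x, HasDerivAt (fun y => dx (dx ρ) y t) (dx (dx (dx ρ)) x t) x :=
    fun x => s2.hasDerivAt x
  have e0 : ∀ x, dt ρ x t = -((g * Ha a (fun y => ρ y t) x) * dx ρ x t) := fun x =>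
    (h.equation t ht x).deriv
  have e1 : ∀ x, dt (dx ρ) x t = -((g * Ha a (fun y => dx ρ y t) x) * dx ρ x t +
      (g * Ha a (fun y => ρ y t) x) * dx (dx ρ) x t) := fun x => by
    rw [h.smooth.dt_dx hJ ht]
    have := (((u0 x).const_mul g).fun_mul (r1 x)).fun_neg
    exact (this.congr_of_eventuallyEq (Eventually.of_forall e0)).deriv
  rw [(h.smooth.dx hJ).dt_dx hJ ht]
  have := ((((u1 x).const_mul g).fun_mul (r1 x)).fun_add
    (((u0 x).const_mul g).fun_mul (r2 x))).fun_neg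
  refine ((this.congr_of_eventuallyEq (Eventually.of_forall e1)).congr_deriv ?_).deriv
  ring

/-- In the energy identity for `∂ₓ²ρ`, integration by parts gives `+1` and the forcing `-4` times `g
H_a(∂ₓρ) (∂ₓ²ρ)²`, hence the `3`. That factor is bounded logarithmically, the term with `H_a(∂ₓ²ρ)`
in `L²`. The `1` in `E` ensures `E ≥ 1`, so that `1/E` is an admissible cut radius. -/
theorem IsSol.exists_hasDerivAt_energy {a g : ℝ} (ha : 0 < a) (hg : 0 < g) {J : Set ℝ}
    (hJ : IsOpen J) {ρ : ℝ → ℝ → ℝ} (h : IsSol a g J ρ) {t : ℝ} (ht : t ∈ J) {E b : ℝ}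
    (hE : E = 1 + ∫ x in (0 : ℝ)..2 * Real.pi, dx (dx ρ) x t ^ 2)
    (hb : ∀ x, |dx ρ x t| ≤ b) :
    ∃ D, HasDerivAt (fun t => ∫ x in (0 : ℝ)..2 * Real.pi, dx (dx ρ) x t ^ 2) D t ∧
      |D| ≤ (3 * (g * (2 + b * Real.log E + b * ∫ y : ℝ, a ^ 2 / (y ^ 2 + a ^ 2))) +
        b * (1 + 4 * g ^ 2)) * ∫ x in (0 : ℝ)..2 * Real.pi, dx (dx ρ) x t ^ 2 := by
  have s0 := h.slice t ht
  have s1 : SmoothPeriodic fun y => dx ρ y t := s0.deriv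
  have s2 : SmoothPeriodic fun y => dx (dx ρ) y t := s1.deriv
  have hb0 : 0 ≤ b := (abs_nonneg _).trans (hb 0)
  have c1 := s1.continuous
  have c2 := s2.continuous
  have c3 := (s1.Ha ha).continuous
  have c4 := (s2.Ha ha).continuous
  have hI : 0 ≤ ∫ x in (0 : ℝ)..2 * Real.pi, dx (dx ρ) x t ^ 2 :=
    intervalIntegral.integral_nonneg Real.two_pi_pos.le fun x _ => sq_nonneg _
  refine ⟨_, ((h.smooth.dx hJ).dx hJ).hasDerivAt_transport_energy hJ ht s2
    ((s0.Ha ha).const_mul g) (by fun_prop) (h.dt_dx_dx ha hJ ht), ?_⟩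
  refine s2.abs_integral_le_energy ha hb0 fun x => ?_
  have e1 : deriv (fun x => g * Ha a (fun y => ρ y t) x) x = g * Ha a (fun y => dx ρ y t) x := by
    rw [(((s0.Ha ha).hasDerivAt x).const_mul g).deriv, s0.deriv_Ha ha]; rfl
  have hA : |-3 * (g * Ha a (fun y => dx ρ y t) x)| ≤
      3 * (g * (2 + b * Real.log E + b * ∫ y : ℝ, a ^ 2 / (y ^ 2 + a ^ 2))) := by
    rw [abs_mul, abs_mul, abs_of_pos hg, abs_neg, abs_of_pos (three_pos)]
    gcongr
    exact s1.abs_Ha_le_log ha hb (by linarith)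
        (by rw [hE]; exact le_add_of_nonneg_left one_pos.le) x
  refine le_trans (le_of_eq ?_) (abs_energy_density_le hA (hb x))
  rw [e1]
  congr 1
  ring

/-- A priori bound of the second derivative in terms of `∫ ‖∂ₓρ‖_∞`. -/
theorem IsSol.exists_integral_sq_le {a g : ℝ} (ha : 0 < a) (hg : 0 < g) {T M : ℝ}
    (hT : 0 < T) {ρ : ℝ → ℝ → ℝ} (h : IsSol a g (Ioo 0 T) ρ) {b B : ℝ → ℝ}
    (hb : ∀ t ∈ Ioo 0 T, ∀ x, |dx ρ x t| ≤ b t) (hB : ∀ t ∈ Ioo 0 T, HasDerivAt B (b t) t)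
    (hB0 : ∀ t ∈ Ioo 0 T, 0 ≤ B t) (hBM : ∀ t ∈ Ioo 0 T, B t ≤ M) :
    ∃ R, 0 < R ∧ ∀ t ∈ Ico (T / 2) T, ∫ x in (0 : ℝ)..2 * Real.pi, dx (dx ρ) x t ^ 2 ≤ R := by
  set W : ℝ := ∫ y : ℝ, a ^ 2 / (y ^ 2 + a ^ 2)
  have hW : 0 ≤ W := integral_nonneg fun y => by positivity
  set I : ℝ → ℝ := fun t => ∫ x in (0 : ℝ)..2 * Real.pi, dx (dx ρ) x t ^ 2
  have hI : ∀ t, 0 ≤ I t := fun t =>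
    intervalIntegral.integral_nonneg Real.two_pi_pos.le fun x _ => sq_nonneg _
  set C : ℝ := 6 * g + 3 * g * W + 3 * g + 1 + 4 * g ^ 2
  have hC : 0 ≤ C := by positivity
  -- The energy grows at a rate of order `(1 + b) (1 + log (1 + I))`, so passing to this logarithm
  -- gives the linear inequality `Z' ≤ C (1 + b) Z`, with integrating factor `exp (-C (t + B))`.
  set Z : ℝ → ℝ := fun t => 1 + Real.log (1 + I t)
  have hlog : ∀ t, 0 ≤ Real.log (1 + I t) := fun t => Real.log_nonneg (by linarith [hI t])
  have hZ : ∀ t ∈ Ioo 0 T, ∃ D, HasDerivAt Z D t ∧ D ≤ C * (1 + b t) * Z t := by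
    intro t ht
    obtain ⟨D, hD, hDle⟩ := h.exists_hasDerivAt_energy ha hg isOpen_Ioo ht rfl (hb t ht)
    have hpos : 0 < 1 + I t := by linarith [hI t]
    refine ⟨_, ((hD.const_add 1).log hpos.ne').const_add 1, ?_⟩
    have hbt : 0 ≤ b t := (abs_nonneg _).trans (hb t ht 0)
    have hl := hlog t
    have h1 : 3 * (g * (2 + b t * Real.log (1 + I t) + b t * W)) + b t * (1 + 4 * g ^ 2) ≤
        C * (1 + b t) * Z t := by
      have e : C * (1 + b t) * Z t -
          (3 * (g * (2 + b t * Real.log (1 + I t) + b t * W)) + b t * (1 + 4 * g ^ 2)) =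
          (3 * g * W + 3 * g + 1 + 4 * g ^ 2) + b t * (9 * g) +
            C * Real.log (1 + I t) + (6 * g + 3 * g * W + 1 + 4 * g ^ 2) *
              (b t * Real.log (1 + I t)) := by
        simp only [C, Z]; ring
      have : 0 ≤ (3 * g * W + 3 * g + 1 + 4 * g ^ 2) + b t * (9 * g) +
            C * Real.log (1 + I t) + (6 * g + 3 * g * W + 1 + 4 * g ^ 2) *
              (b t * Real.log (1 + I t)) := by positivity
      linarith
    have hR : 0 ≤ C * (1 + b t) * Z t := by
      have : 0 ≤ Z t := by simp only [Z]; linarith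
      positivity
    rw [div_le_iff₀ hpos]
    calc D ≤ _ := le_abs_self D
      _ ≤ _ := hDle
      _ ≤ C * (1 + b t) * Z t * I t := mul_le_mul_of_nonneg_right h1 (hI t)
      _ ≤ C * (1 + b t) * Z t * (1 + I t) := mul_le_mul_of_nonneg_left (by linarith) hR
  choose! D hD hDle using hZ
  have hder : ∀ t ∈ Ioo 0 T, HasDerivAt (fun t => Z t * Real.exp (-(C * (t + B t))))
      ((D t - C * (1 + b t) * Z t) * Real.exp (-(C * (t + B t)))) t := by
    intro t ht
    have h1 := ((((hasDerivAt_id t).add (hB t ht)).const_mul C).fun_neg).exp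
    exact ((hD t ht).mul h1).congr_deriv (by simp only [Pi.add_apply, id]; ring)
  -- The estimate starts at the interior time `T/2`, as the equation is available here on the open
  -- interval only.
  have hsub : Ico (T / 2) T ⊆ Ioo 0 T := fun t ht => ⟨by linarith [ht.1], ht.2⟩
  have hanti : AntitoneOn (fun t => Z t * Real.exp (-(C * (t + B t)))) (Ico (T / 2) T) := by
    refine antitoneOn_of_deriv_nonpos (convex_Ico _ _)
      (fun t ht => (hder t (hsub ht)).continuousAt.continuousWithinAt)
      (fun t ht => (hder t (hsub (interior_subset ht))).differentiableAt.differentiableWithinAt)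
      fun t ht => ?_
    have ht' := hsub (interior_subset ht)
    rw [(hder t ht').deriv]
    exact mul_nonpos_of_nonpos_of_nonneg (by linarith [hDle t ht']) (Real.exp_pos _).le
  refine ⟨Real.exp (Z (T / 2) * Real.exp (C * (T + M))), Real.exp_pos _, fun t ht => ?_⟩
  have hh : T / 2 ∈ Ico (T / 2) T := ⟨le_rfl, by linarith⟩
  have h1 : Z t * Real.exp (-(C * (t + B t))) ≤
    Z (T / 2) * Real.exp (-(C * (T / 2 + B (T / 2)))) := hanti hh ht ht.1
  have hZ2 : 0 ≤ Z (T / 2) := by linarith [hlog (T / 2)]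
  have h2 : Z t ≤ Z (T / 2) * Real.exp (C * (T + M)) := by
    have h3 : Z t = Z t * Real.exp (-(C * (t + B t))) * Real.exp (C * (t + B t)) := by
      rw [mul_assoc, ← Real.exp_add]; simp
    rw [h3]
    have h4 : Real.exp (-(C * (T / 2 + B (T / 2)))) ≤ 1 :=
      Real.exp_le_one_iff.2 (neg_nonpos.2 (mul_nonneg hC
        (by linarith [hB0 _ (hsub hh)])))
    have h5 : Real.exp (C * (t + B t)) ≤ Real.exp (C * (T + M)) :=
      Real.exp_le_exp.2 (mul_le_mul_of_nonneg_left
        (by linarith [hBM t (hsub ht), ht.2]) hC)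
    exact mul_le_mul (h1.trans (mul_le_of_le_one_right hZ2 h4)) h5 (Real.exp_pos _).le hZ2
  have hpos : 0 < 1 + I t := by linarith [hI t]
  have h3 : Real.log (1 + I t) ≤ Z (T / 2) * Real.exp (C * (T + M)) := by linarith
  have := (Real.log_le_iff_le_exp hpos).1 h3
  change I t ≤ _
  linarith

/-! ### Restarting and gluing -/

section Restart

variable {a g : ℝ}

theorem IsSol.mono {J J' : Set ℝ} {ρ : ℝ → ℝ → ℝ} (h : IsSol a g J ρ) (hJ : J' ⊆ J) :
    IsSol a g J' ρ where
  smooth := ContDiffOn.mono h.smooth (prod_mono le_rfl hJ)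
  slice t ht := h.slice t (hJ ht)
  equation t ht := h.equation t (hJ ht)

/-- Local existence from an arbitrary initial time. -/
theorem exists_isSol (ha : 0 < a) (hg : 0 < g) {R : ℝ} (hR : 0 < R) :
    ∃ τ > 0, ∀ (t₀ : ℝ) (f : ℝ → ℝ), SmoothPeriodic f →
      ∫ x in (0 : ℝ)..2 * Real.pi, deriv (deriv f) x ^ 2 ≤ R →
      ∃ ρ, IsSol a g (Ioo (t₀ - τ) (t₀ + τ)) ρ ∧ ∀ x, ρ x t₀ = f x := by
  obtain ⟨τ, hτ, H⟩ := exists_local_solution ha hg hR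
  refine ⟨τ, hτ, fun t₀ f hf hfR => ?_⟩
  obtain ⟨σ, h1, h2, h3, h4⟩ := H f hf hfR
  have hmem : ∀ t ∈ Ioo (t₀ - τ) (t₀ + τ), t - t₀ ∈ Ioo (-τ) τ := fun t ht =>
    ⟨by linarith [ht.1], by linarith [ht.2]⟩
  refine ⟨fun x t => σ x (t - t₀), ⟨?_, fun t ht => h2 _ (hmem t ht), fun t ht x => ?_⟩,
    fun x => by simp [h3]⟩
  · have hφ : ContDiff ℝ ∞ fun p : ℝ × ℝ => (p.1, p.2 - t₀) := by fun_prop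
    exact h1.comp (f := fun p : ℝ × ℝ => (p.1, p.2 - t₀)) hφ.contDiffOn
      fun p hp => ⟨mem_univ _, hmem _ hp.2⟩
  · exact (h4 _ (hmem t ht) x).comp_sub_const t t₀

variable {ρ₀ : ℝ → ℝ} {T : ℝ} {ρ : ℝ → ℝ → ℝ}

theorem IsSmoothSolution.slice (h : IsSmoothSolution a g ρ₀ T ρ) {t : ℝ} (ht : t ∈ Ico 0 T) :
    SmoothPeriodic fun x => ρ x t := by
  refine ⟨?_, h.periodic t ht⟩
  rw [← contDiffOn_univ]
  have hφ : ContDiff ℝ ∞ fun x : ℝ => (x, t) := by fun_prop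
  exact h.smooth.comp (f := fun x : ℝ => (x, t)) hφ.contDiffOn fun x _ => ⟨mem_univ _, ht⟩

theorem IsSmoothSolution.isSol (h : IsSmoothSolution a g ρ₀ T ρ) : IsSol a g (Ioo 0 T) ρ where
  smooth := h.smooth.mono (prod_mono le_rfl Ioo_subset_Ico_self)
  slice t ht := h.slice (Ioo_subset_Ico_self ht)
  equation t ht x := by
    have hS : Smooth2 (Ioo 0 T) ρ := h.smooth.mono (prod_mono le_rfl Ioo_subset_Ico_self)
    have h1 := h.equation t (Ioo_subset_Ico_self ht) x
    rw [derivWithin_of_mem_nhds (Ico_mem_nhds ht.1 ht.2)] at h1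
    exact (hS.hasDerivAt_dt isOpen_Ioo ht).congr_deriv (eq_neg_of_add_eq_zero_left h1)

/-- Gluing a solution on `[0, T)` with a solution around a later time interval. -/
theorem IsSmoothSolution.glue (h : IsSmoothSolution a g ρ₀ T ρ) (hT : 0 < T) {t₀ T' : ℝ}
    (ht₀ : t₀ < T) (hT' : T < T') {σ : ℝ → ℝ → ℝ} (hσ : IsSol a g (Ioo t₀ T') σ)
    (he : ∀ t ∈ Ioo t₀ T, ∀ x, ρ x t = σ x t) : CanBeContinued a g ρ₀ T ρ := by
  set r : ℝ → ℝ → ℝ := fun x t => if t < T then ρ x t else σ x t with hr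
  have r1 : ∀ t < T, ∀ x, r x t = ρ x t := fun t ht x => if_pos ht
  -- The solutions overlap on `(t₀, T)`, so near every `t ≥ T` the glued function is `σ` on a full
  -- neighbourhood and nothing has to be matched at `T`.
  have r2 : ∀ t, t₀ < t → ∀ x, r x t = σ x t := fun t ht x => by
    by_cases h : t < T
    · rw [r1 t h, he t ⟨ht, h⟩]
    · exact if_neg h
  refine ⟨T', hT', r, ⟨?_, fun t ht => ?_, fun x => ?_, fun t ht x => ?_⟩,
      fun t ht x => r1 t ht.2 x⟩
  · rintro ⟨x, t⟩ ⟨-, ht⟩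
    rcases lt_or_ge t T with htT | htT
    · have hV : {p : ℝ × ℝ | p.2 < T} ∈ 𝓝 (x, t) :=
        (isOpen_lt continuous_snd continuous_const).mem_nhds htT
      have h1 := h.smooth (x, t) ⟨mem_univ _, ht.1, htT⟩
      have h2 : (univ : Set ℝ) ×ˢ Ico 0 T ∈ 𝓝[univ ×ˢ Ico 0 T'] (x, t) := by
        filter_upwards [self_mem_nhdsWithin, mem_nhdsWithin_of_mem_nhds hV] with p hp1 hp2
        exact ⟨mem_univ _, hp1.2.1, hp2⟩
      refine (h1.mono_of_mem_nhdsWithin h2).congr_of_eventuallyEq ?_ (r1 t htT x)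
      filter_upwards [mem_nhdsWithin_of_mem_nhds hV] with p hp using r1 p.2 hp p.1
    · have htt : t₀ < t := ht₀.trans_le htT
      have hV : {p : ℝ × ℝ | t₀ < p.2} ∈ 𝓝 (x, t) :=
        (isOpen_lt continuous_const continuous_snd).mem_nhds htt
      refine ((hσ.smooth.contDiffAt isOpen_Ioo ⟨htt, ht.2⟩).congr_of_eventuallyEq
        ?_).contDiffWithinAt
      filter_upwards [hV] with p hp using r2 p.2 hp p.1
  · rcases lt_or_ge t T with htT | htT
    · simp only [r1 t htT]
      exact h.periodic t ⟨ht.1, htT⟩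
    · simp only [r2 t (ht₀.trans_le htT)]
      exact (hσ.slice t ⟨ht₀.trans_le htT, ht.2⟩).2
  · rw [r1 0 hT, h.initial]
  · rcases lt_or_ge t T with htT | htT
    · have h1 := h.equation t ⟨ht.1, htT⟩ x
      simp only [r1 t htT]
      refine Eq.trans (congrArg (· + _) ?_) h1
      have h2 : (fun s => r x s) =ᶠ[𝓝[Ico 0 T'] t] fun s => ρ x s := by
        filter_upwards [mem_nhdsWithin_of_mem_nhds (Iio_mem_nhds htT)] with s hs using r1 s hs x
      rw [h2.derivWithin_eq (r1 t htT x)]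
      refine derivWithin_congr_set ?_
      filter_upwards [Iio_mem_nhds htT] with s hs
      exact propext ⟨fun h => ⟨h.1, hs⟩, fun h => ⟨h.1, h.2.trans hT'⟩⟩
    · have htt : t₀ < t := ht₀.trans_le htT
      have h1 := hσ.equation t ⟨htt, ht.2⟩ x
      have h2 : (fun s => r x s) =ᶠ[𝓝 t] fun s => σ x s := by
        filter_upwards [Ioi_mem_nhds htt] with s hs using r2 s hs x
      rw [derivWithin_of_mem_nhds (Ico_mem_nhds (hT.trans_le htT) ht.2),
        (h1.congr_of_eventuallyEq h2).deriv]
      simp only [r2 t htt]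
      ring

/-- A bound of the second derivative near `T` allows continuation past `T`. -/
theorem IsSmoothSolution.canBeContinued (ha : 0 < a) (hg : 0 < g) (hT : 0 < T)
    (h : IsSmoothSolution a g ρ₀ T ρ) {R : ℝ} (hR : 0 < R)
    (hρR : ∀ t ∈ Ico (T / 2) T, ∫ x in (0 : ℝ)..2 * Real.pi, dx (dx ρ) x t ^ 2 ≤ R) :
    CanBeContinued a g ρ₀ T ρ := by
  obtain ⟨τ, hτ, H⟩ := exists_isSol ha hg hR
  -- Late enough that `t₀ + τ > T`, and not before `T/2`, where the bound `R` begins to hold.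
  set t₀ := max (T / 2) (T - τ / 2)
  have h1 : T / 2 ≤ t₀ := le_max_left _ _
  have h2 : T - τ / 2 ≤ t₀ := le_max_right _ _
  have h3 : t₀ < T := max_lt (by linarith) (by linarith)
  obtain ⟨σ, hσ, hσ0⟩ := H t₀ _ (h.slice ⟨by linarith, h3⟩) (hρR t₀ ⟨h1, h3⟩)
  refine h.glue hT h3 (T' := t₀ + τ) (by linarith)
    (hσ.mono (Ioo_subset_Ioo_left (by linarith))) fun t ht x => ?_
  -- Uniqueness requires an open interval around `t₀` on which both solutions live.
  have hJ₁ : Ioo (max 0 (t₀ - τ)) T ⊆ Ioo 0 T := Ioo_subset_Ioo_left (le_max_left _ _)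
  have hJ₂ : Ioo (max 0 (t₀ - τ)) T ⊆ Ioo (t₀ - τ) (t₀ + τ) :=
    Ioo_subset_Ioo (le_max_right _ _) (by linarith)
  refine (h.isSol.mono hJ₁).eq_of_eq_at ha isOpen_Ioo (hσ.mono hJ₂) (t₁ := t)
    (fun s hs => ⟨?_, hs.2.trans_lt ht.2⟩) (fun x => (hσ0 x).symm) t ⟨ht.1.le, le_rfl⟩ x
  exact (max_lt (by linarith) (by linarith)).trans_le hs.1

/-- Periodicity reduces the supremum to a compact period, and the supremum of a jointly continuous
function over a compact set depends continuously on the parameter. -/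
theorem continuousOn_supNorm {S : Set ℝ} {G : ℝ → ℝ → ℝ}
    (hG : ContinuousOn (fun p : ℝ × ℝ => G p.1 p.2) (univ ×ˢ S))
    (hp : ∀ t ∈ S, Function.Periodic (fun x => G x t) (2 * Real.pi)) :
    ContinuousOn (fun t => supNorm fun x => G x t) S := by
  rw [continuousOn_iff_continuous_domRestrict]
  have h1 : Continuous (Function.uncurry fun (s : S) (x : ℝ) => |G x s|) := by
    refine Continuous.abs ?_
    exact hG.comp_continuous (f := fun q : S × ℝ => (q.2, (q.1 : ℝ))) (by fun_prop)
      fun q => ⟨mem_univ _, q.1.2⟩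
  refine (IsCompact.continuous_sSup (f := fun (s : S) (x : ℝ) => |G x s|)
    (isCompact_Icc (a := (0 : ℝ)) (b := 0 + 2 * Real.pi)) h1).congr
    fun s => ?_
  have h2 : Function.Periodic (fun x => |G x s|) (2 * Real.pi) := fun x => by
    have := hp s s.2 x
    simp only at this
    simp only [this]
  rw [h2.image_Icc Real.two_pi_pos]
  rfl

/-- Continuity includes the initial time, where only the derivative within `ℝ × [0, T)` is
available; its value in the direction `(1, 0)` is still the ordinary `x`-derivative. This makes the
time integral from `0` meaningful. -/
theorem IsSmoothSolution.continuousOn_dx (h : IsSmoothSolution a g ρ₀ T ρ) :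
    ContinuousOn (fun p : ℝ × ℝ => dx ρ p.1 p.2) (univ ×ˢ Ico 0 T) := by
  set f : ℝ × ℝ → ℝ := fun p => ρ p.1 p.2
  have hU : UniqueDiffOn ℝ ((univ : Set ℝ) ×ˢ Ico 0 T) :=
      uniqueDiffOn_univ.prod (uniqueDiffOn_Ico 0 T)
  have h1 := h.smooth.continuousOn_fderivWithin hU (by simp)
  refine (h1.clm_apply (continuousOn_const (c := ((1 : ℝ), (0 : ℝ))))).congr ?_
  rintro ⟨x, t⟩ ⟨-, ht⟩
  have h2 := ((h.smooth.differentiableOn (by simp)) (x, t) ⟨mem_univ _, ht⟩).hasFDerivWithinAt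
  have h3 := h2.comp_hasDerivWithinAt (f := fun y : ℝ => (y, t)) (s := univ) x
    ((hasDerivAt_id x).prodMk (hasDerivAt_const x t)).hasDerivWithinAt
    fun y _ => ⟨mem_univ _, ht⟩
  rw [hasDerivWithinAt_univ] at h3
  exact h3.deriv

end Restart

end IPM1D

/-! ### The continuation criterion -/

theorem mainTheorem4 (a g : ℝ) (ha : 0 < a) (hg : 0 < g)
    (ρ₀ : ℝ → ℝ) (hρ₀ : IPM1D.SmoothPeriodic ρ₀)
    (T : ℝ) (hT : 0 < T)
    (ρ : ℝ → ℝ → ℝ) (hρ : IPM1D.IsSmoothSolution a g ρ₀ T ρ)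
    (hmax : ¬ IPM1D.CanBeContinued a g ρ₀ T ρ) :
    (∀ t ∈ Set.Ico 0 T, IntervalIntegrable
      (fun s => IPM1D.supNorm (deriv (fun x => ρ x s))) MeasureTheory.volume 0 t) ∧
    Filter.Tendsto (fun t => ∫ s in (0 : ℝ)..t, IPM1D.supNorm (deriv (fun x => ρ x s)))
      (nhdsWithin T (Set.Iio T)) Filter.atTop := by
  set b : ℝ → ℝ := fun s => IPM1D.supNorm (deriv (fun x => ρ x s))
  have hb : ∀ t ∈ Ico 0 T, ∀ x, |IPM1D.dx ρ x t| ≤ b t := fun t ht x =>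
    (hρ.slice ht).deriv.abs_le_supNorm x
  have hbc : ContinuousOn b (Ico 0 T) :=
    IPM1D.continuousOn_supNorm hρ.continuousOn_dx fun t ht => (hρ.slice ht).deriv.2
  have hint : ∀ t ∈ Ico 0 T, IntervalIntegrable b volume 0 t := fun t ht =>
    (hbc.mono (by rw [uIcc_of_le ht.1]; exact Icc_subset_Ico_right ht.2)).intervalIntegrable
  refine ⟨hint, tendsto_atTop.2 fun M => ?_⟩
  by_contra hne
  have hb0 : ∀ t ∈ Ico 0 T, 0 ≤ b t := fun t ht => (abs_nonneg _).trans (hb t ht 0)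
  -- The integral is nondecreasing in `t`: had it exceeded `M` once, it would do so at all later
  -- times, against the failure of divergence.
  have hBM : ∀ t ∈ Ico 0 T, ∫ s in (0 : ℝ)..t, b s ≤ M := by
    intro t ht
    by_contra! hlt
    refine hne ?_
    filter_upwards [Ioo_mem_nhdsLT ht.2] with s hs
    refine hlt.le.trans (intervalIntegral.integral_mono_interval le_rfl ht.1 hs.1.le ?_
      (hint s ⟨ht.1.trans hs.1.le, hs.2⟩))
    refine (ae_restrict_iff' measurableSet_Ioc).2 (Eventually.of_forall fun r hr => ?_)
    exact hb0 r ⟨hr.1.le, hr.2.trans_lt hs.2⟩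
  have hB : ∀ t ∈ Ioo 0 T, HasDerivAt (fun t => ∫ s in (0 : ℝ)..t, b s) (b t) t := fun t ht =>
    intervalIntegral.integral_hasDerivAt_right (hint t (Ioo_subset_Ico_self ht))
      ((hbc.mono Ioo_subset_Ico_self).stronglyMeasurableAtFilter isOpen_Ioo t ht)
      (hbc.continuousAt (Ico_mem_nhds ht.1 ht.2))
  obtain ⟨R, hR, hRle⟩ := hρ.isSol.exists_integral_sq_le ha hg hT
    (fun t ht => hb t (Ioo_subset_Ico_self ht)) hB
    (fun t ht => intervalIntegral.integral_nonneg ht.1.le fun s hs =>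
      hb0 s ⟨hs.1, hs.2.trans_lt ht.2⟩)
    (fun t ht => hBM t (Ioo_subset_Ico_self ht))
  exact hmax (hρ.canBeContinued ha hg hT hR hRle)
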